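/- An Ising model on $n$ nodes is given by a real symmetric $n\times n$ matrix $J$; its partition function is $Z=\sum_{x\in\{\pm1\}^n}\exp\bigl(\sum_{i,j=1}^n J_{i,j}x_ix_j\bigr)$, and $\|\vec J\|_1=\sum_{i,j}|J_{i,j}|$. The model is regular with parameter $J'$ if $\sum_j|J_{i,j}|=J'$ for every $i$. For $J'>0$ its normalized adjacency matrix $J_D$ has entries $J_{i,j}/J'$, and for $\delta>0$ its $\delta$-sum-of-squares threshold rank is $t_\delta=\sum_{i:|\lambda_i|>\delta}\lambda_i^2$, where $\lambda_1,\dots,\lambda_n$ are the eigenvalues of $J_D$ with multiplicity. Algorithms are deterministic programs for a real random access machine: the memory consists of cells for natural numbers and cells for real numbers, with indirect addressing; the basic operations are addition and truncated subtraction of natural numbers, $+,-,\times,/$ on reals (with $x/0=0$), the conversion of a natural number to a real, loading of integer or rational constants, comparisons, and probing an entry $J_{i,j}$, each at cost one step. The input consists of $n$, $\epsilon$ and probe access to $J$. Theorem. There are a universal constant $C>0$, a single algorithm, and universal constants $A,B\in\mathbb R$, $k,l\in\mathbb N$ such that the following holds. Let $\epsilon>0$, let $J$ be a regular Ising model on $n$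 nodes with parameter $J'\ge1$, let $t=t_{\epsilon/2}$ be its $\epsilon/2$-sum-of-squares threshold rank, and suppose that $n\ge 2^{Ct/\epsilon^2}$. Then on input $(n,\epsilon,J)$ the algorithm halts and outputs a real number $a$ with $$|a-\log Z|\le\epsilon\|\vec J\|_1,$$ after at most $$2^{A\,\frac{t}{\epsilon^2}\,\log^k\left(2+\frac{t}{\epsilon^2}\right)}+B\left(n+t+\frac1\epsilon+1\right)^l$$ steps, that is, in time $2^{\tilde O(t/\epsilon^2)}+\mathrm{poly}(n,t,1/\epsilon)$. -/

import Mathlib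

/-! ## Ising models -/

/-- The interaction data of an Ising model on `n` nodes: an arbitrary real symmetric matrix. -/
structure IsingModel (n : ℕ) where
  J : Matrix (Fin n) (Fin n) ℝ
  symm : J.IsSymm

namespace IsingModel

variable {n : ℕ}

/-- The partition function `Z = ∑_{x ∈ {±1}ⁿ} exp (∑_{i,j} J i j * x i * x j)`.
The type `ℤˣ` consists of exactly the two integers `1` and `-1`. -/
noncomputable def partitionFunction (M : IsingModel n) : ℝ :=
  ∑ x : Fin n → ℤˣ, Real.exp (∑ i, ∑ j, M.J i j * ((x i : ℤ) : ℝ) * ((x j : ℤ) : ℝ))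

/-- The entrywise `L¹` norm of the interaction matrix. -/
noncomputable def l1Norm (M : IsingModel n) : ℝ := ∑ i, ∑ j, |M.J i j|

/-- The model is regular with common absolute row sum `J'`. -/
def IsRegular (M : IsingModel n) (J' : ℝ) : Prop := ∀ i, ∑ j, |M.J i j| = J'

/-- The matrix with entries `J i j / J'`. -/
noncomputable def normalizedAdjacency (M : IsingModel n) (J' : ℝ) : Matrix (Fin n) (Fin n) ℝ :=
  Matrix.of fun i j => M.J i j / J'

theorem normalizedAdjacency_isHermitian (M : IsingModel n) (J' : ℝ) :
    (M.normalizedAdjacency J').IsHermitian := by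
  ext i j
  have h := M.symm.apply i j
  simp [normalizedAdjacency, h]

open Classical in
/-- The `δ`-sum-of-squares threshold rank: the sum of `λ ^ 2` over the eigenvalues `λ` (listed with
multiplicity) of the normalized adjacency matrix that satisfy `|λ| > δ`. -/
noncomputable def thresholdRank (M : IsingModel n) (J' δ : ℝ) : ℝ :=
  ∑ i ∈ Finset.univ.filter
      (fun i => |(M.normalizedAdjacency_isHermitian J').eigenvalues i| > δ),
    (M.normalizedAdjacency_isHermitian J').eigenvalues i ^ 2

/-- The interaction matrix as a table that can be probed at any pair of natural numbers; probes
outside the matrix return `0`. -/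
noncomputable def entry (M : IsingModel n) (i j : ℕ) : ℝ :=
  if h : i < n ∧ j < n then M.J ⟨i, h.1⟩ ⟨j, h.2⟩ else 0

end IsingModel

/-! ## A deterministic real random access machine

The memory has two banks, one of natural numbers (counters and addresses) and one of real numbers,
both with indirect addressing.  Programs are finite structured texts; one basic operation, one
probe of the input matrix or one evaluation of a test costs one step.  There is no rounding of
reals to integers, and the only real constants in a program text are rational. -/

namespace RealRAM

/-- The memory: `nat a` and `real a` are the contents of the cells with address `a`. -/
structure State where
  nat : ℕ → ℕ
  real : ℕ → ℝ

/-- Basic instructions; all arguments named `a b c` are addresses of cells. -/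
inductive Instr where
  | natConst (a k : ℕ)
  | natAdd (a b c : ℕ)
  | natSub (a b c : ℕ)
  | natLoad (a b : ℕ)
  | natStore (a b : ℕ)
  | realConst (a : ℕ) (q : ℚ)
  | realAdd (a b c : ℕ)
  | realSub (a b c : ℕ)
  | realMul (a b c : ℕ)
  | realDiv (a b c : ℕ)
  | realLoad (a b : ℕ)
  | realStore (a b : ℕ)
  | natToReal (a b : ℕ)
  | probe (a b c : ℕ)

/-- Tests for branching and loops. -/
inductive Test where
  | natLE (a b : ℕ)
  | realLE (a b : ℕ)

/-- Program texts. -/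
inductive Program where
  | instr (i : Instr)
  | seq (p q : Program)
  | ite (b : Test) (p q : Program)
  | while (b : Test) (p : Program)

/-- Write a value into a cell of the bank of natural numbers. -/
def State.setNat (s : State) (a v : ℕ) : State := { s with nat := Function.update s.nat a v }

/-- Write a value into a cell of the bank of real numbers. -/
noncomputable def State.setReal (s : State) (a : ℕ) (v : ℝ) : State :=
  { s with real := Function.update s.real a v }

/-- The effect of a basic instruction when the input table is `A`. -/
noncomputable def Instr.exec (A : ℕ → ℕ → ℝ) (s : State) : Instr → State
  | .natConst a k => s.setNat a k
  | .natAdd a b c => s.setNat a (s.nat b + s.nat c)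
  | .natSub a b c => s.setNat a (s.nat b - s.nat c)
  | .natLoad a b => s.setNat a (s.nat (s.nat b))
  | .natStore a b => s.setNat (s.nat a) (s.nat b)
  | .realConst a q => s.setReal a (q : ℝ)
  | .realAdd a b c => s.setReal a (s.real b + s.real c)
  | .realSub a b c => s.setReal a (s.real b - s.real c)
  | .realMul a b c => s.setReal a (s.real b * s.real c)
  | .realDiv a b c => s.setReal a (s.real b / s.real c)
  | .realLoad a b => s.setReal a (s.real (s.nat b))
  | .realStore a b => s.setReal (s.nat a) (s.real b)
  | .natToReal a b => s.setReal a (s.nat b : ℝ)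
  | .probe a b c => s.setReal a (A (s.nat b) (s.nat c))

/-- The truth of a test in a memory state. -/
def Test.Holds (s : State) : Test → Prop
  | .natLE a b => s.nat a ≤ s.nat b
  | .realLE a b => s.real a ≤ s.real b

/-- `Runs A p s T s'`: with input table `A`, the program `p` started in the memory state `s` halts
after exactly `T` steps in the memory state `s'`. -/
inductive Runs (A : ℕ → ℕ → ℝ) : Program → State → ℕ → State → Prop where
  | instr (i : Instr) (s : State) : Runs A (.instr i) s 1 (i.exec A s)
  | seq {p q : Program} {s s' s'' : State} {T T' : ℕ} :
      Runs A p s T s' → Runs A q s' T' s'' → Runs A (.seq p q) s (T + T') s''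
  | iteTrue {b : Test} {p q : Program} {s s' : State} {T : ℕ} :
      b.Holds s → Runs A p s T s' → Runs A (.ite b p q) s (T + 1) s'
  | iteFalse {b : Test} {p q : Program} {s s' : State} {T : ℕ} :
      ¬ b.Holds s → Runs A q s T s' → Runs A (.ite b p q) s (T + 1) s'
  | whileFalse {b : Test} {p : Program} {s : State} :
      ¬ b.Holds s → Runs A (.while b p) s 1 s
  | whileTrue {b : Test} {p : Program} {s s' s'' : State} {T T' : ℕ} :
      b.Holds s → Runs A p s T s' → Runs A (.while b p) s' T' s'' →
        Runs A (.while b p) s (T + T' + 1) s''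

/-- The initial memory on input `(n, ε)`: natural cell `0` holds `n`, real cell `0` holds `ε`, and
all other cells hold `0`. -/
noncomputable def initial (n : ℕ) (ε : ℝ) : State where
  nat := Function.update (fun _ => 0) 0 n
  real := Function.update (fun _ => 0) 0 ε

/-- Started on the input `(n, ε)`, with `M` given as a table that can be probed, the program `p`
halts after exactly `T` steps with the real number `out` in real cell `0`. -/
def Computes (p : Program) {n : ℕ} (M : IsingModel n) (ε : ℝ) (T : ℕ) (out : ℝ) : Prop :=
  ∃ s : State, Runs M.entry p (initial n ε) T s ∧ s.real 0 = out

end RealRAM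

/-! ### Program logic for the machine and natural number expressions -/

namespace RealRAM

/-! Write e = εJ', c = e²/2 and s = t/ε². Regularity gives ε‖J‖₁ = e·n, so an additive error e·n is
allowed.

Low rank part. J is split as Q + ∑_{i<r} W_i V_iᵀ/|V_i|² with orthogonal V_i, W_i = J V_i, |W_i|² ≥
c|V_i|² and ‖Q‖ ≤ 0.8e; dropping Q then costs at most 0.8·e·n on the cube. The V_i arise from 2n
steps of power iteration with QᵀQ/c, started at the standard unit vectors. Moments of a positive
semidefinite matrix are log-convex, so a unit vector that has grown has a large Rayleigh quotient
(`le_mulVec_of_one_lt`), and if no unit vector grows then Q has small norm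
(`mulVec_le_of_forall_le_one`). No eigenvalue is ever computed. With ρ = e⁻² ∑ |W_i|²/|V_i|², an
expansion in the eigenbasis and Bessel's inequality give r/2 ≤ ρ ≤ s + r/4, hence r ≤ 4s and ρ ≤ 2s
(`sum_mulVec_le`, `Deflation.bounds`).

Minimax formula. The rank r form is polarised into ∑ h_i((P_i·x)² - (R_i·x)²). Replacing each square
by a tangent at z⁺ or z⁻ leaves a sum over independent spins, whose logarithm is the function
`dual`. Tangents bound -(R_i·x)² from above for every z⁻, and they lose little on (P_i·x)² if z⁺
runs through a fine grid; so log Z is at most the max over z⁺ of the min over z⁻, up to rounding and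
the logarithm of the grid size (`log_sum_exp_form_le`). Conversely, for fixed z⁺ the minimiser in z⁻
solves mean field equations, and the corresponding product measure in the Gibbs variational
principle bounds `dual` by log Z, up to a diagonal term coming from x_j² = 1 (`exists_mean_field`,
`exists_dual_le`). The max-min over a grid with K^r points, K of order 1 + ρ², is therefore the
answer.

Size of n. All errors other than that of Q are small against e·n because n is exponentially large in
s and nε² ≥ 1; the latter follows from the hypothesis on n (`one_le_card_mul_sq`).

Machine. The function log(2 cosh y) is replaced by a rational expression whose error is uniform in
y, so that the running time does not depend on J'. The algorithm is written in a small language with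
bounded loops and compiled; a program costs a polynomial in the length L of its longest loop
(`Stmt.exists_computes`). Here L is of order n + K^r, and K^r ≤ (2 + s)^(60s). -/

/-- The program `p`, started in `s`, halts after at most `c` steps in a state satisfying `Q`. -/
def Reaches (A : ℕ → ℕ → ℝ) (p : Program) (s : State) (c : ℕ) (Q : State → Prop) : Prop :=
  ∃ T s', Runs A p s T s' ∧ T ≤ c ∧ Q s'

section Reaches

variable {A : ℕ → ℕ → ℝ}

theorem Reaches.mono {p : Program} {s : State} {c c' : ℕ} {Q Q' : State → Prop}
    (h : Reaches A p s c Q) (hc : c ≤ c') (hQ : ∀ s, Q s → Q' s) : Reaches A p s c' Q' := by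
  obtain ⟨T, s', hr, hT, hq⟩ := h
  exact ⟨T, s', hr, hT.trans hc, hQ _ hq⟩

theorem Reaches.instr {i : Instr} {s : State} {Q : State → Prop} (h : Q (i.exec A s)) :
    Reaches A (.instr i) s 1 Q :=
  ⟨1, _, .instr i s, le_rfl, h⟩

theorem Reaches.seq {p q : Program} {s : State} {c c' : ℕ} {Q Q' : State → Prop}
    (h : Reaches A p s c Q) (h' : ∀ s', Q s' → Reaches A q s' c' Q') :
    Reaches A (.seq p q) s (c + c') Q' := by
  obtain ⟨T, s', hr, hT, hq⟩ := h
  obtain ⟨T', s'', hr', hT', hq'⟩ := h' s' hq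
  exact ⟨T + T', s'', .seq hr hr', Nat.add_le_add hT hT', hq'⟩

theorem Reaches.ite {b : Test} {p q : Program} {s : State} {c : ℕ} {Q : State → Prop}
    (h : b.Holds s → Reaches A p s c Q) (h' : ¬ b.Holds s → Reaches A q s c Q) :
    Reaches A (.ite b p q) s (c + 1) Q := by
  by_cases hb : b.Holds s
  · obtain ⟨T, s', hr, hT, hq⟩ := h hb
    exact ⟨T + 1, s', .iteTrue hb hr, Nat.add_le_add_right hT 1, hq⟩
  · obtain ⟨T, s', hr, hT, hq⟩ := h' hb
    exact ⟨T + 1, s', .iteFalse hb hr, Nat.add_le_add_right hT 1, hq⟩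

/-- A loop with invariant `I` that is executed exactly `m` times. -/
theorem Reaches.loop {b : Test} {p : Program} {c m : ℕ} (I : ℕ → State → Prop)
    (hstep : ∀ i < m, ∀ s, I i s → b.Holds s ∧ Reaches A p s c (I (i + 1)))
    (hend : ∀ s, I m s → ¬ b.Holds s) {s : State} (h0 : I 0 s) :
    Reaches A (.while b p) s (m * (c + 1) + 1) (I m) := by
  -- Induction on the number k of rounds that remain; the final unit of cost is the failing test.
  have key : ∀ k ≤ m, ∀ s, I (m - k) s → Reaches A (.while b p) s (k * (c + 1) + 1) (I m) := by
    intro k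
    induction k with
    | zero => exact fun _ s hs => ⟨1, s, .whileFalse (hend s hs), by simp, hs⟩
    | succ k ih =>
      intro hk s hs
      obtain ⟨hb, T, s', hr, hT, hq⟩ := hstep _ (by omega) s hs
      rw [show m - (k + 1) + 1 = m - k by omega] at hq
      obtain ⟨T', s'', hr', hT', hq'⟩ := ih (by omega) s' hq
      refine ⟨T + T' + 1, s'', .whileTrue hb hr hr', ?_, hq'⟩
      have : (k + 1) * (c + 1) = k * (c + 1) + (c + 1) := by ring
      omega
  exact key m le_rfl s (by simpa using h0)

/-- A nonempty straight-line program. -/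
def Program.block : Instr → List Instr → Program
  | i, [] => .instr i
  | i, j :: l => .seq (.instr i) (block j l)

theorem Reaches.block {i : Instr} {l : List Instr} {s : State} {Q : State → Prop}
    (h : Q ((i :: l).foldl (fun s i => i.exec A s) s)) :
    Reaches A (.block i l) s (l.length + 1) Q := by
  induction l generalizing i s with
  | nil => exact .instr h
  | cons j l ih =>
    have := Reaches.seq (A := A) (p := .instr i) (q := .block j l) (s := s) (Q' := Q)
      (Q := fun s' => s' = i.exec A s) (c := 1) (c' := l.length + 1) (.instr rfl)
      (fun s' hs' => ih (by subst hs'; exact h))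
    exact this.mono (by simp; omega) fun _ h => h

end Reaches

/-! ### A language with bounded loops

Variables of the language live in the even cells of the machine, temporaries in the odd cells. -/

/-- Expressions for natural numbers.  `fold v a b i e` starts with the value of `i` and, for `v`
running through the numbers below `b`, replaces the value by that of `e`, in which the variable `a`
stands for the current value. -/
inductive NatExpr where
  | const (k : ℕ)
  | var (i : ℕ)
  | add (x y : NatExpr)
  | sub (x y : NatExpr)
  | fold (v a : ℕ) (b i e : NatExpr)

namespace NatExpr

open Function

/-- The value of an expression. -/
def eval : NatExpr → (ℕ → ℕ) → ℕ
  | const k, _ => k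
  | var i, σ => σ i
  | add x y, σ => x.eval σ + y.eval σ
  | sub x y, σ => x.eval σ - y.eval σ
  | fold v a b i e, σ =>
      Nat.rec (i.eval σ) (fun k z => e.eval (update (update σ v k) a z)) (b.eval σ)

/-- All loops in the evaluation run at most `L` times. -/
def Ok (L : ℕ) : NatExpr → (ℕ → ℕ) → Prop
  | const _, _ => True
  | var _, _ => True
  | add x y, σ => x.Ok L σ ∧ y.Ok L σ
  | sub x y, σ => x.Ok L σ ∧ y.Ok L σ
  | fold v a b i e, σ => v ≠ a ∧ b.Ok L σ ∧ b.eval σ ≤ L ∧ i.Ok L σ ∧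
      ∀ k < b.eval σ, ∀ z, e.Ok L (update (update σ v k) a z)

/-- A bound for the number of steps if all loops run at most `L` times. -/
def cost (L : ℕ) : NatExpr → ℕ
  | const _ => 1
  | var _ => 2
  | add x y => x.cost L + y.cost L + 1
  | sub x y => x.cost L + y.cost L + 1
  | fold _ _ b i e => b.cost L + i.cost L + (L * (e.cost L + 5) + 1) + 15

/-- The program that evaluates an expression with the temporaries from number `d` on, leaving the
value in temporary `d`. -/
def compile : NatExpr → ℕ → Program
  | const k, d => .instr (.natConst (2 * d + 1) k)
  | var i, d => .block (.natConst (2 * d + 1) 0) [.natAdd (2 * d + 1) (2 * d + 1) (2 * i)]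
  | add x y, d => .seq (.seq (x.compile d) (y.compile (d + 1)))
      (.instr (.natAdd (2 * d + 1) (2 * d + 1) (2 * (d + 1) + 1)))
  | sub x y, d => .seq (.seq (x.compile d) (y.compile (d + 1)))
      (.instr (.natSub (2 * d + 1) (2 * d + 1) (2 * (d + 1) + 1)))
  | fold v a b i e, d =>
      .seq (.seq (.seq (.seq (b.compile d) (i.compile (d + 1)))
        -- There is no move instruction, so copies are additions to zero. Temporary d + 5 is first
        -- this zero and later the counter; d + 2 and d + 3 save the variables v and a, and d + 4
        -- holds the constant 1.
        (.block (.natConst (2 * (d + 5) + 1) 0)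
          [.natAdd (2 * (d + 2) + 1) (2 * (d + 5) + 1) (2 * v),
           .natAdd (2 * (d + 3) + 1) (2 * (d + 5) + 1) (2 * a),
           .natConst (2 * (d + 4) + 1) 1,
           .natConst (2 * v) 0,
           .natAdd (2 * a) (2 * (d + 5) + 1) (2 * (d + 1) + 1),
           .natConst (2 * (d + 5) + 1) 1]))
        (.while (.natLE (2 * (d + 5) + 1) (2 * d + 1))
          (.seq (e.compile (d + 6))
            (.block (.natConst (2 * a) 0)
              [.natAdd (2 * a) (2 * a) (2 * (d + 6) + 1),
               .natAdd (2 * v) (2 * v) (2 * (d + 4) + 1),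
               .natAdd (2 * (d + 5) + 1) (2 * (d + 5) + 1) (2 * (d + 4) + 1)]))))
        (.block (.natConst (2 * d + 1) 0)
          [.natAdd (2 * d + 1) (2 * d + 1) (2 * a),
           .natConst (2 * v) 0,
           .natAdd (2 * v) (2 * v) (2 * (d + 2) + 1),
           .natConst (2 * a) 0,
           .natAdd (2 * a) (2 * a) (2 * (d + 3) + 1)])

/-- The effect of evaluating an expression for natural numbers with temporaries from `d` on. -/
def Post (d : ℕ) (s : State) (x : ℕ) (s' : State) : Prop :=
  s'.real = s.real ∧ (∀ i, s'.nat (2 * i) = s.nat (2 * i)) ∧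
    (∀ i < d, s'.nat (2 * i + 1) = s.nat (2 * i + 1)) ∧ s'.nat (2 * d + 1) = x

/-- The second operand only uses temporaries from d + 1 on, so the first value survives in temporary
d. -/
theorem Post.pair {A : ℕ → ℕ → ℝ} {p q : Program} {d c c' x y : ℕ} {s : State}
    (hp : Reaches A p s c (Post d s x))
    (hq : ∀ s', Post d s x s' → Reaches A q s' c' (Post (d + 1) s' y)) :
    Reaches A (.seq p q) s (c + c') fun s' => Post d s x s' ∧ s'.nat (2 * (d + 1) + 1) = y := by
  refine hp.seq fun s' hs' => (hq s' hs').mono le_rfl fun s'' hs'' => ?_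
  exact ⟨⟨hs''.1.trans hs'.1, fun i => (hs''.2.1 i).trans (hs'.2.1 i),
    fun i hi => (hs''.2.2.1 i (by omega)).trans (hs'.2.2.1 i hi),
    (hs''.2.2.1 d (by omega)).trans hs'.2.2.2⟩, hs''.2.2.2⟩

theorem Post.setNat {d x y : ℕ} {s s' : State} (h : Post d s x s') :
    Post d s y (s'.setNat (2 * d + 1) y) := by
  refine ⟨h.1, fun i => ?_, fun i hi => ?_, ?_⟩
  · rw [← h.2.1 i]
    exact update_of_ne (by omega) _ _
  · rw [← h.2.2.1 i hi]
    exact update_of_ne (by omega) _ _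
  · exact update_self _ _ _

theorem Post.refl (d : ℕ) (s : State) : Post d s (s.nat (2 * d + 1)) s :=
  ⟨rfl, fun _ => rfl, fun _ _ => rfl, rfl⟩

theorem two_mul_ne_two_mul_add_one (i j : ℕ) : 2 * i ≠ 2 * j + 1 := by omega

theorem two_mul_add_one_ne_two_mul (i j : ℕ) : 2 * i + 1 ≠ 2 * j := by omega

theorem compile_spec (A : ℕ → ℕ → ℝ) (L : ℕ) (x : NatExpr) : ∀ (d : ℕ) (s : State) (σ : ℕ → ℕ),
    (∀ i, s.nat (2 * i) = σ i) → x.Ok L σ →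
      Reaches A (x.compile d) s (x.cost L) (Post d s (x.eval σ)) := by
  induction x with
  | const k =>
    intro d s σ hs _
    exact .instr (Post.refl d s).setNat
  | var k =>
    intro d s σ hs _
    refine .block ?_
    have := ((Post.refl d s).setNat (y := 0)).setNat (y := 0 + σ k)
    simpa [Instr.exec, State.setNat, eval, two_mul_ne_two_mul_add_one, hs] using this
  | add x y hx hy =>
    intro d s σ hs hok
    refine (Post.pair (hx d s σ hs hok.1) fun s' hs' => hy (d + 1) s' σ
      (fun i => by rw [hs'.2.1, hs]) hok.2).seq fun s' hs' => .instr ?_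
    simpa only [Instr.exec, eval, hs'.1.2.2.2, hs'.2] using hs'.1.setNat
  | sub x y hx hy =>
    intro d s σ hs hok
    refine (Post.pair (hx d s σ hs hok.1) fun s' hs' => hy (d + 1) s' σ
      (fun i => by rw [hs'.2.1, hs]) hok.2).seq fun s' hs' => .instr ?_
    simpa only [Instr.exec, eval, hs'.1.2.2.2, hs'.2] using hs'.1.setNat
  | fold v a b i e hb hi he =>
    intro d s σ hs ⟨hva, hokb, hbL, hoki, hoke⟩
    set z : ℕ → ℕ := fun m =>
      Nat.rec (i.eval σ) (fun k z => e.eval (update (update σ v k) a z)) m with hz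
    -- Invariant after k rounds. The counter temporary holds k + 1, so that the available test ≤
    -- expresses k < b.
    let I : ℕ → State → Prop := fun k s' => s'.real = s.real ∧
      (∀ j, s'.nat (2 * j) = update (update σ v k) a (z k) j) ∧
      (∀ j < d, s'.nat (2 * j + 1) = s.nat (2 * j + 1)) ∧ s'.nat (2 * d + 1) = b.eval σ ∧
      s'.nat (2 * (d + 2) + 1) = σ v ∧ s'.nat (2 * (d + 3) + 1) = σ a ∧
      s'.nat (2 * (d + 4) + 1) = 1 ∧ s'.nat (2 * (d + 5) + 1) = k + 1
    have hpair := Post.pair (hb d s σ hs hokb) fun s' hs' => hi (d + 1) s' σ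
      (fun i => by rw [hs'.2.1, hs]) hoki
    have hinit := hpair.seq (q := (.block (.natConst (2 * (d + 5) + 1) 0)
          [.natAdd (2 * (d + 2) + 1) (2 * (d + 5) + 1) (2 * v),
           .natAdd (2 * (d + 3) + 1) (2 * (d + 5) + 1) (2 * a),
           .natConst (2 * (d + 4) + 1) 1,
           .natConst (2 * v) 0,
           .natAdd (2 * a) (2 * (d + 5) + 1) (2 * (d + 1) + 1),
           .natConst (2 * (d + 5) + 1) 1])) (Q' := I 0) (c' := 7) (by
      rintro s' ⟨⟨h1, h2, h3, h4⟩, h5⟩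
      have hz0 : z 0 = i.eval σ := rfl
      have h5' : s'.nat (2 * (d + 1) + 1) = i.eval σ := h5
      refine .block ⟨h1, fun j => ?_, fun j hj => ?_, ?_, ?_, ?_, ?_, ?_⟩ <;>
        simp [Instr.exec, State.setNat, update_apply, two_mul_ne_two_mul_add_one,
          two_mul_add_one_ne_two_mul, h2, hs, h4, h5', hz0]
      rw [if_neg (by omega), if_neg (by omega), if_neg (by omega), if_neg (by omega),
        if_neg (by omega), h3 j hj])
    refine ((hinit.seq (Q' := I (b.eval σ)) (c' := L * (e.cost L + 5) + 1) fun s' hs' => ?_).seq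
      (c' := 6) fun s' hs' => ?_).mono (by simp only [cost]; omega) fun _ h => h
    · refine (Reaches.loop (c := e.cost L + 4) (m := b.eval σ) I ?_ ?_ hs').mono (by gcongr)
        fun _ h => h
      · rintro k hk s' ⟨h1, h2, h3, h4, h5, h6, h7, h8⟩
        refine ⟨by simp only [Test.Holds, h4, h8]; omega,
          (he (d + 6) s' _ h2 (hoke k hk (z k))).seq ?_⟩
        rintro s'' ⟨g1, g2, g3, g4⟩
        have hzs : e.eval (update (update σ v k) a (z k)) = z (k + 1) := rfl
        rw [hzs] at g4
        refine .block ⟨g1.trans h1, fun j => ?_, fun j hj => ?_, ?_, ?_, ?_, ?_, ?_⟩ <;>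
          simp [Instr.exec, State.setNat, update_apply, two_mul_ne_two_mul_add_one,
            two_mul_add_one_ne_two_mul, g2, g3, g4, h2, h4, h5, h6, h7, h8, hva]
        · by_cases hja : j = a <;> by_cases hjv : j = v <;> simp_all
        · rw [if_neg (by omega), g3 j (by omega), h3 j hj]
      · rintro s' ⟨h1, h2, h3, h4, h5, h6, h7, h8⟩
        simp only [Test.Holds, h4, h8]; omega
    · obtain ⟨h1, h2, h3, h4, h5, h6, h7, h8⟩ := hs'
      have hzb : z (b.eval σ) = eval (fold v a b i e) σ := rfl
      refine .block ⟨h1, fun j => ?_, fun j hj => ?_, ?_⟩ <;>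
        simp [Instr.exec, State.setNat, update_apply, two_mul_ne_two_mul_add_one,
          two_mul_add_one_ne_two_mul, h2, h5, h6, hs, hzb]
      · by_cases hja : j = a <;> by_cases hjv : j = v <;> simp_all
      · rw [if_neg (by omega), h3 j hj]

end NatExpr
end RealRAM

/-! ### Real expressions and their compilation -/

namespace RealRAM

/-- Expressions for real numbers; `get i` reads the real cell with the computed address `i`.  The
fold has a counter `v` and an accumulator with the fixed address `a`. -/
inductive RealExpr where
  | const (q : ℚ)
  | nat (x : NatExpr)
  | get (i : NatExpr)
  | probe (i j : NatExpr)
  | add (x y : RealExpr)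
  | sub (x y : RealExpr)
  | mul (x y : RealExpr)
  | div (x y : RealExpr)
  | ite (x y p q : RealExpr)
  | fold (v a : ℕ) (b : NatExpr) (i e : RealExpr)

namespace RealExpr

open Function NatExpr

open Classical in
/-- The value of an expression. -/
noncomputable def eval (A : ℕ → ℕ → ℝ) : RealExpr → State → ℝ
  | const q, _ => q
  | nat x, σ => x.eval σ.nat
  | get i, σ => σ.real (i.eval σ.nat)
  | probe i j, σ => A (i.eval σ.nat) (j.eval σ.nat)
  | add x y, σ => x.eval A σ + y.eval A σ
  | sub x y, σ => x.eval A σ - y.eval A σ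
  | mul x y, σ => x.eval A σ * y.eval A σ
  | div x y, σ => x.eval A σ / y.eval A σ
  | ite x y p q, σ => if x.eval A σ ≤ y.eval A σ then p.eval A σ else q.eval A σ
  | fold v a b i e, σ =>
      Nat.rec (i.eval A σ) (fun k z => e.eval A ((σ.setNat v k).setReal a z)) (b.eval σ.nat)

/-- All loops in the evaluation run at most `L` times. -/
def Ok (L : ℕ) : RealExpr → (ℕ → ℕ) → Prop
  | const _, _ => True
  | nat x, σ => x.Ok L σ
  | get i, σ => i.Ok L σ
  | probe i j, σ => i.Ok L σ ∧ j.Ok L σ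
  | add x y, σ => x.Ok L σ ∧ y.Ok L σ
  | sub x y, σ => x.Ok L σ ∧ y.Ok L σ
  | mul x y, σ => x.Ok L σ ∧ y.Ok L σ
  | div x y, σ => x.Ok L σ ∧ y.Ok L σ
  | ite x y p q, σ => x.Ok L σ ∧ y.Ok L σ ∧ p.Ok L σ ∧ q.Ok L σ
  | fold v _ b i e, σ => b.Ok L σ ∧ b.eval σ ≤ L ∧ i.Ok L σ ∧
      ∀ k < b.eval σ, e.Ok L (update σ v k)

/-- A bound for the number of steps if all loops run at most `L` times. -/
def cost (L : ℕ) : RealExpr → ℕ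
  | const _ => 1
  | nat x => x.cost L + 1
  | get i => i.cost L + 2
  | probe i j => i.cost L + j.cost L + 1
  | add x y => x.cost L + y.cost L + 1
  | sub x y => x.cost L + y.cost L + 1
  | mul x y => x.cost L + y.cost L + 1
  | div x y => x.cost L + y.cost L + 1
  | ite x y p q => x.cost L + y.cost L + (p.cost L + q.cost L + 1)
  | fold _ _ b i e => b.cost L + i.cost L + (L * (e.cost L + 5) + 1) + 15

/-- The program that evaluates an expression with the temporaries from number `d` on, leaving the
value in real temporary `d`. -/
def compile : RealExpr → ℕ → Program
  | const q, d => .instr (.realConst (2 * d + 1) q)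
  | nat x, d => .seq (x.compile d) (.instr (.natToReal (2 * d + 1) (2 * d + 1)))
  -- The address is doubled because variable number i lives in the machine cell 2 * i.
  | get i, d => .seq (i.compile d)
      (.block (.natAdd (2 * d + 1) (2 * d + 1) (2 * d + 1)) [.realLoad (2 * d + 1) (2 * d + 1)])
  | probe i j, d => .seq (.seq (i.compile d) (j.compile (d + 1)))
      (.instr (.probe (2 * d + 1) (2 * d + 1) (2 * (d + 1) + 1)))
  | add x y, d => .seq (.seq (x.compile d) (y.compile (d + 1)))
      (.instr (.realAdd (2 * d + 1) (2 * d + 1) (2 * (d + 1) + 1)))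
  | sub x y, d => .seq (.seq (x.compile d) (y.compile (d + 1)))
      (.instr (.realSub (2 * d + 1) (2 * d + 1) (2 * (d + 1) + 1)))
  | mul x y, d => .seq (.seq (x.compile d) (y.compile (d + 1)))
      (.instr (.realMul (2 * d + 1) (2 * d + 1) (2 * (d + 1) + 1)))
  | div x y, d => .seq (.seq (x.compile d) (y.compile (d + 1)))
      (.instr (.realDiv (2 * d + 1) (2 * d + 1) (2 * (d + 1) + 1)))
  | ite x y p q, d => .seq (.seq (x.compile d) (y.compile (d + 1)))
      (.ite (.realLE (2 * d + 1) (2 * (d + 1) + 1)) (p.compile d) (q.compile d))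
  | fold v a b i e, d =>
      .seq (.seq (.seq (.seq (b.compile d) (i.compile (d + 1)))
        (.block (.natConst (2 * (d + 5) + 1) 0)
          [.natAdd (2 * (d + 2) + 1) (2 * (d + 5) + 1) (2 * v),
           .realConst (2 * (d + 3) + 1) 0,
           .realAdd (2 * (d + 2) + 1) (2 * (d + 3) + 1) (2 * a),
           .natConst (2 * (d + 4) + 1) 1,
           .natConst (2 * v) 0,
           .realAdd (2 * a) (2 * (d + 3) + 1) (2 * (d + 1) + 1),
           .natConst (2 * (d + 5) + 1) 1]))
        (.while (.natLE (2 * (d + 5) + 1) (2 * d + 1))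
          (.seq (e.compile (d + 6))
            (.block (.realConst (2 * a) 0)
              [.realAdd (2 * a) (2 * a) (2 * (d + 6) + 1),
               .natAdd (2 * v) (2 * v) (2 * (d + 4) + 1),
               .natAdd (2 * (d + 5) + 1) (2 * (d + 5) + 1) (2 * (d + 4) + 1)]))))
        (.block (.realConst (2 * d + 1) 0)
          [.realAdd (2 * d + 1) (2 * d + 1) (2 * a),
           .natConst (2 * v) 0,
           .natAdd (2 * v) (2 * v) (2 * (d + 2) + 1),
           .realConst (2 * a) 0,
           .realAdd (2 * a) (2 * a) (2 * (d + 2) + 1)])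

/-- The even cells of `s` hold the values of the variables in `σ`. -/
def _root_.RealRAM.State.Represents (s σ : State) : Prop :=
  ∀ i, s.nat (2 * i) = σ.nat i ∧ s.real (2 * i) = σ.real i

/-- The cells of the variables and of the temporaries below `d` have the same content. -/
def _root_.RealRAM.State.Agree (d : ℕ) (s s' : State) : Prop :=
  (∀ i, s'.nat (2 * i) = s.nat (2 * i)) ∧ (∀ i, s'.real (2 * i) = s.real (2 * i)) ∧
    (∀ i < d, s'.nat (2 * i + 1) = s.nat (2 * i + 1)) ∧
    (∀ i < d, s'.real (2 * i + 1) = s.real (2 * i + 1))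

theorem _root_.RealRAM.State.Agree.refl (d : ℕ) (s : State) : State.Agree d s s :=
  ⟨fun _ => rfl, fun _ => rfl, fun _ _ => rfl, fun _ _ => rfl⟩

theorem _root_.RealRAM.State.Agree.trans {d d' : ℕ} {s s' s'' : State} (h : State.Agree d s s')
    (h' : State.Agree d' s' s'') (hd : d ≤ d') : State.Agree d s s'' :=
  ⟨fun i => (h'.1 i).trans (h.1 i), fun i => (h'.2.1 i).trans (h.2.1 i),
    fun i hi => (h'.2.2.1 i (by omega)).trans (h.2.2.1 i hi),
    fun i hi => (h'.2.2.2 i (by omega)).trans (h.2.2.2 i hi)⟩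

theorem _root_.RealRAM.State.Agree.setNat {d e x : ℕ} {s s' : State} (h : State.Agree d s s')
    (hd : d ≤ e) : State.Agree d s (s'.setNat (2 * e + 1) x) := by
  refine ⟨fun i => ?_, h.2.1, fun i hi => ?_, h.2.2.2⟩
  · rw [← h.1 i]
    exact update_of_ne (by omega) _ _
  · rw [← h.2.2.1 i hi]
    exact update_of_ne (by omega) _ _

theorem _root_.RealRAM.State.Agree.setReal {d e : ℕ} {x : ℝ} {s s' : State} (h : State.Agree d s s')
    (hd : d ≤ e) : State.Agree d s (s'.setReal (2 * e + 1) x) := by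
  refine ⟨h.1, fun i => ?_, h.2.2.1, fun i hi => ?_⟩
  · rw [← h.2.1 i]
    exact update_of_ne (by omega) _ _
  · rw [← h.2.2.2 i hi]
    exact update_of_ne (by omega) _ _

theorem _root_.RealRAM.State.Represents.agree {d : ℕ} {s s' σ : State} (h : s.Represents σ)
    (h' : State.Agree d s s') : s'.Represents σ :=
  fun i => ⟨(h'.1 i).trans (h i).1, (h'.2.1 i).trans (h i).2⟩

theorem _root_.RealRAM.NatExpr.reaches_compile {A : ℕ → ℕ → ℝ} {L : ℕ} {x : NatExpr} {d : ℕ}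
    {s σ : State} (h : s.Represents σ) (hok : x.Ok L σ.nat) :
    Reaches A (x.compile d) s (x.cost L)
      fun s' => State.Agree d s s' ∧ s'.nat (2 * d + 1) = x.eval σ.nat :=
  (NatExpr.compile_spec A L x d s σ.nat (fun i => (h i).1) hok).mono le_rfl
    fun s' hs' => ⟨⟨hs'.2.1, fun i => by rw [hs'.1], hs'.2.2.1, fun i _ => by rw [hs'.1]⟩,
      hs'.2.2.2⟩

/-- Evaluation has no lasting side effect on variables, since a fold restores its counter and its
accumulator. All operands can therefore be evaluated against the same abstract state σ. -/
theorem compile_spec (A : ℕ → ℕ → ℝ) (L : ℕ) (x : RealExpr) : ∀ (d : ℕ) (s σ : State),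
    s.Represents σ → x.Ok L σ.nat → Reaches A (x.compile d) s (x.cost L)
      fun s' => State.Agree d s s' ∧ s'.real (2 * d + 1) = x.eval A σ := by
  have pair : ∀ {x y : RealExpr} {d : ℕ} {s σ : State},
      (∀ (d : ℕ) (s σ : State), s.Represents σ → x.Ok L σ.nat → Reaches A (x.compile d) s (x.cost L)
        fun s' => State.Agree d s s' ∧ s'.real (2 * d + 1) = x.eval A σ) →
      (∀ (d : ℕ) (s σ : State), s.Represents σ → y.Ok L σ.nat → Reaches A (y.compile d) s (y.cost L)
        fun s' => State.Agree d s s' ∧ s'.real (2 * d + 1) = y.eval A σ) →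
      s.Represents σ → x.Ok L σ.nat → y.Ok L σ.nat →
      Reaches A (.seq (x.compile d) (y.compile (d + 1))) s (x.cost L + y.cost L)
        fun s' => State.Agree d s s' ∧ s'.real (2 * d + 1) = x.eval A σ ∧
          s'.real (2 * (d + 1) + 1) = y.eval A σ := by
    intro x y d s σ hx hy hs hxo hyo
    refine (hx d s σ hs hxo).seq fun s' hs' => (hy (d + 1) s' σ (hs.agree hs'.1) hyo).mono le_rfl
      fun s'' hs'' => ⟨hs'.1.trans hs''.1 (by omega), ?_, hs''.2⟩
    rw [hs''.1.2.2.2 d (by omega), hs'.2]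
  induction x with
  | const q =>
    intro d s σ hs _
    exact .instr ⟨(State.Agree.refl d s).setReal le_rfl, update_self _ _ _⟩
  | nat x =>
    intro d s σ hs hok
    refine (NatExpr.reaches_compile hs hok).seq fun s' hs' => .instr
      ⟨hs'.1.setReal le_rfl, ?_⟩
    simp [Instr.exec, State.setReal, eval, hs'.2]
  | get i =>
    intro d s σ hs hok
    refine (NatExpr.reaches_compile hs hok).seq fun s' hs' => .block
      ⟨(hs'.1.setNat le_rfl).setReal le_rfl, ?_⟩
    simp [Instr.exec, State.setReal, State.setNat, eval, hs'.2, ← two_mul, hs'.1.2.1, (hs _).2]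
  | probe i j =>
    intro d s σ hs hok
    refine ((NatExpr.reaches_compile (d := d) hs hok.1).seq (c' := j.cost L)
      (Q' := fun s' => State.Agree d s s' ∧ s'.nat (2 * d + 1) = i.eval σ.nat ∧
        s'.nat (2 * (d + 1) + 1) = j.eval σ.nat) fun s' hs' =>
      (NatExpr.reaches_compile (hs.agree hs'.1) hok.2).mono le_rfl fun s'' hs'' =>
        ⟨hs'.1.trans hs''.1 (by omega), ?_, hs''.2⟩).seq fun s' hs' => .instr
      ⟨hs'.1.setReal le_rfl, ?_⟩
    · rw [hs''.1.2.2.1 d (by omega), hs'.2]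
    · have h2 : s'.nat (2 * (d + 1) + 1) = j.eval σ.nat := hs'.2.2
      simp [Instr.exec, State.setReal, eval, hs'.2.1, h2]
  | add x y hx hy =>
    intro d s σ hs hok
    refine (pair hx hy hs hok.1 hok.2).seq fun s' hs' => .instr ⟨hs'.1.setReal le_rfl, ?_⟩
    simp only [Instr.exec, State.setReal, eval, hs'.2.1, hs'.2.2, update_self]
  | sub x y hx hy =>
    intro d s σ hs hok
    refine (pair hx hy hs hok.1 hok.2).seq fun s' hs' => .instr ⟨hs'.1.setReal le_rfl, ?_⟩
    simp only [Instr.exec, State.setReal, eval, hs'.2.1, hs'.2.2, update_self]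
  | mul x y hx hy =>
    intro d s σ hs hok
    refine (pair hx hy hs hok.1 hok.2).seq fun s' hs' => .instr ⟨hs'.1.setReal le_rfl, ?_⟩
    simp only [Instr.exec, State.setReal, eval, hs'.2.1, hs'.2.2, update_self]
  | div x y hx hy =>
    intro d s σ hs hok
    refine (pair hx hy hs hok.1 hok.2).seq fun s' hs' => .instr ⟨hs'.1.setReal le_rfl, ?_⟩
    simp only [Instr.exec, State.setReal, eval, hs'.2.1, hs'.2.2, update_self]
  | ite x y p q hx hy hp hq =>
    intro d s σ hs ⟨hox, hoy, hop, hoq⟩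
    refine (pair hx hy hs hox hoy).seq fun s' hs' => .ite (fun hb => ?_) (fun hb => ?_)
    all_goals simp only [Test.Holds, hs'.2.1, hs'.2.2] at hb
    · refine (hp d s' σ (hs.agree hs'.1) hop).mono (by omega) fun s'' hs'' =>
        ⟨hs'.1.trans hs''.1 le_rfl, ?_⟩
      rw [hs''.2, eval, if_pos hb]
    · refine (hq d s' σ (hs.agree hs'.1) hoq).mono (by omega) fun s'' hs'' =>
        ⟨hs'.1.trans hs''.1 le_rfl, ?_⟩
      rw [hs''.2, eval, if_neg hb]
  | fold v a b i e hi he =>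
    intro d s σ hs ⟨hokb, hbL, hoki, hoke⟩
    set z : ℕ → ℝ := fun m =>
      Nat.rec (i.eval A σ) (fun k z => e.eval A ((σ.setNat v k).setReal a z)) m with hz
    let I : ℕ → State → Prop := fun k s' =>
      (∀ j, s'.nat (2 * j) = update σ.nat v k j) ∧
      (∀ j, s'.real (2 * j) = update σ.real a (z k) j) ∧
      (∀ j < d, s'.nat (2 * j + 1) = s.nat (2 * j + 1)) ∧
      (∀ j < d, s'.real (2 * j + 1) = s.real (2 * j + 1)) ∧
      s'.nat (2 * d + 1) = b.eval σ.nat ∧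
      s'.nat (2 * (d + 2) + 1) = σ.nat v ∧ s'.real (2 * (d + 2) + 1) = σ.real a ∧
      s'.nat (2 * (d + 4) + 1) = 1 ∧ s'.nat (2 * (d + 5) + 1) = k + 1
    have hsn : ∀ j, s.nat (2 * j) = σ.nat j := fun j => (hs j).1
    have hsr : ∀ j, s.real (2 * j) = σ.real j := fun j => (hs j).2
    have hpair := (NatExpr.reaches_compile (A := A) (d := d) hs hokb).seq fun s' hs' =>
      (hi (d + 1) s' σ (hs.agree hs'.1) hoki).mono (Q' := fun s'' => State.Agree d s s'' ∧
        s''.nat (2 * d + 1) = b.eval σ.nat ∧ s''.real (2 * (d + 1) + 1) = i.eval A σ) le_rfl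
        fun s'' hs'' => ⟨hs'.1.trans hs''.1 (by omega),
          by rw [hs''.1.2.2.1 d (by omega), hs'.2], hs''.2⟩
    have hinit := hpair.seq (q := (.block (.natConst (2 * (d + 5) + 1) 0)
          [.natAdd (2 * (d + 2) + 1) (2 * (d + 5) + 1) (2 * v),
           .realConst (2 * (d + 3) + 1) 0,
           .realAdd (2 * (d + 2) + 1) (2 * (d + 3) + 1) (2 * a),
           .natConst (2 * (d + 4) + 1) 1,
           .natConst (2 * v) 0,
           .realAdd (2 * a) (2 * (d + 3) + 1) (2 * (d + 1) + 1),
           .natConst (2 * (d + 5) + 1) 1])) (Q' := I 0) (c' := 8) (by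
      rintro s' ⟨⟨h1, h2, h3, h4⟩, h5, h6⟩
      have hz0 : z 0 = i.eval A σ := rfl
      have h6' : s'.real (2 * (d + 1) + 1) = i.eval A σ := h6
      refine .block ⟨fun j => ?_, fun j => ?_, fun j hj => ?_, fun j hj => ?_, ?_, ?_, ?_, ?_, ?_⟩ <;>
        simp [Instr.exec, State.setNat, State.setReal, update_apply, two_mul_ne_two_mul_add_one,
          two_mul_add_one_ne_two_mul, h1, h2, hsn, hsr, h5, h6', hz0]
      · rw [if_neg (by omega), if_neg (by omega), if_neg (by omega), if_neg (by omega), h3 j hj]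
      · rw [if_neg (by omega), if_neg (by omega), h4 j hj])
    refine ((hinit.seq (Q' := I (b.eval σ.nat)) (c' := L * (e.cost L + 5) + 1) fun s' hs' => ?_).seq
      (c' := 6) fun s' hs' => ?_).mono (by simp only [cost]; omega) fun _ h => h
    · refine (Reaches.loop (c := e.cost L + 4) (m := b.eval σ.nat) I ?_ ?_ hs').mono (by gcongr)
        fun _ h => h
      · rintro k hk s' ⟨h1, h2, h3, h4, h5, h6, h7, h8, h9⟩
        refine ⟨by simp only [Test.Holds, h5, h9]; omega,
          (he (d + 6) s' ((σ.setNat v k).setReal a (z k)) (fun j => ⟨h1 j, h2 j⟩)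
            (hoke k hk)).seq ?_⟩
        rintro s'' ⟨⟨g1, g2, g3, g4⟩, g5⟩
        have hzs : e.eval A ((σ.setNat v k).setReal a (z k)) = z (k + 1) := rfl
        rw [hzs] at g5
        refine .block ⟨fun j => ?_, fun j => ?_, fun j hj => ?_, fun j hj => ?_, ?_, ?_, ?_, ?_, ?_⟩
          <;> simp [Instr.exec, State.setNat, State.setReal, update_apply,
            two_mul_ne_two_mul_add_one, two_mul_add_one_ne_two_mul, g1, g2, g3, g4, g5, h1, h2, h5,
            h6, h7, h8, h9]
        · by_cases hjv : j = v <;> simp_all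
        · by_cases hja : j = a <;> simp_all
        · rw [if_neg (by omega), g3 j (by omega), h3 j hj]
        · rw [g4 j (by omega), h4 j hj]
      · rintro s' ⟨h1, h2, h3, h4, h5, h6, h7, h8, h9⟩
        simp only [Test.Holds, h5, h9]; omega
    · obtain ⟨h1, h2, h3, h4, h5, h6, h7, h8, h9⟩ := hs'
      have hzb : z (b.eval σ.nat) = eval A (fold v a b i e) σ := rfl
      refine .block ⟨⟨fun j => ?_, fun j => ?_, fun j hj => ?_, fun j hj => ?_⟩, ?_⟩ <;>
        simp [Instr.exec, State.setNat, State.setReal, update_apply, two_mul_ne_two_mul_add_one,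
          two_mul_add_one_ne_two_mul, h1, h2, h6, h7, hsn, hsr, hzb]
      · by_cases hjv : j = v <;> simp_all
      · by_cases hja : j = a <;> simp_all
      · rw [h3 j hj]
      · rw [if_neg (by omega), h4 j hj]

end RealExpr
end RealRAM

/-! ### Statements and their compilation -/

namespace RealRAM

/-- Statements with bounded loops; `set i x` writes the value of `x` into the real cell with the
computed address `i`. -/
inductive Stmt where
  | setNat (i : ℕ) (x : NatExpr)
  | set (i : NatExpr) (x : RealExpr)
  | seq (p q : Stmt)
  | ite (x y : RealExpr) (p q : Stmt)
  | loop (v : ℕ) (b : NatExpr) (p : Stmt)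

namespace Stmt

open Function NatExpr

open Classical in
/-- The effect of a statement. -/
noncomputable def run (A : ℕ → ℕ → ℝ) : Stmt → State → State
  | setNat i x, σ => σ.setNat i (x.eval σ.nat)
  | set i x, σ => σ.setReal (i.eval σ.nat) (x.eval A σ)
  | seq p q, σ => q.run A (p.run A σ)
  | ite x y p q, σ => if x.eval A σ ≤ y.eval A σ then p.run A σ else q.run A σ
  | loop v b p, σ => Nat.rec σ (fun k τ => p.run A (τ.setNat v k)) (b.eval σ.nat)

/-- All loops run at most `L` times. -/
def Ok (A : ℕ → ℕ → ℝ) (L : ℕ) : Stmt → State → Prop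
  | setNat _ x, σ => x.Ok L σ.nat
  | set i x, σ => i.Ok L σ.nat ∧ x.Ok L σ.nat
  | seq p q, σ => p.Ok A L σ ∧ q.Ok A L (p.run A σ)
  | ite x y p q, σ => x.Ok L σ.nat ∧ y.Ok L σ.nat ∧
      (x.eval A σ ≤ y.eval A σ → p.Ok A L σ) ∧ (¬ x.eval A σ ≤ y.eval A σ → q.Ok A L σ)
  | loop v b p, σ => b.Ok L σ.nat ∧ b.eval σ.nat ≤ L ∧ ∀ k < b.eval σ.nat,
      p.Ok A L (State.setNat (Nat.rec σ (fun k τ => p.run A (τ.setNat v k)) k) v k)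

/-- A bound for the number of steps if all loops run at most `L` times. -/
def cost (L : ℕ) : Stmt → ℕ
  | setNat _ x => x.cost L + 2
  | set i x => i.cost L + x.cost L + 2
  | seq p q => p.cost L + q.cost L
  | ite x y p q => x.cost L + y.cost L + (p.cost L + q.cost L + 1)
  | loop _ b p => b.cost L + (L * (p.cost L + 3) + 1) + 2

/-- The program for a statement, with temporaries from number `d` on. -/
def compile : Stmt → ℕ → Program
  | setNat i x, d => .seq (x.compile d)
      (.block (.natConst (2 * i) 0) [.natAdd (2 * i) (2 * i) (2 * d + 1)])
  | set i x, d => .seq (.seq (i.compile d) (x.compile (d + 1)))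
      (.block (.natAdd (2 * d + 1) (2 * d + 1) (2 * d + 1))
        [.realStore (2 * d + 1) (2 * (d + 1) + 1)])
  | seq p q, d => .seq (p.compile d) (q.compile d)
  | ite x y p q, d => .seq (.seq (x.compile d) (y.compile (d + 1)))
      (.ite (.realLE (2 * d + 1) (2 * (d + 1) + 1)) (p.compile d) (q.compile d))
  | loop v b p, d => .seq (.seq (b.compile d)
      (.block (.natConst (2 * (d + 1) + 1) 1) [.natConst (2 * (d + 2) + 1) 1]))
      (.while (.natLE (2 * (d + 1) + 1) (2 * d + 1))
        -- The true counter is a temporary holding k + 1; the variable v is reset to k before every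
        -- round, so the body may overwrite it.
        (.seq (.seq (.instr (.natSub (2 * v) (2 * (d + 1) + 1) (2 * (d + 2) + 1)))
          (p.compile (d + 3)))
          (.instr (.natAdd (2 * (d + 1) + 1) (2 * (d + 1) + 1) (2 * (d + 2) + 1)))))

/-- The temporaries below `d` have the same content. -/
def _root_.RealRAM.State.AgreeTemp (d : ℕ) (s s' : State) : Prop :=
  (∀ i < d, s'.nat (2 * i + 1) = s.nat (2 * i + 1)) ∧
    (∀ i < d, s'.real (2 * i + 1) = s.real (2 * i + 1))

theorem _root_.RealRAM.State.AgreeTemp.trans {d d' : ℕ} {s s' s'' : State}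
    (h : State.AgreeTemp d s s') (h' : State.AgreeTemp d' s' s'') (hd : d ≤ d') :
    State.AgreeTemp d s s'' :=
  ⟨fun i hi => (h'.1 i (by omega)).trans (h.1 i hi),
    fun i hi => (h'.2 i (by omega)).trans (h.2 i hi)⟩

theorem _root_.RealRAM.State.Agree.agreeTemp {d : ℕ} {s s' : State} (h : State.Agree d s s') :
    State.AgreeTemp d s s' := h.2.2

theorem _root_.RealRAM.RealExpr.reaches_compile_pair {A : ℕ → ℕ → ℝ} {L : ℕ} {x y : RealExpr}
    {d : ℕ} {s σ : State} (hs : s.Represents σ) (hx : x.Ok L σ.nat) (hy : y.Ok L σ.nat) :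
    Reaches A (.seq (x.compile d) (y.compile (d + 1))) s (x.cost L + y.cost L)
      fun s' => State.Agree d s s' ∧ s'.real (2 * d + 1) = x.eval A σ ∧
        s'.real (2 * (d + 1) + 1) = y.eval A σ :=
  (RealExpr.compile_spec A L x d s σ hs hx).seq fun _ hs' =>
    (RealExpr.compile_spec A L y (d + 1) _ σ (hs.agree hs'.1) hy).mono le_rfl
      fun _ hs'' => ⟨hs'.1.trans hs''.1 (by omega),
        (hs''.1.2.2.2 d (by omega)).trans hs'.2, hs''.2⟩

theorem compile_spec (A : ℕ → ℕ → ℝ) (L : ℕ) (p : Stmt) : ∀ (d : ℕ) (s σ : State),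
    s.Represents σ → p.Ok A L σ → Reaches A (p.compile d) s (p.cost L)
      fun s' => s'.Represents (p.run A σ) ∧ State.AgreeTemp d s s' := by
  induction p with
  | setNat i x =>
    intro d s σ hs hok
    refine (NatExpr.reaches_compile hs hok).seq fun s' hs' => .block ⟨fun j => ⟨?_, ?_⟩,
      fun j hj => ?_, fun j hj => ?_⟩
    · simp [Instr.exec, State.setNat, update_apply, two_mul_add_one_ne_two_mul, run, hs'.2,
        hs'.1.1, (hs j).1]
    · simp [Instr.exec, State.setNat, run, hs'.1.2.1, (hs j).2]
    · simp [Instr.exec, State.setNat,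
        two_mul_add_one_ne_two_mul, hs'.1.2.2.1 j hj]
    · simp [Instr.exec, State.setNat, hs'.1.2.2.2 j hj]
  | set i x =>
    intro d s σ hs hok
    refine ((NatExpr.reaches_compile (d := d) hs hok.1).seq (c' := x.cost L)
      (Q' := fun s' => State.Agree d s s' ∧ s'.nat (2 * d + 1) = i.eval σ.nat ∧
        s'.real (2 * (d + 1) + 1) = x.eval A σ) fun s' hs' =>
      (RealExpr.compile_spec A L x (d + 1) s' σ (hs.agree hs'.1) hok.2).mono le_rfl
        fun s'' hs'' => ⟨hs'.1.trans hs''.1 (by omega),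
          (hs''.1.2.2.1 d (by omega)).trans hs'.2, hs''.2⟩).seq fun s' hs' => .block ?_
    obtain ⟨⟨h1, h2, h3, h4⟩, h5, h6⟩ := hs'
    refine ⟨fun j => ⟨?_, ?_⟩, fun j hj => ?_, fun j hj => ?_⟩
    · simp [Instr.exec, State.setNat, State.setReal, two_mul_ne_two_mul_add_one,
        run, h1, (hs j).1]
    · have h6' : s'.real (2 * (d + 1) + 1) = x.eval A σ := h6
      simp [Instr.exec, State.setNat, State.setReal, update_apply, run, h2, (hs j).2, h5, h6',
        ← two_mul]
    · simp [Instr.exec, State.setNat, State.setReal, hj.ne, h3 j hj]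
    · simp [Instr.exec, State.setNat, State.setReal, ← two_mul,
        two_mul_add_one_ne_two_mul, h4 j hj]
  | seq p q hp hq =>
    intro d s σ hs hok
    exact (hp d s σ hs hok.1).seq fun s' hs' => (hq d s' _ hs'.1 hok.2).mono le_rfl
      fun s'' hs'' => ⟨hs''.1, hs'.2.trans hs''.2 le_rfl⟩
  | ite x y p q hp hq =>
    intro d s σ hs ⟨hox, hoy, hop, hoq⟩
    refine (RealExpr.reaches_compile_pair hs hox hoy).seq fun s' hs' =>
      .ite (fun hb => ?_) (fun hb => ?_)
    all_goals simp only [Test.Holds, hs'.2.1, hs'.2.2] at hb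
    · refine (hp d s' σ (hs.agree hs'.1) (hop hb)).mono (by omega) fun s'' hs'' =>
        ⟨?_, hs'.1.agreeTemp.trans hs''.2 le_rfl⟩
      rw [run, if_pos hb]
      exact hs''.1
    · refine (hq d s' σ (hs.agree hs'.1) (hoq hb)).mono (by omega) fun s'' hs'' =>
        ⟨?_, hs'.1.agreeTemp.trans hs''.2 le_rfl⟩
      rw [run, if_neg hb]
      exact hs''.1
  | loop v b p hp =>
    intro d s σ hs ⟨hokb, hbL, hokp⟩
    set τ : ℕ → State := fun k => Nat.rec σ (fun k τ => p.run A (τ.setNat v k)) k with hτ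
    let I : ℕ → State → Prop := fun k s' => s'.Represents (τ k) ∧ State.AgreeTemp d s s' ∧
      s'.nat (2 * d + 1) = b.eval σ.nat ∧ s'.nat (2 * (d + 1) + 1) = k + 1 ∧
      s'.nat (2 * (d + 2) + 1) = 1
    have hinit := (NatExpr.reaches_compile (A := A) (d := d) hs hokb).seq
      (q := (.block (.natConst (2 * (d + 1) + 1) 1) [.natConst (2 * (d + 2) + 1) 1]))
      (Q' := I 0) (c' := 2) (by
        rintro s' ⟨h, h'⟩
        have h'' := (h.setNat (e := d + 1) (x := 1) (by omega)).setNat (e := d + 2) (x := 1)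
          (by omega)
        refine .block ⟨hs.agree h'', h''.agreeTemp, ?_, ?_, ?_⟩ <;>
          simp [Instr.exec, State.setNat, h'])
    refine (hinit.seq (c' := L * (p.cost L + 3) + 1) fun s' hs' => ?_).mono
      (by simp only [cost]; omega) fun _ h => h
    refine ((Reaches.loop (c := 1 + p.cost L + 1) (m := b.eval σ.nat) I ?_ ?_ hs').mono ?_
      fun s'' hs'' => ⟨hs''.1, hs''.2.1⟩)
    · rintro k hk s' ⟨h1, h2, h3, h4, h5⟩
      refine ⟨by simp only [Test.Holds, h3, h4]; omega, ?_⟩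
      have hrep : (s'.setNat (2 * v) k).Represents ((τ k).setNat v k) := by
        refine fun j => ⟨?_, (h1 j).2⟩
        simp [State.setNat, update_apply, (h1 j).1]
      have hset : Instr.exec A s' (.natSub (2 * v) (2 * (d + 1) + 1) (2 * (d + 2) + 1)) =
          s'.setNat (2 * v) k := by
        simp only [Instr.exec, h4, h5, Nat.add_sub_cancel]
      have hodd : ∀ j, (s'.setNat (2 * v) k).nat (2 * j + 1) = s'.nat (2 * j + 1) := fun j =>
        update_of_ne (by omega) _ _
      refine (Reaches.seq (Q := fun s'' => s'' = s'.setNat (2 * v) k) (.instr hset)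
        (Q' := fun s'' => s''.Represents (p.run A ((τ k).setNat v k)) ∧
          State.AgreeTemp (d + 3) (s'.setNat (2 * v) k) s'') (fun s'' hs'' => ?_)).seq
        fun s'' hs'' => .instr ?_
      · subst hs''
        exact hp (d + 3) _ _ hrep (hokp k hk)
      have hτs : p.run A ((τ k).setNat v k) = τ (k + 1) := rfl
      rw [hτs] at hs''
      obtain ⟨g1, g2, g3⟩ := hs''
      refine ⟨fun j => ⟨?_, (g1 j).2⟩, ⟨fun j hj => ?_, fun j hj => ?_⟩, ?_, ?_, ?_⟩
      · rw [← (g1 j).1]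
        exact update_of_ne (by omega) _ _
      · rw [← h2.1 j hj, ← hodd, ← g2 j (by omega)]
        exact update_of_ne (by omega) _ _
      · rw [← h2.2 j hj]
        exact g3 j (by omega)
      · rw [← h3, ← hodd d, ← g2 d (by omega)]
        exact update_of_ne (by omega) _ _
      · have e1 := g2 (d + 1) (by omega)
        have e2 := g2 (d + 2) (by omega)
        rw [hodd] at e1 e2
        simp only [Instr.exec, State.setNat, update_self, e1, e2, h4, h5]
      · refine Eq.trans ?_ ((g2 (d + 2) (by omega)).trans ((hodd (d + 2)).trans h5))
        exact update_of_ne (by omega) _ _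
    · rintro s' ⟨h1, h2, h3, h4, h5⟩
      simp only [Test.Holds, h3, h4]; omega
    · have : 1 + p.cost L + 1 + 1 = p.cost L + 3 := by omega
      rw [this]
      gcongr

end Stmt

/-! ### Polynomial bounds for the number of steps -/

/-- `f` is bounded by a polynomial. -/
def PolyBounded (f : ℕ → ℕ) : Prop := ∃ a l, ∀ L, f L ≤ a * (L + 1) ^ l

theorem PolyBounded.const (c : ℕ) : PolyBounded fun _ => c := ⟨c, 0, fun L => by simp⟩

theorem PolyBounded.add {f g : ℕ → ℕ} (hf : PolyBounded f) (hg : PolyBounded g) :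
    PolyBounded fun L => f L + g L := by
  obtain ⟨a, l, h⟩ := hf
  obtain ⟨b, m, h'⟩ := hg
  refine ⟨a + b, l + m, fun L => (Nat.add_le_add (h L) (h' L)).trans ?_⟩
  rw [add_mul]
  gcongr <;> omega

/-- A loop contributes a factor L, so each level of nesting raises the degree by one. -/
theorem PolyBounded.mul_left {f : ℕ → ℕ} (hf : PolyBounded f) : PolyBounded fun L => L * f L := by
  obtain ⟨a, l, h⟩ := hf
  refine ⟨a, l + 1, fun L => (Nat.mul_le_mul (Nat.le_succ L) (h L)).trans (le_of_eq ?_)⟩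
  rw [Nat.succ_eq_add_one]
  ring

theorem NatExpr.polyBounded_cost (x : NatExpr) : PolyBounded fun L => x.cost L := by
  induction x with
  | const k => exact .const 1
  | var i => exact .const 2
  | add x y hx hy => exact (hx.add hy).add (.const 1)
  | sub x y hx hy => exact (hx.add hy).add (.const 1)
  | fold v a b i e hb hi he =>
    exact ((hb.add hi).add ((he.add (.const 5)).mul_left.add (.const 1))).add (.const 15)

theorem RealExpr.polyBounded_cost (x : RealExpr) : PolyBounded fun L => x.cost L := by
  induction x with
  | const q => exact .const 1
  | nat x => exact x.polyBounded_cost.add (.const 1)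
  | get i => exact i.polyBounded_cost.add (.const 2)
  | probe i j => exact (i.polyBounded_cost.add j.polyBounded_cost).add (.const 1)
  | add x y hx hy => exact (hx.add hy).add (.const 1)
  | sub x y hx hy => exact (hx.add hy).add (.const 1)
  | mul x y hx hy => exact (hx.add hy).add (.const 1)
  | div x y hx hy => exact (hx.add hy).add (.const 1)
  | ite x y p q hx hy hp hq => exact (hx.add hy).add ((hp.add hq).add (.const 1))
  | fold v a b i e hi he =>
    exact ((b.polyBounded_cost.add hi).add
      ((he.add (.const 5)).mul_left.add (.const 1))).add (.const 15)

theorem Stmt.polyBounded_cost (p : Stmt) : PolyBounded fun L => p.cost L := by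
  induction p with
  | setNat i x => exact x.polyBounded_cost.add (.const 2)
  | set i x => exact (i.polyBounded_cost.add x.polyBounded_cost).add (.const 2)
  | seq p q hp hq => exact hp.add hq
  | ite x y p q hp hq =>
    exact (x.polyBounded_cost.add y.polyBounded_cost).add ((hp.add hq).add (.const 1))
  | loop v b p hp =>
    exact (b.polyBounded_cost.add ((hp.add (.const 3)).mul_left.add (.const 1))).add (.const 2)

/-- A statement whose loops run at most `L` times is computed by a program in polynomial time. -/
theorem Stmt.exists_computes (p : Stmt) : ∃ a l : ℕ, ∀ (n : ℕ) (M : IsingModel n) (ε : ℝ) (L : ℕ),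
    p.Ok M.entry L (initial n ε) →
      ∃ T, Computes (p.compile 0) M ε T ((p.run M.entry (initial n ε)).real 0) ∧
        T ≤ a * (L + 1) ^ l := by
  obtain ⟨a, l, h⟩ := p.polyBounded_cost
  refine ⟨a, l, fun n M ε L hok => ?_⟩
  obtain ⟨T, s', hr, hT, hs', -⟩ := p.compile_spec M.entry L 0 (initial n ε) (initial n ε)
    (fun i => by simp [initial, Function.update_apply]) hok
  exact ⟨T, ⟨s', hr, (hs' 0).2⟩, hT.trans (h L)⟩

end RealRAM

namespace RealRAM

open Function

/-! ### Derived expressions -/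

namespace NatExpr

/-- In every environment that agrees with `σ` on the variables below `N`, the expression has the
value `m` and its evaluation runs no loop more than `L` times. -/
def Ev (L N : ℕ) (σ : ℕ → ℕ) (x : NatExpr) (m : ℕ) : Prop :=
  ∀ τ : ℕ → ℕ, (∀ i < N, τ i = σ i) → x.eval τ = m ∧ x.Ok L τ

variable {L N : ℕ} {σ : ℕ → ℕ}

theorem Ev.mono {x : NatExpr} {m N' : ℕ} (h : Ev L N σ x m) (hN : N ≤ N') : Ev L N' σ x m :=
  fun τ hτ => h τ fun i hi => hτ i (hi.trans_le hN)

theorem Ev.of_agree {x : NatExpr} {m : ℕ} {τ : ℕ → ℕ} (h : Ev L N σ x m)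
    (hτ : ∀ i < N, τ i = σ i) : Ev L N τ x m :=
  fun υ hυ => h υ fun i hi => (hυ i hi).trans (hτ i hi)

theorem Ev.const (k : ℕ) : Ev L N σ (.const k) k := fun _ _ => ⟨rfl, trivial⟩

theorem Ev.var {i : ℕ} (hi : i < N) : Ev L N σ (.var i) (σ i) := fun _ hτ => ⟨hτ i hi, trivial⟩

theorem Ev.add {x y : NatExpr} {a b : ℕ} (hx : Ev L N σ x a) (hy : Ev L N σ y b) :
    Ev L N σ (.add x y) (a + b) := fun τ hτ => by
  simp [eval, Ok, hx τ hτ, hy τ hτ]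

theorem Ev.sub {x y : NatExpr} {a b : ℕ} (hx : Ev L N σ x a) (hy : Ev L N σ y b) :
    Ev L N σ (.sub x y) (a - b) := fun τ hτ => by
  simp [eval, Ok, hx τ hτ, hy τ hτ]

/-- Counter and accumulator occupy the first free variables N and N + 1, and the body treats
everything from N + 2 on as free. The body is controlled for arbitrary z because `Ok` demands this.
-/
theorem Ev.fold {b i e : NatExpr} {m z : ℕ} {f : ℕ → ℕ → ℕ} (hb : Ev L N σ b m) (hm : m ≤ L)
    (hi : Ev L N σ i z)
    (he : ∀ k < m, ∀ z, Ev L (N + 2) (update (update σ N k) (N + 1) z) e (f k z)) :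
    Ev L N σ (.fold N (N + 1) b i e) (Nat.rec z f m) := by
  intro τ hτ
  have hagree : ∀ k z, ∀ i < N + 2,
      update (update τ N k) (N + 1) z i = update (update σ N k) (N + 1) z i := by
    intro k z i hi
    simp only [update_apply]
    split_ifs with h1 h2
    · rfl
    · rfl
    · exact hτ i (by omega)
  refine ⟨?_, by omega, (hb τ hτ).2, (hb τ hτ).1.trans_le hm, (hi τ hτ).2, fun k hk z => ?_⟩
  · rw [eval, (hb τ hτ).1, (hi τ hτ).1]
    clear hm hb
    induction m with
    | zero => rfl
    | succ m ih =>
      simp only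
      rw [ih fun k hk => he k (by omega)]
      exact (he m (by omega) _ _ (hagree m _)).1
  · rw [(hb τ hτ).1] at hk
    exact (he k hk z _ (hagree k z)).2

/-- Multiplication, with auxiliary variables `N` and `N + 1`. -/
def mul (N : ℕ) (x y : NatExpr) : NatExpr := .fold N (N + 1) y (.const 0) (.add (.var (N + 1)) x)

theorem Ev.extend {x : NatExpr} {m k z : ℕ} (h : Ev L N σ x m) :
    Ev L (N + 2) (update (update σ N k) (N + 1) z) x m :=
  (h.of_agree fun i hi => by
    rw [update_of_ne (by omega), update_of_ne (by omega)]).mono (by omega)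

theorem Ev.acc {k z : ℕ} :
    Ev L (N + 2) (update (update σ N k) (N + 1) z) (.var (N + 1)) z := by
  simpa using Ev.var (L := L) (σ := update (update σ N k) (N + 1) z) (i := N + 1) (N := N + 2)
    (by omega)

theorem Ev.counter {k z : ℕ} :
    Ev L (N + 2) (update (update σ N k) (N + 1) z) (.var N) k := by
  simpa using Ev.var (L := L) (σ := update (update σ N k) (N + 1) z) (i := N) (N := N + 2)
    (by omega)

/-- The loop runs over the second factor only. The first factor, and with it the product, may exceed
`L`; powers and cell addresses rely on this. -/
theorem Ev.mul {x y : NatExpr} {a b : ℕ} (hx : Ev L N σ x a) (hy : Ev L N σ y b) (hb : b ≤ L) :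
    Ev L N σ (.mul N x y) (a * b) := by
  have h := Ev.fold (f := fun _ z => z + a) hy hb (Ev.const 0) (e := .add (.var (N + 1)) x)
    fun k _ z => Ev.acc.add hx.extend
  refine Eq.mp (congrArg (Ev L N σ (.mul N x y)) ?_) h
  clear h hb hy
  induction b with
  | zero => rfl
  | succ b ih => rw [Nat.mul_succ, ← ih]

/-- Powers, with auxiliary variables from `N` on. -/
def pow (N : ℕ) (x y : NatExpr) : NatExpr :=
  .fold N (N + 1) y (.const 1) (.mul (N + 2) (.var (N + 1)) x)

theorem Ev.pow {x y : NatExpr} {a b : ℕ} (hx : Ev L N σ x a) (hy : Ev L N σ y b) (ha : a ≤ L)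
    (hb : b ≤ L) : Ev L N σ (.pow N x y) (a ^ b) := by
  have h := Ev.fold (f := fun _ z => z * a) hy hb (Ev.const 1)
    (e := .mul (N + 2) (.var (N + 1)) x) fun k _ z => Ev.acc.mul hx.extend ha
  refine Eq.mp (congrArg (Ev L N σ (.pow N x y)) ?_) h
  clear h hb hy
  induction b with
  | zero => rfl
  | succ b ih => rw [pow_succ, ← ih]

/-- Division, with auxiliary variables from `N` on. -/
def div (N : ℕ) (x y : NatExpr) : NatExpr :=
  .fold N (N + 1) x (.const 0) (.add (.var (N + 1))
    (.sub (.const 1) (.sub (.mul (N + 2) (.add (.var N) (.const 1)) y) x)))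

theorem Ev.div {x y : NatExpr} {a b : ℕ} (hx : Ev L N σ x a) (hy : Ev L N σ y b) (ha : a ≤ L)
    (hb : b ≤ L) (hb0 : 0 < b) : Ev L N σ (.div N x y) (a / b) := by
  have h := Ev.fold (f := fun k z => z + (1 - ((k + 1) * b - a))) hx ha (Ev.const 0)
    (e := .add (.var (N + 1))
      (.sub (.const 1) (.sub (.mul (N + 2) (.add (.var N) (.const 1)) y) x)))
    fun k _ z => Ev.acc.add ((Ev.const 1).sub
      (((Ev.counter.add (Ev.const 1)).mul hy.extend hb).sub hx.extend))
  refine Eq.mp (congrArg (Ev L N σ (.div N x y)) ?_) h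
  -- With truncated subtraction, 1 - ((k + 1) * b - a) is the indicator of (k + 1) * b ≤ a, so the
  -- fold counts the positive multiples of b up to a.
  have key : ∀ m : ℕ, (Nat.rec 0 (fun k z => z + (1 - ((k + 1) * b - a))) m : ℕ) =
      min m (a / b) := by
    intro m
    induction m with
    | zero => simp
    | succ m ih =>
      simp only
      rw [ih]
      have := Nat.le_div_iff_mul_le hb0 (x := m + 1) (y := a)
      by_cases hle : m + 1 ≤ a / b
      · have := this.1 hle
        omega
      · have : ¬ (m + 1) * b ≤ a := fun h' => hle (this.2 h')
        omega
  rw [key, min_eq_right (Nat.div_le_self a b)]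

/-- Remainders, with auxiliary variables from `N` on. -/
def mod (N : ℕ) (x y : NatExpr) : NatExpr := .sub x (.mul N y (.div N x y))

theorem Ev.mod {x y : NatExpr} {a b : ℕ} (hx : Ev L N σ x a) (hy : Ev L N σ y b) (ha : a ≤ L)
    (hb : b ≤ L) (hb0 : 0 < b) : Ev L N σ (.mod N x y) (a % b) := by
  have h := hx.sub (hy.mul (hx.div hy ha hb hb0) ((Nat.div_le_self a b).trans ha))
  refine Eq.mp (congrArg (Ev L N σ (.mod N x y)) ?_) h
  have := Nat.div_add_mod a b
  omega

end NatExpr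

/-- The address of the entry `(i, j)` of the array number `k < 8`. -/
def cell (k i j : ℕ) : ℕ := ((i + j) * (i + j) + i) * 8 + k

/-- The residue modulo 8 is k, and (i + j)² + i lies strictly below (i + j + 1)², so it determines i
+ j and then i. Arrays with k > 0 avoid the multiples of 8, where the scalar cells 0, 8 and 16 are
kept. -/
theorem cell_inj {k i j k' i' j' : ℕ} (hk : k < 8) (hk' : k' < 8) :
    cell k i j = cell k' i' j' ↔ k = k' ∧ i = i' ∧ j = j' := by
  refine ⟨fun h => ?_, fun ⟨h1, h2, h3⟩ => by rw [h1, h2, h3]⟩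
  have h1 : (i + j) * (i + j) + i = (i' + j') * (i' + j') + i' := by
    unfold cell at h
    omega
  have h2 : k = k' := by
    unfold cell at h
    omega
  have h3 : i + j = i' + j' := by
    rcases lt_trichotomy (i + j) (i' + j') with h | h | h
    · nlinarith
    · exact h
    · nlinarith
  rw [h3] at h1
  exact ⟨h2, by omega, by omega⟩

namespace NatExpr

/-- The expression for `cell`. -/
def cell (k : ℕ) (x y : NatExpr) : NatExpr :=
  .add (.mul 50 (.add (.mul 50 (.add x y) (.add x y)) x) (.const 8)) (.const k)

theorem Ev.cell {L : ℕ} {σ : ℕ → ℕ} {k a b : ℕ} {x y : NatExpr} (hx : Ev L 50 σ x a)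
    (hy : Ev L 50 σ y b) (hab : a + b ≤ L) (hL : 8 ≤ L) :
    Ev L 50 σ (.cell k x y) (RealRAM.cell k a b) :=
  ((((hx.add hy).mul (hx.add hy) hab).add hx).mul (Ev.const 8) hL).add (Ev.const k)

end NatExpr

/-- The states agree up to auxiliary cells. -/
def State.Visible (σ τ : State) : Prop :=
  (∀ i < 50, τ.nat i = σ.nat i) ∧ ∀ i, i ≠ 8 → τ.real i = σ.real i

namespace RealExpr

/-- In every state that agrees with `σ` up to auxiliary cells, the expression has the value `v` and
its evaluation runs no loop more than `L` times. -/
def Ev (A : ℕ → ℕ → ℝ) (L : ℕ) (σ : State) (x : RealExpr) (v : ℝ) : Prop :=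
  ∀ τ : State, σ.Visible τ → x.eval A τ = v ∧ x.Ok L τ.nat

variable {A : ℕ → ℕ → ℝ} {L : ℕ} {σ : State}

theorem Ev.const (q : ℚ) : Ev A L σ (.const q) q := fun _ _ => ⟨rfl, trivial⟩

theorem Ev.nat {x : NatExpr} {m : ℕ} (h : x.Ev L 50 σ.nat m) : Ev A L σ (.nat x) m :=
  fun τ hτ => ⟨congrArg Nat.cast (h τ.nat hτ.1).1, (h τ.nat hτ.1).2⟩

theorem Ev.get {x : NatExpr} {m : ℕ} (h : x.Ev L 50 σ.nat m) (hm : m ≠ 8) :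
    Ev A L σ (.get x) (σ.real m) :=
  fun τ hτ => ⟨by rw [eval, (h τ.nat hτ.1).1, hτ.2 m hm], (h τ.nat hτ.1).2⟩

theorem Ev.probe {x y : NatExpr} {a b : ℕ} (hx : x.Ev L 50 σ.nat a) (hy : y.Ev L 50 σ.nat b) :
    Ev A L σ (.probe x y) (A a b) :=
  fun τ hτ => ⟨by rw [eval, (hx τ.nat hτ.1).1, (hy τ.nat hτ.1).1],
    (hx τ.nat hτ.1).2, (hy τ.nat hτ.1).2⟩

theorem Ev.add {x y : RealExpr} {a b : ℝ} (hx : Ev A L σ x a) (hy : Ev A L σ y b) :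
    Ev A L σ (.add x y) (a + b) := fun τ hτ => by
  simp [eval, Ok, hx τ hτ, hy τ hτ]

theorem Ev.sub {x y : RealExpr} {a b : ℝ} (hx : Ev A L σ x a) (hy : Ev A L σ y b) :
    Ev A L σ (.sub x y) (a - b) := fun τ hτ => by
  simp [eval, Ok, hx τ hτ, hy τ hτ]

theorem Ev.mul {x y : RealExpr} {a b : ℝ} (hx : Ev A L σ x a) (hy : Ev A L σ y b) :
    Ev A L σ (.mul x y) (a * b) := fun τ hτ => by
  simp [eval, Ok, hx τ hτ, hy τ hτ]

theorem Ev.div {x y : RealExpr} {a b : ℝ} (hx : Ev A L σ x a) (hy : Ev A L σ y b) :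
    Ev A L σ (.div x y) (a / b) := fun τ hτ => by
  simp [eval, Ok, hx τ hτ, hy τ hτ]

open Classical in
theorem Ev.ite {x y p q : RealExpr} {a b c d : ℝ} (hx : Ev A L σ x a) (hy : Ev A L σ y b)
    (hp : Ev A L σ p c) (hq : Ev A L σ q d) :
    Ev A L σ (.ite x y p q) (if a ≤ b then c else d) := fun τ hτ => by
  simp [eval, Ok, hx τ hτ, hy τ hτ, hp τ hτ, hq τ hτ]

/-- The absolute value. -/
def abs (x : RealExpr) : RealExpr := .ite (.const 0) x x (.sub (.const 0) x)

theorem Ev.abs {x : RealExpr} {a : ℝ} (hx : Ev A L σ x a) : Ev A L σ (.abs x) |a| := by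
  have h := (Ev.const (A := A) (L := L) (σ := σ) 0).ite hx hx ((Ev.const 0).sub hx)
  refine Eq.mp (congrArg (Ev A L σ (.abs x)) ?_) h
  rw [Rat.cast_zero, zero_sub]
  split_ifs with h0
  · exact (abs_of_nonneg h0).symm
  · exact (abs_of_neg (not_le.1 h0)).symm

/-- All folds share the accumulator cell 8, which `State.Visible` ignores for this reason; the body
sees the running value as τ.real 8. Nesting is harmless because evaluation does not change the
surrounding state. -/
theorem Ev.fold {v : ℕ} {b : NatExpr} {i e : RealExpr} {m : ℕ} {z : ℝ} {f : ℕ → ℝ → ℝ}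
    (hb : b.Ev L 50 σ.nat m) (hm : m ≤ L) (hi : Ev A L σ i z)
    (he : ∀ k < m, ∀ τ, (σ.setNat v k).Visible τ → e.eval A τ = f k (τ.real 8) ∧ e.Ok L τ.nat) :
    Ev A L σ (.fold v 8 b i e) (Nat.rec z f m) := by
  intro τ hτ
  have hvis : ∀ k z, (σ.setNat v k).Visible ((τ.setNat v k).setReal 8 z) := by
    refine fun k z => ⟨fun i hi => ?_, fun i hi => ?_⟩
    · simp only [State.setNat, State.setReal, update_apply]
      split_ifs
      · rfl
      · exact hτ.1 i hi
    · simp only [State.setNat, State.setReal, update_of_ne hi]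
      exact hτ.2 i hi
  obtain ⟨hb1, hb2⟩ := hb τ.nat hτ.1
  refine ⟨?_, hb2, hb1.trans_le hm, (hi τ hτ).2, fun k hk => ?_⟩
  · rw [eval, hb1, (hi τ hτ).1]
    clear hm hb1 hb
    induction m with
    | zero => rfl
    | succ m ih =>
      simp only
      rw [ih fun k hk => he k (by omega), (he m (by omega) _ (hvis m _)).1]
      simp [State.setReal]
  · rw [hb1] at hk
    exact (he k hk _ (hvis k 0)).2

/-- The sum of `x` over the values of `v` below `b`. -/
def sum (v : ℕ) (b : NatExpr) (x : RealExpr) : RealExpr :=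
  .fold v 8 b (.const 0) (.add (.get (.const 8)) x)

theorem Ev.sum {v : ℕ} {b : NatExpr} {x : RealExpr} {m : ℕ} {f : ℕ → ℝ}
    (hb : b.Ev L 50 σ.nat m) (hm : m ≤ L) (hx : ∀ k < m, Ev A L (σ.setNat v k) x (f k)) :
    Ev A L σ (.sum v b x) (∑ k ∈ Finset.range m, f k) := by
  have h := Ev.fold (v := v) (f := fun k z => z + f k) hb hm (Ev.const 0)
    (e := .add (.get (.const 8)) x) fun k hk τ hτ => by
      obtain ⟨h1, h2⟩ := hx k hk τ hτ
      exact ⟨by rw [eval, h1]; rfl, trivial, h2⟩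
  refine Eq.mp (congrArg (Ev A L σ (.sum v b x)) ?_) h
  clear h hx hm hb
  induction m with
  | zero => simp
  | succ m ih => rw [Finset.sum_range_succ, ← ih]

/-- The product of `x` over the values of `v` below `b`. -/
def prod (v : ℕ) (b : NatExpr) (x : RealExpr) : RealExpr :=
  .fold v 8 b (.const 1) (.mul (.get (.const 8)) x)

theorem Ev.prod {v : ℕ} {b : NatExpr} {x : RealExpr} {m : ℕ} {f : ℕ → ℝ}
    (hb : b.Ev L 50 σ.nat m) (hm : m ≤ L) (hx : ∀ k < m, Ev A L (σ.setNat v k) x (f k)) :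
    Ev A L σ (.prod v b x) (∏ k ∈ Finset.range m, f k) := by
  have h := Ev.fold (v := v) (f := fun k z => z * f k) hb hm (Ev.const 1)
    (e := .mul (.get (.const 8)) x) fun k hk τ hτ => by
      obtain ⟨h1, h2⟩ := hx k hk τ hτ
      exact ⟨by rw [eval, h1]; rfl, trivial, h2⟩
  refine Eq.mp (congrArg (Ev A L σ (.prod v b x)) ?_) h
  clear h hx hm hb
  induction m with
  | zero => simp
  | succ m ih => rw [Finset.prod_range_succ, ← ih]

/-- The maximum of `x` over the values of `v` below `b`. -/
def max (v : ℕ) (b : NatExpr) (x : RealExpr) : RealExpr :=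
  -- A sum over the single index 0 evaluates x at v = 0, which serves as the initial value.
  .fold v 8 b (.sum v (.const 1) x) (.ite (.get (.const 8)) x x (.get (.const 8)))

/-- The minimum of `x` over the values of `v` below `b`. -/
def min (v : ℕ) (b : NatExpr) (x : RealExpr) : RealExpr :=
  .sub (.const 0) (.max v b (.sub (.const 0) x))

theorem Ev.max {v : ℕ} {b : NatExpr} {x : RealExpr} {m : ℕ} {f : ℕ → ℝ}
    (hb : b.Ev L 50 σ.nat m) (hm : m ≤ L) (hm0 : 0 < m)
    (hx : ∀ k < m, Ev A L (σ.setNat v k) x (f k)) :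
    ∃ M, Ev A L σ (.max v b x) M ∧ (∀ k < m, f k ≤ M) ∧ ∃ k < m, f k = M := by
  classical
  have h0 : Ev A L σ (.sum v (.const 1) x) (f 0) := by
    simpa using Ev.sum (m := 1) (NatExpr.Ev.const 1) (by omega)
      fun k hk => hx k (by omega)
  have h := Ev.fold (v := v) (f := fun k z => if z ≤ f k then f k else z) hb hm h0
    (e := .ite (.get (.const 8)) x x (.get (.const 8))) fun k hk τ hτ => by
      obtain ⟨h1, h2⟩ := hx k hk τ hτ
      refine ⟨?_, trivial, h2, h2, trivial⟩
      rw [eval, h1]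
      rfl
  refine ⟨_, h, ?_⟩
  have key : ∀ l : ℕ, (∀ k < l, f k ≤
      (Nat.rec (f 0) (fun k z => if z ≤ f k then f k else z) l : ℝ)) ∧
      ∃ k < l + 1, f k = (Nat.rec (f 0) (fun k z => if z ≤ f k then f k else z) l : ℝ) ∧
        (k < l ∨ l = 0) := by
    intro l
    induction l with
    | zero => exact ⟨fun k hk => absurd hk (by omega), 0, by omega, rfl, Or.inr rfl⟩
    | succ l ih =>
      obtain ⟨h1, k, hk, h2, h3⟩ := ih
      simp only
      set z : ℝ := Nat.rec (f 0) (fun k z => if z ≤ f k then f k else z) l with hz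
      split_ifs with hle
      · refine ⟨fun j hj => ?_, l, by omega, rfl, Or.inl (by omega)⟩
        rcases Nat.lt_succ_iff_lt_or_eq.1 hj with hj | rfl
        · exact (h1 j hj).trans hle
        · exact le_rfl
      · refine ⟨fun j hj => ?_, k, by omega, h2, Or.inl (by omega)⟩
        rcases Nat.lt_succ_iff_lt_or_eq.1 hj with hj | rfl
        · exact h1 j hj
        · exact (not_le.1 hle).le
  obtain ⟨h1, k, hk, h2, h3⟩ := key m
  exact ⟨h1, k, by omega, h2⟩

theorem Ev.min {v : ℕ} {b : NatExpr} {x : RealExpr} {m : ℕ} {f : ℕ → ℝ}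
    (hb : b.Ev L 50 σ.nat m) (hm : m ≤ L) (hm0 : 0 < m)
    (hx : ∀ k < m, Ev A L (σ.setNat v k) x (f k)) :
    ∃ M, Ev A L σ (.min v b x) M ∧ (∀ k < m, M ≤ f k) ∧ ∃ k < m, f k = M := by
  obtain ⟨M, h1, h2, k, hk, h3⟩ := Ev.max (f := fun k => (0 : ℚ) - f k) hb hm hm0
    fun k hk => (Ev.const 0).sub (hx k hk)
  refine ⟨_, (Ev.const 0).sub h1, fun j hj => ?_, k, hk, ?_⟩
  · have := h2 j hj
    push_cast at *
    linarith
  · push_cast at *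
    linarith

end RealExpr

/-! ### Hoare-style rules for statements -/

namespace Stmt

variable {A : ℕ → ℕ → ℝ} {L : ℕ} {σ : State} {Q : State → Prop}

/-- Started in `σ`, the statement runs no loop more than `L` times and ends in a state with `Q`. -/
def Tr (A : ℕ → ℕ → ℝ) (L : ℕ) (p : Stmt) (σ : State) (Q : State → Prop) : Prop :=
  p.Ok A L σ ∧ Q (p.run A σ)

theorem Tr.mono {p : Stmt} {Q' : State → Prop} (h : Tr A L p σ Q) (hQ : ∀ τ, Q τ → Q' τ) :
    Tr A L p σ Q' := ⟨h.1, hQ _ h.2⟩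

theorem _root_.RealRAM.State.Visible.refl (σ : State) : σ.Visible σ :=
  ⟨fun _ _ => rfl, fun _ _ => rfl⟩

theorem Tr.setNat {i m : ℕ} {x : NatExpr} (hx : x.Ev L 50 σ.nat m) (hQ : Q (σ.setNat i m)) :
    Tr A L (.setNat i x) σ Q := by
  obtain ⟨h1, h2⟩ := hx σ.nat fun _ _ => rfl
  exact ⟨h2, by rwa [run, h1]⟩

theorem Tr.set {i : NatExpr} {m : ℕ} {x : RealExpr} {v : ℝ} (hi : i.Ev L 50 σ.nat m)
    (hx : x.Ev A L σ v) (hQ : Q (σ.setReal m v)) : Tr A L (.set i x) σ Q := by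
  obtain ⟨h1, h2⟩ := hi σ.nat fun _ _ => rfl
  obtain ⟨h3, h4⟩ := hx σ (.refl σ)
  exact ⟨⟨h2, h4⟩, by rwa [run, h1, h3]⟩

theorem Tr.seq {p q : Stmt} {Q' : State → Prop} (hp : Tr A L p σ Q)
    (hq : ∀ τ, Q τ → Tr A L q τ Q') : Tr A L (.seq p q) σ Q' :=
  ⟨⟨hp.1, (hq _ hp.2).1⟩, (hq _ hp.2).2⟩

theorem Tr.ite {x y : RealExpr} {a b : ℝ} {p q : Stmt} (hx : x.Ev A L σ a) (hy : y.Ev A L σ b)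
    (hp : a ≤ b → Tr A L p σ Q) (hq : ¬ a ≤ b → Tr A L q σ Q) : Tr A L (.ite x y p q) σ Q := by
  obtain ⟨h1, h2⟩ := hx σ (.refl σ)
  obtain ⟨h3, h4⟩ := hy σ (.refl σ)
  refine ⟨⟨h2, h4, fun h => (hp (by rwa [h1, h3] at h)).1, fun h => (hq (by rwa [h1, h3] at h)).1⟩,
    ?_⟩
  rw [run, h1, h3]
  split_ifs with h
  · exact (hp h).2
  · exact (hq h).2

theorem Tr.loop {v m : ℕ} {b : NatExpr} {p : Stmt} (hb : b.Ev L 50 σ.nat m) (hm : m ≤ L)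
    (I : ℕ → State → Prop) (h0 : I 0 σ)
    (hstep : ∀ k < m, ∀ τ, I k τ → Tr A L p (τ.setNat v k) (I (k + 1))) :
    Tr A L (.loop v b p) σ (I m) := by
  obtain ⟨h1, h2⟩ := hb σ.nat fun _ _ => rfl
  have key : ∀ k ≤ m, I k (Nat.rec σ (fun k τ => p.run A (τ.setNat v k)) k) := by
    intro k
    induction k with
    | zero => exact fun _ => h0
    | succ k ih => exact fun hk => (hstep k (by omega) _ (ih (by omega))).2
  refine ⟨⟨h2, h1.trans_le hm, fun k hk => ?_⟩, ?_⟩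
  · rw [h1] at hk
    exact (hstep k hk _ (key k hk.le)).1
  · rw [run, h1]
    exact key m le_rfl

end Stmt

end RealRAM

/-! ### Partition functions and a minimax formula -/

namespace Ising

open Real

/-- The function `log (2 cosh y)`, the logarithm of the partition function of a single spin. -/
noncomputable def logTwoCosh (y : ℝ) : ℝ := log (2 * cosh y)

theorem two_mul_cosh (y : ℝ) : 2 * cosh y = exp y + exp (-y) := by
  rw [cosh_eq]
  ring

theorem exp_logTwoCosh (y : ℝ) : exp (logTwoCosh y) = 2 * cosh y :=
  exp_log (by positivity)

theorem logTwoCosh_nonneg (y : ℝ) : 0 ≤ logTwoCosh y :=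
  log_nonneg (by linarith [one_le_cosh y])

theorem continuous_logTwoCosh : Continuous logTwoCosh :=
  (continuous_const.mul continuous_cosh).log fun y => (mul_pos two_pos (cosh_pos y)).ne'

theorem hasDerivAt_logTwoCosh (y : ℝ) : HasDerivAt logTwoCosh (sinh y / cosh y) y := by
  have h := ((hasDerivAt_cosh y).const_mul 2).log (by positivity)
  rwa [mul_div_mul_left _ _ two_ne_zero] at h

/-- After exponentiation this is a termwise comparison: exp (±a) ≤ exp |a - b| * exp (±b). -/
theorem logTwoCosh_sub_le (a b : ℝ) : logTwoCosh a - logTwoCosh b ≤ |a - b| := by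
  rw [sub_le_iff_le_add, ← exp_le_exp, exp_add, exp_logTwoCosh, exp_logTwoCosh, two_mul_cosh,
    two_mul_cosh, mul_add, ← exp_add, ← exp_add]
  gcongr
  · linarith [le_abs_self (a - b)]
  · linarith [neg_abs_le (a - b)]

theorem abs_sinh_div_cosh_le (y : ℝ) : |sinh y / cosh y| ≤ 1 := by
  rw [abs_div, abs_of_pos (cosh_pos y), div_le_one (cosh_pos y), abs_le]
  have := sinh_lt_cosh (-y)
  rw [sinh_neg, cosh_neg] at this
  exact ⟨by linarith, (sinh_lt_cosh y).le⟩

variable {ι κ : Type*} [Fintype ι] [Fintype κ] [DecidableEq ι]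

/-- A spin as a real number. -/
def spin (u : ℤˣ) : ℝ := ((u : ℤ) : ℝ)

@[simp] theorem spin_one : spin 1 = 1 := by simp [spin]

@[simp] theorem spin_neg_one : spin (-1) = -1 := by simp [spin]

theorem spin_mul_self (u : ℤˣ) : spin u * spin u = 1 := by
  rcases Int.units_eq_one_or u with rfl | rfl <;> simp

theorem abs_spin (u : ℤˣ) : |spin u| = 1 := by
  rcases Int.units_eq_one_or u with rfl | rfl <;> simp

theorem sum_units (f : ℤˣ → ℝ) : ∑ u, f u = f 1 + f (-1) := by
  rw [UnitsInt.univ, Finset.sum_pair (by decide)]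

theorem sum_prod_units (f : ι → ℤˣ → ℝ) :
    ∑ x : ι → ℤˣ, ∏ j, f j (x j) = ∏ j, (f j 1 + f j (-1)) := by
  simp_rw [← sum_units, Finset.prod_univ_sum, Fintype.piFinset_univ]

theorem sum_exp_field (y : ι → ℝ) :
    ∑ x : ι → ℤˣ, exp (∑ j, y j * spin (x j)) = exp (∑ j, logTwoCosh (y j)) := by
  simp_rw [exp_sum]
  rw [sum_prod_units fun j u => exp (y j * spin u)]
  refine Finset.prod_congr rfl fun j _ => ?_
  rw [exp_logTwoCosh, two_mul_cosh]
  simp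

/-- The second moments of independent spins. -/
theorem sum_exp_field_mul (y : ι → ℝ) (j k : ι) :
    ∑ x : ι → ℤˣ, exp (∑ l, y l * spin (x l)) * (spin (x j) * spin (x k)) =
      exp (∑ l, logTwoCosh (y l)) *
        (if j = k then 1 else sinh (y j) / cosh (y j) * (sinh (y k) / cosh (y k))) := by
  split_ifs with hjk
  · subst hjk
    simp_rw [spin_mul_self, mul_one, sum_exp_field]
  · have h1 : ∀ x : ι → ℤˣ, exp (∑ l, y l * spin (x l)) * (spin (x j) * spin (x k)) =
        ∏ l, exp (y l * spin (x l)) * ((if l = j then spin (x l) else 1) *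
          (if l = k then spin (x l) else 1)) := by
      intro x
      rw [Finset.prod_mul_distrib, Finset.prod_mul_distrib, exp_sum]
      simp
    simp_rw [h1]
    rw [sum_prod_units fun l u => exp (y l * spin u) * ((if l = j then spin u else 1) *
          (if l = k then spin u else 1))]
    have h2 : sinh (y j) / cosh (y j) * (sinh (y k) / cosh (y k)) =
        ∏ l, ((if l = j then sinh (y l) / cosh (y l) else 1) *
          (if l = k then sinh (y l) / cosh (y l) else 1)) := by
      rw [Finset.prod_mul_distrib]
      simp
    rw [h2, exp_sum, ← Finset.prod_mul_distrib]
    refine Finset.prod_congr rfl fun l _ => ?_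
    have hc := cosh_pos (y l)
    have hs : 2 * sinh (y l) = exp (y l) - exp (-y l) := by rw [sinh_eq]; ring
    have hcc := two_mul_cosh (y l)
    rw [exp_logTwoCosh]
    by_cases hj : l = j <;> by_cases hk : l = k
    · exact absurd (hj.symm.trans hk) hjk
    · subst hj
      simp only [hk, if_true, if_false]
      field_simp
      simp
      linarith
    · subst hk
      simp only [hj, if_true, if_false]
      field_simp
      simp
      linarith
    · simp only [hj, hk, if_false]
      simp
      linarith

/-- The Gibbs variational principle for product measures. -/
theorem gibbs_le (B : ι → ι → ℝ) (y : ι → ℝ) :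
    ∑ j, logTwoCosh (y j) - ∑ j, y j * (sinh (y j) / cosh (y j)) +
        ∑ j, ∑ k, B j k * (sinh (y j) / cosh (y j)) * (sinh (y k) / cosh (y k)) +
        ∑ j, B j j * (1 - (sinh (y j) / cosh (y j)) ^ 2) ≤
      log (∑ x : ι → ℤˣ, exp (∑ j, ∑ k, B j k * spin (x j) * spin (x k))) := by
  set m : ι → ℝ := fun j => sinh (y j) / cosh (y j) with hm
  set W := exp (∑ l, logTwoCosh (y l)) with hW
  -- W is the total mass of the product measure with means m, and δ is the mean under it of the
  -- quadratic exponent minus the linear one. The diagonal correction appears because a spin has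
  -- second moment 1, not m j ^ 2.
  set δ := ∑ j, ∑ k, B j k * m j * m k + ∑ j, B j j * (1 - m j ^ 2) - ∑ j, y j * m j with hδ
  have hfirst : ∀ j, ∑ x : ι → ℤˣ, exp (∑ l, y l * spin (x l)) * spin (x j) = W * m j := by
    intro j
    have h1 : ∀ x : ι → ℤˣ, exp (∑ l, y l * spin (x l)) * spin (x j) =
        ∏ l, exp (y l * spin (x l)) * (if l = j then spin (x l) else 1) := by
      intro x
      rw [Finset.prod_mul_distrib, exp_sum]
      simp
    simp_rw [h1]
    rw [sum_prod_units fun l u => exp (y l * spin u) * (if l = j then spin u else 1)]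
    have h2 : m j = ∏ l, (if l = j then m l else 1) := by simp
    rw [h2, hW, exp_sum, ← Finset.prod_mul_distrib]
    refine Finset.prod_congr rfl fun l _ => ?_
    have hc := cosh_pos (y l)
    have hs : 2 * sinh (y l) = exp (y l) - exp (-y l) := by rw [sinh_eq]; ring
    have hcc := two_mul_cosh (y l)
    rw [exp_logTwoCosh]
    by_cases hj : l = j
    · simp only [hj, hm, if_true] at *
      field_simp
      simp
      linarith
    · simp only [hj, if_false]
      simp
      linarith
  have hmean : ∑ x : ι → ℤˣ, exp (∑ l, y l * spin (x l)) *
      (∑ j, ∑ k, B j k * spin (x j) * spin (x k) - ∑ j, y j * spin (x j)) = W * δ := by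
    have e1 : ∑ x : ι → ℤˣ, exp (∑ l, y l * spin (x l)) *
        (∑ j, ∑ k, B j k * spin (x j) * spin (x k)) =
        W * (∑ j, ∑ k, B j k * m j * m k + ∑ j, B j j * (1 - m j ^ 2)) := by
      simp_rw [Finset.mul_sum]
      rw [Finset.sum_comm]
      rw [← Finset.sum_add_distrib, Finset.mul_sum]
      refine Finset.sum_congr rfl fun j _ => ?_
      rw [Finset.sum_comm]
      have : ∀ k, ∑ x : ι → ℤˣ, exp (∑ l, y l * spin (x l)) * (B j k * spin (x j) * spin (x k)) =
          W * (B j k * m j * m k) + if j = k then W * (B j k * (1 - m j ^ 2)) else 0 := by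
        intro k
        have := sum_exp_field_mul y j k
        calc _ = B j k * ∑ x : ι → ℤˣ, exp (∑ l, y l * spin (x l)) * (spin (x j) * spin (x k)) := by
              rw [Finset.mul_sum]
              exact Finset.sum_congr rfl fun x _ => by ring
          _ = _ := by
              rw [this]
              split_ifs with h
              · subst h
                ring
              · ring
      simp_rw [this, Finset.sum_add_distrib]
      rw [← Finset.mul_sum]
      simp
      ring
    have e2 : ∑ x : ι → ℤˣ, exp (∑ l, y l * spin (x l)) * (∑ j, y j * spin (x j)) =
        W * ∑ j, y j * m j := by
      simp_rw [Finset.mul_sum]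
      rw [Finset.sum_comm]
      refine Finset.sum_congr rfl fun j _ => ?_
      rw [mul_left_comm, ← hfirst j, Finset.mul_sum]
      exact Finset.sum_congr rfl fun x _ => by ring
    simp_rw [mul_sub, Finset.sum_sub_distrib]
    rw [e1, e2, hδ]
    ring
  have hWpos : 0 < W := exp_pos _
  -- Jensen's inequality in the form 1 + u ≤ exp u, applied to u = b - a - δ, which has mean zero
  -- under the product measure.
  have key : W * exp δ ≤ ∑ x : ι → ℤˣ, exp (∑ j, ∑ k, B j k * spin (x j) * spin (x k)) := by
    calc W * exp δ = exp δ * ((1 - δ) * W + W * δ) := by ring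
      _ = ∑ x : ι → ℤˣ, exp δ * (exp (∑ l, y l * spin (x l)) * ((1 - δ) +
          (∑ j, ∑ k, B j k * spin (x j) * spin (x k) - ∑ j, y j * spin (x j)))) := by
            rw [← Finset.mul_sum, ← hmean, hW, ← sum_exp_field, Finset.mul_sum,
              ← Finset.sum_add_distrib]
            congr 1
            exact Finset.sum_congr rfl fun x _ => by ring
      _ ≤ _ := by
            refine Finset.sum_le_sum fun x _ => ?_
            set a := ∑ l, y l * spin (x l)
            set b := ∑ j, ∑ k, B j k * spin (x j) * spin (x k)
            have := add_one_le_exp (b - a - δ)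
            calc exp δ * (exp a * (1 - δ + (b - a)))
                ≤ exp δ * (exp a * exp (b - a - δ)) := by gcongr; linarith
              _ = exp b := by
                rw [← exp_add, ← exp_add]
                ring_nf
  calc _ = log (W * exp δ) := by
        rw [log_mul hWpos.ne' (exp_pos _).ne', hW, log_exp, log_exp, hδ]
        ring
    _ ≤ _ := log_le_log (by positivity) key

/-- The external field that belongs to a point of the dual problem. -/
def field (P R : κ → ι → ℝ) (h : κ → ℝ) (zp zm : κ → ℝ) (j : ι) : ℝ :=
  2 * ∑ i, h i * (P i j * zp i - R i j * zm i)

/-- The objective function of the minimax formula. -/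
noncomputable def dual (P R : κ → ι → ℝ) (h : κ → ℝ) (zp zm : κ → ℝ) : ℝ :=
  ∑ j, logTwoCosh (field P R h zp zm j) - ∑ i, h i * (zp i ^ 2 - zm i ^ 2)

/-- A quadratic form as a difference of sums of squares. -/
def form (P R : κ → ι → ℝ) (h : κ → ℝ) (x : ι → ℝ) : ℝ :=
  ∑ i, h i * ((∑ j, P i j * x j) ^ 2 - (∑ j, R i j * x j) ^ 2)

variable (P R : κ → ι → ℝ) (h : κ → ℝ)

omit [DecidableEq ι] in
theorem sum_field_mul (zp zm : κ → ℝ) (x : ι → ℝ) : ∑ j, field P R h zp zm j * x j =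
    2 * ∑ i, h i * (zp i * (∑ j, P i j * x j) - zm i * ∑ j, R i j * x j) := by
  simp_rw [field, mul_assoc, ← Finset.mul_sum, Finset.sum_mul]
  rw [Finset.sum_comm]
  congr 1
  refine Finset.sum_congr rfl fun i _ => ?_
  rw [Finset.mul_sum, Finset.mul_sum, ← Finset.sum_sub_distrib, Finset.mul_sum]
  exact Finset.sum_congr rfl fun j _ => by ring

/-- Tangents: -(R·x)² ≤ zm² - 2 zm (R·x) for every zm, while (P·x)² exceeds its tangent at zp by
(P·x - zp)², at most η in total at a suitable net point. Each x is charged to one term of a sum over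
the net, and every term is a partition function of independent spins. Since zm is unrestricted, it
can be chosen later as the best response to zp. -/
theorem log_sum_exp_form_le {α : Type*} [Fintype α] (hh : ∀ i, 0 ≤ h i) {η M : ℝ}
    (zp zm : α → κ → ℝ)
    (hnet : ∀ x : ι → ℤˣ, ∃ a, ∑ i, h i * (∑ j, P i j * spin (x j) - zp a i) ^ 2 ≤ η)
    (hM : ∀ a, dual P R h (zp a) (zm a) ≤ M) :
    log (∑ x : ι → ℤˣ, exp (form P R h fun j => spin (x j))) ≤
      log (Fintype.card α) + η + M := by
  have hα : Nonempty α := ⟨(hnet fun _ => 1).choose⟩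
  have hsum : ∑ x : ι → ℤˣ, exp (form P R h fun j => spin (x j)) ≤
      Fintype.card α * exp (η + M) := by
    calc _ ≤ ∑ x : ι → ℤˣ, ∑ a, exp (η - ∑ i, h i * (zp a i ^ 2 - zm a i ^ 2)) *
          exp (∑ j, field P R h (zp a) (zm a) j * spin (x j)) := by
          refine Finset.sum_le_sum fun x _ => ?_
          obtain ⟨a, ha⟩ := hnet x
          refine le_trans ?_ (Finset.single_le_sum (f := fun a =>
            exp (η - ∑ i, h i * (zp a i ^ 2 - zm a i ^ 2)) *
              exp (∑ j, field P R h (zp a) (zm a) j * spin (x j)))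
            (fun a _ => by positivity) (Finset.mem_univ a))
          rw [← exp_add, exp_le_exp, sum_field_mul]
          refine le_trans ?_ (add_le_add_left (sub_le_sub_right ha _) _)
          rw [form, Finset.mul_sum, ← Finset.sum_sub_distrib, ← Finset.sum_add_distrib]
          refine Finset.sum_le_sum fun i _ => ?_
          nlinarith [mul_nonneg (hh i) (sq_nonneg (∑ j, R i j * spin (x j) - zm a i))]
      _ = ∑ a, exp (η + dual P R h (zp a) (zm a)) := by
          rw [Finset.sum_comm]
          refine Finset.sum_congr rfl fun a _ => ?_
          rw [← Finset.mul_sum, sum_exp_field, ← exp_add, dual]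
          ring_nf
      _ ≤ ∑ a : α, exp (η + M) := Finset.sum_le_sum fun a _ => by
          gcongr
          exact hM a
      _ = _ := by simp
  have hcard : (0 : ℝ) < Fintype.card α := by exact_mod_cast Fintype.card_pos
  calc _ ≤ log (Fintype.card α * exp (η + M)) :=
        log_le_log (Finset.sum_pos (fun _ _ => exp_pos _) ⟨fun _ => 1, Finset.mem_univ _⟩) hsum
    _ = _ := by rw [log_mul hcard.ne' (exp_pos _).ne', log_exp]; ring

-- The spin terms are 1-Lipschitz in the field and the squares are factored. This controls the move
-- from the mean field point to the nearest grid point.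
omit [DecidableEq ι] in
theorem dual_sub_le (zp z z' : κ → ℝ) (hh : ∀ i, 0 ≤ h i) :
    dual P R h zp z - dual P R h zp z' ≤
      ∑ i, h i * (2 * (∑ j, |R i j|) * |z i - z' i| + |z i - z' i| * |z i + z' i|) := by
  have h1 : ∀ j, logTwoCosh (field P R h zp z j) - logTwoCosh (field P R h zp z' j) ≤
      ∑ i, h i * (2 * |R i j| * |z i - z' i|) := by
    intro j
    refine (logTwoCosh_sub_le _ _).trans ?_
    rw [field, field, ← mul_sub, ← Finset.sum_sub_distrib, Finset.mul_sum]
    refine (Finset.abs_sum_le_sum_abs _ _).trans (Finset.sum_le_sum fun i _ => le_of_eq ?_)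
    rw [show 2 * (h i * (P i j * zp i - R i j * z i) - h i * (P i j * zp i - R i j * z' i)) =
      h i * (2 * (-R i j) * (z i - z' i)) by ring, abs_mul, abs_mul, abs_mul, abs_neg,
      abs_of_nonneg (hh i), abs_two]
  have h2 := Finset.sum_le_sum fun j (_ : j ∈ Finset.univ) => h1 j
  rw [Finset.sum_sub_distrib, Finset.sum_comm] at h2
  have h3 : ∑ i, h i * (z i ^ 2 - z' i ^ 2) ≤ ∑ i, h i * (|z i - z' i| * |z i + z' i|) := by
    refine Finset.sum_le_sum fun i _ => mul_le_mul_of_nonneg_left ?_ (hh i)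
    rw [← abs_mul]
    exact (le_of_eq (by ring)).trans (le_abs_self _)
  have h4 : ∀ i, ∑ j, h i * (2 * |R i j| * |z i - z' i|) =
      h i * (2 * (∑ j, |R i j|) * |z i - z' i|) := by
    intro i
    simp only [Finset.mul_sum, Finset.sum_mul]
  simp_rw [h4] at h2
  simp_rw [mul_sub, Finset.sum_sub_distrib] at h3
  simp_rw [mul_add, Finset.sum_add_distrib, dual, mul_sub, Finset.sum_sub_distrib]
  simp_rw [← mul_assoc] at *
  linarith

omit [DecidableEq ι] in
/-- A minimiser of the dual problem in its second argument is a mean field solution. -/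
theorem exists_mean_field (hh : ∀ i, 0 < h i) (zp : κ → ℝ) :
    ∃ z : κ → ℝ, ∀ i, z i = ∑ j, R i j *
      (sinh (field P R h zp z j) / cosh (field P R h zp z j)) := by
  classical
  have hcont : Continuous fun z => dual P R h zp z := by
    unfold dual field
    refine (continuous_finsetSum _ fun j _ => continuous_logTwoCosh.comp ?_).sub ?_ <;> fun_prop
  -- The objective is coercive in z: `logTwoCosh` is nonnegative and the quadratic part contributes
  -- ∑ h i * z i ^ 2.
  have hmin : ∃ z, ∀ z', dual P R h zp z ≤ dual P R h zp z' := by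
    cases isEmpty_or_nonempty κ
    · exact ⟨0, fun z' => (congrArg _ (Subsingleton.elim _ _)).le⟩
    obtain ⟨i₀, hi₀⟩ := Finite.exists_min h
    refine hcont.exists_forall_le ?_
    have h1 : Filter.Tendsto (fun z : κ → ℝ => h i₀ * ‖z‖ ^ 2 - ∑ i, h i * zp i ^ 2)
        (Filter.cocompact _) Filter.atTop :=
      Filter.tendsto_atTop_add_const_right _ _ (((Filter.tendsto_pow_atTop two_ne_zero).comp
        (tendsto_norm_cocompact_atTop (E := κ → ℝ))).const_mul_atTop (hh i₀))
    refine Filter.tendsto_atTop_mono (fun z => ?_) h1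
    obtain ⟨i, hi⟩ : ∃ i, ‖z‖ = ‖z i‖ := by
      obtain ⟨i, -, hi⟩ := Finset.exists_mem_eq_sup' (s := Finset.univ) Finset.univ_nonempty
        fun i => ‖z i‖
      refine ⟨i, le_antisymm ?_ (norm_le_pi_norm z i)⟩
      rw [pi_norm_le_iff_of_nonneg (norm_nonneg _), ← hi]
      exact fun b => Finset.le_sup' (fun i => ‖z i‖) (Finset.mem_univ b)
    have h2 : h i₀ * ‖z‖ ^ 2 ≤ ∑ i, h i * z i ^ 2 := by
      refine le_trans ?_ (Finset.single_le_sum (f := fun i => h i * z i ^ 2)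
        (fun i _ => mul_nonneg (hh i).le (sq_nonneg _)) (Finset.mem_univ i))
      rw [hi, norm_eq_abs, sq_abs]
      exact mul_le_mul_of_nonneg_right (hi₀ i) (sq_nonneg _)
    have h3 : 0 ≤ ∑ j, logTwoCosh (field P R h zp z j) :=
      Finset.sum_nonneg fun j _ => logTwoCosh_nonneg _
    simp_rw [dual, mul_sub, Finset.sum_sub_distrib]
    linarith
  obtain ⟨z, hz⟩ := hmin
  set y := field P R h zp z with hy
  set m : ι → ℝ := fun j => sinh (y j) / cosh (y j) with hm
  refine ⟨z, fun i => ?_⟩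
  change z i = ∑ j, R i j * m j
  -- Only coordinate i is varied, by s; the vanishing derivative at s = 0 is the mean field equation
  -- times 2 * h i.
  obtain ⟨w, hw⟩ : ∃ w : ℝ → κ → ℝ, ∀ s k, w s k = z k + if k = i then s else 0 :=
    ⟨_, fun _ _ => rfl⟩
  have hw0 : w 0 = z := funext fun k => by simp [hw]
  have hfield : ∀ (s : ℝ) (j : ι), field P R h zp (w s) j =
      y j - 2 * h i * R i j * s := by
    intro s j
    have : ∀ k, h k * (P k j * zp k - R k j * (w s) k) =
        h k * (P k j * zp k - R k j * z k) - if k = i then h k * R k j * s else 0 := by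
      intro k
      by_cases hk : k = i
      · simp only [hw, if_pos hk]
        ring
      · simp only [hw, if_neg hk]
        ring
    rw [hy, field, field, Finset.sum_congr rfl fun k _ => this k, Finset.sum_sub_distrib]
    simp
    ring
  have hquad : ∀ s : ℝ, ∑ k, h k * (zp k ^ 2 - (w s) k ^ 2) =
      ∑ k, h k * (zp k ^ 2 - z k ^ 2) - h i * (2 * z i * s + s ^ 2) := by
    intro s
    have : ∀ k, h k * (zp k ^ 2 - (w s) k ^ 2) =
        h k * (zp k ^ 2 - z k ^ 2) - if k = i then h k * (2 * z k * s + s ^ 2) else 0 := by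
      intro k
      by_cases hk : k = i
      · simp only [hw, if_pos hk]
        ring
      · simp only [hw, if_neg hk]
        ring
    rw [Finset.sum_congr rfl fun k _ => this k, Finset.sum_sub_distrib]
    simp
  have hder : HasDerivAt (fun s : ℝ => dual P R h zp (w s))
      (∑ j, sinh (y j) / cosh (y j) * (-(2 * h i * R i j)) + h i * (2 * z i)) 0 := by
    have e : (fun s : ℝ => dual P R h zp (w s)) = fun s : ℝ =>
        ∑ j, logTwoCosh (y j - 2 * h i * R i j * s) -
          (∑ k, h k * (zp k ^ 2 - z k ^ 2) - h i * (2 * z i * s + s ^ 2)) := by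
      funext s
      rw [dual, hquad]
      simp_rw [hfield]
    rw [e]
    have h1 : HasDerivAt (fun s : ℝ => ∑ j, logTwoCosh (y j - 2 * h i * R i j * s))
        (∑ j, sinh (y j) / cosh (y j) * (-(2 * h i * R i j))) 0 := by
      refine HasDerivAt.fun_sum fun j _ => ?_
      have h2 : HasDerivAt (fun s : ℝ => y j - 2 * h i * R i j * s) (-(2 * h i * R i j)) 0 := by
        simpa using ((hasDerivAt_id (0 : ℝ)).const_mul (2 * h i * R i j)).const_sub (y j)
      have h3 : HasDerivAt logTwoCosh (sinh (y j) / cosh (y j)) (y j - 2 * h i * R i j * 0) := by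
        simpa using hasDerivAt_logTwoCosh (y j)
      exact HasDerivAt.comp (h₂ := logTwoCosh) (0 : ℝ) h3 h2
    have h2 : HasDerivAt (fun s : ℝ => ∑ k, h k * (zp k ^ 2 - z k ^ 2) -
        h i * (2 * z i * s + s ^ 2)) (-(h i * (2 * z i))) 0 := by
      have := ((((hasDerivAt_id (0 : ℝ)).const_mul (2 * z i)).add
        ((hasDerivAt_id (0 : ℝ)).pow 2)).const_mul (h i)).const_sub
          (∑ k, h k * (zp k ^ 2 - z k ^ 2))
      simpa using this
    have h3 := h1.sub h2
    rw [sub_neg_eq_add] at h3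
    exact h3
  have hlocal : IsLocalMin (fun s : ℝ => dual P R h zp (w s)) 0 :=
    Filter.Eventually.of_forall fun s => by simpa only [hw0] using hz (w s)
  have h0 := hlocal.hasDerivAt_eq_zero hder
  have : ∑ j, sinh (y j) / cosh (y j) * (-(2 * h i * R i j)) =
      -(2 * h i) * ∑ j, R i j * m j := by
    rw [Finset.mul_sum]
    exact Finset.sum_congr rfl fun j _ => by rw [hm]; ring
  rw [this] at h0
  have h4 : 2 * h i * (z i - ∑ j, R i j * m j) = 0 := by linarith
  rcases mul_eq_zero.1 h4 with h5 | h5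
  · linarith [hh i]
  · linarith

/-- At the mean field point, completing the square in zp turns the dual value into the entropy of
the product measure with means m, plus form m, minus ∑ h (zp - P·m)². This measure is a competitor
in `gibbs_le`. The additional sum pays for the diagonal, where spins have x_j² = 1 and form m has
m_j². -/
theorem exists_dual_le (hh : ∀ i, 0 < h i) (zp : κ → ℝ) :
    ∃ m : ι → ℝ, (∀ j, |m j| ≤ 1) ∧
      dual P R h zp (fun i => ∑ j, R i j * m j) ≤
        log (∑ x : ι → ℤˣ, exp (form P R h fun j => spin (x j))) +
          ∑ j, |∑ i, h i * (P i j ^ 2 - R i j ^ 2)| := by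
  obtain ⟨z, hzi⟩ := exists_mean_field P R h hh zp
  set y := field P R h zp z with hy
  set m : ι → ℝ := fun j => sinh (y j) / cosh (y j) with hm
  change ∀ i, z i = ∑ j, R i j * m j at hzi
  refine ⟨m, fun j => abs_sinh_div_cosh_le _, ?_⟩
  rw [← funext hzi]
  have hform : ∀ x : ι → ℝ, form P R h x =
      ∑ j, ∑ k, (∑ i, h i * (P i j * P i k - R i j * R i k)) * x j * x k := by
    intro x
    simp_rw [form, Finset.sum_mul]
    rw [Finset.sum_congr rfl fun j _ => Finset.sum_comm, Finset.sum_comm]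
    refine Finset.sum_congr rfl fun i _ => ?_
    rw [sq, sq, Finset.sum_mul_sum, Finset.sum_mul_sum, ← Finset.sum_sub_distrib, Finset.mul_sum]
    refine Finset.sum_congr rfl fun j _ => ?_
    rw [← Finset.sum_sub_distrib, Finset.mul_sum]
    exact Finset.sum_congr rfl fun k _ => by ring
  have hgibbs := gibbs_le (fun j k => ∑ i, h i * (P i j * P i k - R i j * R i k)) y
  have hdiag : -∑ j, |∑ i, h i * (P i j ^ 2 - R i j ^ 2)| ≤
      ∑ j, (∑ i, h i * (P i j * P i j - R i j * R i j)) * (1 - m j ^ 2) := by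
    rw [← Finset.sum_neg_distrib]
    refine Finset.sum_le_sum fun j _ => ?_
    simp_rw [← sq]
    set a := ∑ i, h i * (P i j ^ 2 - R i j ^ 2)
    have hm1 : m j ^ 2 ≤ 1 := (sq_le_one_iff_abs_le_one _).2 (abs_sinh_div_cosh_le _)
    calc -|a| ≤ -(|a| * (1 - m j ^ 2)) := by
          nlinarith [mul_nonneg (abs_nonneg a) (sq_nonneg (m j))]
      _ = (-|a|) * (1 - m j ^ 2) := by ring
      _ ≤ _ := mul_le_mul_of_nonneg_right (neg_abs_le a) (by linarith)
  have hS := hform m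
  have hfm := sum_field_mul P R h zp z m
  have hle : dual P R h zp z ≤ ∑ j, logTwoCosh (y j) - ∑ j, y j * m j + form P R h m := by
    rw [dual, hy, hfm, form, Finset.mul_sum]
    have : 0 ≤ ∑ i, h i * (zp i - ∑ j, P i j * m j) ^ 2 :=
      Finset.sum_nonneg fun i _ => mul_nonneg (hh i).le (sq_nonneg _)
    have e : ∑ i, h i * (zp i ^ 2 - z i ^ 2) = ∑ i, h i * (zp i - ∑ j, P i j * m j) ^ 2 +
        ∑ i, 2 * (h i * (zp i * (∑ j, P i j * m j) - z i * ∑ j, R i j * m j)) -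
        ∑ i, h i * ((∑ j, P i j * m j) ^ 2 - (∑ j, R i j * m j) ^ 2) := by
      rw [← Finset.sum_add_distrib, ← Finset.sum_sub_distrib]
      refine Finset.sum_congr rfl fun i _ => ?_
      rw [← hzi i]
      ring
    linarith
  simp_rw [hform fun j => spin _]
  rw [← hS] at hgibbs
  linarith

end Ising

/-! ### Discretisation of the minimax problem -/

namespace Ising

open Real

/-- The `d`-th point of a grid with `K` points in `[-B, B]`. -/
noncomputable def gridPoint (B : ℝ) (K d : ℕ) : ℝ := B * (2 * d + 1 - K) / K

theorem exists_gridPoint {B v : ℝ} {K : ℕ} (hK : 1 ≤ K) (hv : |v| ≤ B) :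
    ∃ d < K, |v - gridPoint B K d| ≤ B / K := by
  have hK' : (0 : ℝ) < K := by exact_mod_cast hK
  rcases (abs_nonneg v |>.trans hv).eq_or_lt with hB | hB
  · have : v = 0 := abs_eq_zero.1 (le_antisymm (hB ▸ hv) (abs_nonneg v))
    exact ⟨0, hK, by simp [gridPoint, ← hB, this]⟩
  obtain ⟨h1, h2⟩ := abs_le.1 hv
  obtain ⟨d, hd, h3, h4⟩ : ∃ d < K, (d : ℝ) ≤ (v + B) * K / (2 * B) ∧
      (v + B) * K / (2 * B) ≤ d + 1 := by
    set u := (v + B) * K / (2 * B) with hu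
    have hu0 : 0 ≤ u := div_nonneg (mul_nonneg (by linarith) hK'.le) (by linarith)
    have huK : u ≤ K := by
      rw [hu, div_le_iff₀ (by linarith)]
      nlinarith
    -- The right end point u = K has to be assigned to the last cell, as there is no cell number K.
    rcases huK.eq_or_lt with h | h
    · refine ⟨K - 1, by omega, ?_, ?_⟩ <;> push_cast [Nat.cast_sub hK] <;> linarith
    · exact ⟨⌊u⌋₊, (Nat.floor_lt hu0).2 h, Nat.floor_le hu0, (Nat.lt_floor_add_one u).le⟩
  refine ⟨d, hd, ?_⟩
  rw [le_div_iff₀ (by linarith)] at h3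
  rw [div_le_iff₀ (by linarith)] at h4
  have : v - gridPoint B K d = (v * K - B * (2 * d + 1 - K)) / K := by
    rw [gridPoint]
    field_simp
  rw [this, abs_div, abs_of_pos hK', div_le_div_iff_of_pos_right hK', abs_le]
  constructor <;> linarith

theorem abs_gridPoint_le {B : ℝ} {K d : ℕ} (hB : 0 ≤ B) (hd : d < K) : |gridPoint B K d| ≤ B := by
  have hK' : (0 : ℝ) < K := by exact_mod_cast (by omega : 0 < K)
  have hd' : (d : ℝ) + 1 ≤ K := by exact_mod_cast hd
  rw [gridPoint, abs_div, abs_of_pos hK', div_le_iff₀ hK', abs_mul, abs_of_nonneg hB]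
  refine mul_le_mul_of_nonneg_left (abs_le.2 ⟨?_, ?_⟩) hB
  · have : (0 : ℝ) ≤ d := d.cast_nonneg
    linarith
  · linarith

theorem abs_sum_mul_le {ι : Type*} [Fintype ι] (a x : ι → ℝ) (hx : ∀ j, |x j| ≤ 1) :
    |∑ j, a j * x j| ≤ ∑ j, |a j| := by
  refine (Finset.abs_sum_le_sum_abs _ _).trans (Finset.sum_le_sum fun j _ => ?_)
  rw [abs_mul]
  exact mul_le_of_le_one_right (abs_nonneg _) (hx j)

/-- The minimax value over two grids approximates the logarithm of the partition function. -/
theorem abs_sub_log_sum_exp_form_le {ι κ α : Type*} [Fintype ι] [Fintype κ] [Fintype α]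
    [DecidableEq ι] {P R : κ → ι → ℝ} {h : κ → ℝ} {K : ℕ} (hK : 1 ≤ K) (hh : ∀ i, 0 < h i)
    (d : α → κ → ℕ) (hsurj : ∀ g : κ → ℕ, (∀ i, g i < K) → ∃ a, d a = g)
    {b δ D out : ℝ} (f : α → α → ℝ)
    (hP : ∑ i, h i * (∑ j, |P i j|) ^ 2 ≤ b) (hR : ∑ i, h i * (∑ j, |R i j|) ^ 2 ≤ b)
    (hf : ∀ a a', |f a a' - dual P R h (fun i => gridPoint (∑ j, |P i j|) K (d a i))
      (fun i => gridPoint (∑ j, |R i j|) K (d a' i))| ≤ δ)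
    (hD : ∑ j, |∑ i, h i * (P i j ^ 2 - R i j ^ 2)| ≤ D)
    (hout : ∀ a, ∃ a', f a a' ≤ out) (hout' : ∃ a, ∀ a', out ≤ f a a') :
    |out - log (∑ x : ι → ℤˣ, exp (form P R h fun j => spin (x j)))| ≤
      log (Fintype.card α) + δ + 4 * b / K + D := by
  have hK' : (1 : ℝ) ≤ K := by exact_mod_cast hK
  have hD0 : 0 ≤ D := (Finset.sum_nonneg fun _ _ => abs_nonneg _).trans hD
  have hb0 : 0 ≤ b := (Finset.sum_nonneg fun i _ => mul_nonneg (hh i).le (sq_nonneg _)).trans hP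
  have hbK : b / K ≤ 4 * b / K := by gcongr; linarith
  obtain ⟨a₀, ha₀⟩ := hout'
  have hδ0 : 0 ≤ δ := (abs_nonneg _).trans (hf a₀ a₀)
  have hα : 0 ≤ log (Fintype.card α : ℝ) :=
    log_nonneg (by exact_mod_cast Fintype.card_pos_iff.2 ⟨a₀⟩)
  rw [abs_sub_le_iff]
  constructor
  -- Upper bound for `out`: the maximising grid point a₀ is answered by the grid point next to its
  -- mean field response.
  · obtain ⟨m, hm, hle⟩ := exists_dual_le P R h hh
      (fun i => gridPoint (∑ j, |P i j|) K (d a₀ i))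
    have hz : ∀ i, |∑ j, R i j * m j| ≤ ∑ j, |R i j| := fun i => abs_sum_mul_le _ _ hm
    choose g hg hg' using fun i => exists_gridPoint hK (hz i)
    obtain ⟨a, ha⟩ := hsurj g hg
    have h1 := dual_sub_le P R h (fun i => gridPoint (∑ j, |P i j|) K (d a₀ i))
      (fun i => gridPoint (∑ j, |R i j|) K (g i)) (fun i => ∑ j, R i j * m j) fun i => (hh i).le
    have h2 : ∑ i, h i * (2 * (∑ j, |R i j|) * |gridPoint (∑ j, |R i j|) K (g i) -
        ∑ j, R i j * m j| + |gridPoint (∑ j, |R i j|) K (g i) - ∑ j, R i j * m j| *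
        |gridPoint (∑ j, |R i j|) K (g i) + ∑ j, R i j * m j|) ≤ 4 * b / K := by
      calc _ ≤ ∑ i, h i * (4 * (∑ j, |R i j|) ^ 2 / K) := by
            refine Finset.sum_le_sum fun i _ => mul_le_mul_of_nonneg_left ?_ (hh i).le
            set B := ∑ j, |R i j|
            have hB : 0 ≤ B := Finset.sum_nonneg fun _ _ => abs_nonneg _
            have e1 := hg' i
            rw [abs_sub_comm] at e1
            have e2 : |gridPoint B K (g i) + ∑ j, R i j * m j| ≤ 2 * B :=
              (abs_add_le _ _).trans (by linarith [abs_gridPoint_le hB (hg i), hz i])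
            calc _ ≤ 2 * B * (B / K) + B / K * (2 * B) := by gcongr
              _ = _ := by ring
        _ = 4 * (∑ i, h i * (∑ j, |R i j|) ^ 2) / K := by
            rw [Finset.mul_sum, Finset.sum_div]
            exact Finset.sum_congr rfl fun i _ => by ring
        _ ≤ _ := by gcongr
    have h3 := ha₀ a
    have h4 := (abs_le.1 (hf a₀ a)).2
    rw [ha] at h4
    linarith
  -- Lower bound for `out`: the values P·x are rounded to the net, and the response a' a keeps the
  -- dual value at most out + δ at every net point.
  · choose a' ha' using hout
    have h1 := log_sum_exp_form_le P R h (fun i => (hh i).le) (η := b / K) (M := out + δ)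
      (fun a i => gridPoint (∑ j, |P i j|) K (d a i))
      (fun a i => gridPoint (∑ j, |R i j|) K (d (a' a) i)) (fun x => by
        have hz : ∀ i, |∑ j, P i j * spin (x j)| ≤ ∑ j, |P i j| := fun i =>
          abs_sum_mul_le _ _ fun j => (abs_spin _).le
        choose g hg hg' using fun i => exists_gridPoint hK (hz i)
        obtain ⟨a, ha⟩ := hsurj g hg
        refine ⟨a, ?_⟩
        rw [ha]
        calc _ ≤ ∑ i, h i * ((∑ j, |P i j|) ^ 2 / K) := by
              refine Finset.sum_le_sum fun i _ => mul_le_mul_of_nonneg_left ?_ (hh i).le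
              rw [← sq_abs]
              calc _ ≤ ((∑ j, |P i j|) / K) ^ 2 := by
                    gcongr
                    exact hg' i
                _ = (∑ j, |P i j|) ^ 2 / K / K := by ring
                _ ≤ _ := div_le_self (by positivity) hK'
          _ = (∑ i, h i * (∑ j, |P i j|) ^ 2) / K := by
              rw [Finset.sum_div]
              exact Finset.sum_congr rfl fun i _ => by ring
          _ ≤ _ := by gcongr)
      (fun a => by linarith [(abs_le.1 (hf a (a' a))).1, ha' a])
    linarith

/-! ### Approximation of `log (2 cosh y)` by rational operations -/

theorem logTwoCosh_eq (y : ℝ) : logTwoCosh y = |y| + log (1 + exp (-(2 * |y|))) := by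
  rw [← log_exp |y|, ← log_mul (exp_pos _).ne' (by positivity), logTwoCosh, ← cosh_abs,
    two_mul_cosh, mul_add, ← exp_add, mul_one, log_exp]
  ring_nf

/-- The logarithm telescopes along the points N + k * q, and each increment log (1 + x) with x = q /
(N + k * q) ≤ 1 / N differs from x by at most x². -/
theorem log_approx {q : ℝ} (hq : 0 ≤ q) (hq1 : q ≤ 1) {N : ℕ} (hN : 0 < N) :
    |∑ k ∈ Finset.range N, q / (N + k * q) - log (1 + q)| ≤ 1 / N := by
  have hN' : (0 : ℝ) < N := by exact_mod_cast hN
  have hpos : ∀ k : ℕ, (0 : ℝ) < N + k * q := fun k => by positivity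
  have htel : log (1 + q) = ∑ k ∈ Finset.range N, log (1 + q / (N + k * q)) := by
    have : ∀ k ∈ Finset.range N, log (1 + q / (N + k * q)) =
        log (N + (k + 1 : ℕ) * q) - log (N + k * q) := by
      intro k _
      rw [← log_div (hpos _).ne' (hpos _).ne']
      congr 1
      rw [eq_div_iff (hpos k).ne', add_mul, div_mul_cancel₀ _ (hpos k).ne']
      push_cast
      ring
    rw [Finset.sum_congr rfl this, Finset.sum_range_sub (fun k : ℕ => log (N + k * q)),
      ← log_div (hpos _).ne' (hpos _).ne']
    congr 1
    field_simp
    push_cast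
    ring
  rw [htel, ← Finset.sum_sub_distrib]
  refine (Finset.abs_sum_le_sum_abs _ _).trans ?_
  calc _ ≤ ∑ k ∈ Finset.range N, (1 / N : ℝ) ^ 2 := by
        refine Finset.sum_le_sum fun k _ => ?_
        set x := q / (N + k * q) with hx
        have hx0 : 0 ≤ x := div_nonneg hq (hpos k).le
        have hx1 : x ≤ 1 / N := by
          rw [hx]
          gcongr
          have : 0 ≤ k * q := by positivity
          linarith
        have h1 := log_le_sub_one_of_pos (show 0 < 1 + x by linarith)
        have h2 := one_sub_inv_le_log_of_pos (show 0 < 1 + x by linarith)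
        have h3 : x - x ^ 2 ≤ 1 - (1 + x)⁻¹ := by
          have : 1 - (1 + x)⁻¹ = x / (1 + x) := by
            field_simp
            ring
          rw [this, le_div_iff₀ (by linarith)]
          nlinarith [pow_nonneg hx0 3]
        rw [abs_le]
        constructor
        · nlinarith [sq_nonneg (1 / N : ℝ)]
        · nlinarith
    _ = 1 / N := by
        simp
        field_simp

/-- The error is uniform in u, whatever the size of the external fields. With x = u / (2m),
Bernoulli's inequality for (1 + x) * exp (-x) ≥ 1 - x² bounds the loss by 2m x² / (1 + x)^(2m), and
the even exponent gives (1 + x)^(2m) ≥ (m x)². -/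
theorem exp_approx {u : ℝ} (hu : 0 ≤ u) {m : ℕ} (hm : 0 < m) :
    exp (-u) ≤ (1 / (1 + u / (2 * m : ℕ))) ^ (2 * m) ∧
      (1 / (1 + u / (2 * m : ℕ))) ^ (2 * m) ≤ exp (-u) + 2 / m := by
  have hm' : (0 : ℝ) < m := by exact_mod_cast hm
  set x := u / (2 * m : ℕ) with hx
  have hx0 : 0 ≤ x := by positivity
  have hux : exp (-u) = exp (-x) ^ (2 * m) := by
    rw [← exp_nat_mul, hx]
    congr 1
    field_simp
  have h1 : exp (-x) ≤ 1 / (1 + x) := by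
    rw [exp_neg, one_div]
    gcongr
    linarith [add_one_le_exp x]
  rw [hux]
  refine ⟨by gcongr, ?_⟩
  set a := 1 / (1 + x) with ha
  have ha0 : 0 < a := by positivity
  have hb : 1 - x ^ 2 ≤ exp (-x) / a := by
    rw [ha, div_div_eq_mul_div, div_one]
    nlinarith [add_one_le_exp (-x)]
  have h2 : 1 + (2 * m : ℕ) * (exp (-x) / a - 1) ≤ (exp (-x) / a) ^ (2 * m) := by
    have := one_add_mul_le_pow (a := exp (-x) / a - 1) (by
      have : 0 ≤ exp (-x) / a := by positivity
      linarith) (2 * m)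
    simpa using this
  rw [div_pow, le_div_iff₀ (by positivity)] at h2
  have h3 : a ^ (2 * m) * ((2 * m : ℕ) * x ^ 2) ≤ 2 / m := by
    have h4 : (m * x) ^ 2 ≤ (1 + x) ^ (2 * m) := by
      rw [mul_comm 2 m, pow_mul]
      have := one_add_mul_le_pow (a := x) (by linarith) m
      gcongr
      linarith
    rw [ha, div_pow, one_pow, one_div_mul_eq_div, div_le_div_iff₀ (by positivity) hm']
    push_cast
    calc _ = 2 * (m * x) ^ 2 := by ring
      _ ≤ _ := by linarith
  have h5 : 0 ≤ a ^ (2 * m) * (2 * m : ℕ) * (exp (-x) / a - (1 - x ^ 2)) :=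
    mul_nonneg (by positivity) (by linarith)
  linarith

/-- A rational approximation of `logTwoCosh`. -/
noncomputable def logTwoCoshApprox (N : ℕ) (y : ℝ) : ℝ :=
  |y| + ∑ k ∈ Finset.range N, (∏ _l ∈ Finset.range N, 1 / (1 + 2 * |y| / N)) /
    (N + k * ∏ _l ∈ Finset.range N, 1 / (1 + 2 * |y| / N))

theorem abs_logTwoCoshApprox_sub_le (y : ℝ) {m : ℕ} (hm : 0 < m) :
    |logTwoCoshApprox (2 * m) y - logTwoCosh y| ≤ 3 / m := by
  have hm' : (0 : ℝ) < m := by exact_mod_cast hm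
  obtain ⟨h1, h2⟩ := exp_approx (u := 2 * |y|) (by positivity) hm
  rw [logTwoCoshApprox, logTwoCosh_eq, Finset.prod_const, Finset.card_range]
  set q := (1 / (1 + 2 * |y| / (2 * m : ℕ))) ^ (2 * m) with hq
  have hq0 : 0 ≤ q := by positivity
  have hq1 : q ≤ 1 := by
    refine pow_le_one₀ (by positivity) ?_
    rw [div_le_one (by positivity)]
    have : 0 ≤ 2 * |y| / (2 * m : ℕ) := by positivity
    linarith
  have h3 := log_approx hq0 hq1 (N := 2 * m) (by omega)
  set p := exp (-(2 * |y|)) with hp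
  have hp0 : 0 < p := exp_pos _
  have h4 : log (1 + p) ≤ log (1 + q) := log_le_log (by linarith) (by linarith)
  have h5 : log (1 + q) - log (1 + p) ≤ 2 / m := by
    rw [← log_div (by linarith) (by linarith)]
    refine (log_le_sub_one_of_pos (by positivity)).trans ?_
    rw [div_sub_one (by linarith), div_le_iff₀ (by linarith)]
    have : 0 ≤ 2 / (m : ℝ) * p := by positivity
    linarith
  have h6 : (1 : ℝ) / (2 * m : ℕ) ≤ 1 / m := by
    push_cast
    gcongr
    linarith
  have h7 : (3 : ℝ) / m = 2 / m + 1 / m := by ring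
  rw [h7]
  have := abs_le.1 h3
  rw [abs_le]
  constructor <;> linarith

end Ising

namespace Ising

open Matrix

variable {ι : Type*} [Fintype ι]

/-! ### Moments of a positive semidefinite matrix -/

theorem dotProduct_sq_le (x y : ι → ℝ) : (x ⬝ᵥ y) ^ 2 ≤ (x ⬝ᵥ x) * (y ⬝ᵥ y) := by
  simpa [dotProduct, ← sq] using Finset.sum_mul_sq_le_sq_mul_sq Finset.univ x y

theorem dotProduct_self_nonneg' (x : ι → ℝ) : 0 ≤ x ⬝ᵥ x :=
  Finset.sum_nonneg fun i _ => mul_self_nonneg (x i)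

/-- The normalised Gram matrix of `Q`. -/
noncomputable def gram (Q : Matrix ι ι ℝ) (c : ℝ) : Matrix ι ι ℝ := c⁻¹ • (Qᵀ * Q)

theorem dotProduct_gram (Q : Matrix ι ι ℝ) (c : ℝ) (x y : ι → ℝ) :
    x ⬝ᵥ (gram Q c *ᵥ y) = c⁻¹ * ((Q *ᵥ x) ⬝ᵥ (Q *ᵥ y)) := by
  rw [gram, smul_mulVec, dotProduct_smul, ← mulVec_mulVec, dotProduct_mulVec, vecMul_transpose,
    smul_eq_mul]

variable [DecidableEq ι]

theorem gram_pow_transpose (Q : Matrix ι ι ℝ) (c : ℝ) (k : ℕ) : (gram Q c ^ k)ᵀ = gram Q c ^ k := by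
  rw [transpose_pow, gram, transpose_smul, transpose_mul, transpose_transpose]

/-- The moments of a vector with respect to the Gram matrix. -/
noncomputable def moment (Q : Matrix ι ι ℝ) (c : ℝ) (x : ι → ℝ) (q : ℕ) : ℝ :=
  x ⬝ᵥ (gram Q c ^ q *ᵥ x)

theorem moment_add (Q : Matrix ι ι ℝ) (c : ℝ) (x : ι → ℝ) (a b : ℕ) :
    moment Q c x (a + b) = (gram Q c ^ a *ᵥ x) ⬝ᵥ (gram Q c ^ b *ᵥ x) := by
  rw [moment, pow_add, ← mulVec_mulVec, dotProduct_mulVec, ← mulVec_transpose, gram_pow_transpose]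

theorem moment_add_add_one (Q : Matrix ι ι ℝ) (c : ℝ) (x : ι → ℝ) (a b : ℕ) :
    moment Q c x (a + b + 1) =
      c⁻¹ * ((Q *ᵥ (gram Q c ^ a *ᵥ x)) ⬝ᵥ (Q *ᵥ (gram Q c ^ b *ᵥ x))) := by
  rw [add_assoc, moment_add, pow_succ', ← mulVec_mulVec, dotProduct_gram]

theorem moment_zero (Q : Matrix ι ι ℝ) (c : ℝ) (x : ι → ℝ) : moment Q c x 0 = x ⬝ᵥ x := by
  simp [moment]

theorem moment_one (Q : Matrix ι ι ℝ) (c : ℝ) (x : ι → ℝ) :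
    moment Q c x 1 = c⁻¹ * ((Q *ᵥ x) ⬝ᵥ (Q *ᵥ x)) := by
  simpa using moment_add_add_one Q c x 0 0

theorem moment_nonneg (Q : Matrix ι ι ℝ) {c : ℝ} (hc : 0 < c) (x : ι → ℝ) (q : ℕ) :
    0 ≤ moment Q c x q := by
  rcases Nat.even_or_odd' q with ⟨a, rfl | rfl⟩
  · rw [two_mul, moment_add]
    exact dotProduct_self_nonneg' _
  · rw [two_mul, moment_add_add_one]
    exact mul_nonneg (inv_nonneg.2 hc.le) (dotProduct_self_nonneg' _)

/-- Cauchy–Schwarz, for the standard inner product if q is even and for the images under Q if q is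
odd. -/
theorem moment_sq_le (Q : Matrix ι ι ℝ) (c : ℝ) (x : ι → ℝ) (q : ℕ) :
    moment Q c x (q + 1) ^ 2 ≤ moment Q c x q * moment Q c x (q + 2) := by
  rcases Nat.even_or_odd' q with ⟨a, rfl | rfl⟩
  · rw [show 2 * a + 1 = a + (a + 1) by ring, show 2 * a + 2 = (a + 1) + (a + 1) by ring,
      show 2 * a = a + a by ring, moment_add, moment_add, moment_add]
    exact dotProduct_sq_le _ _
  · rw [show 2 * a + 1 + 1 = a + (a + 1) + 1 by ring, show 2 * a + 1 + 2 = (a + 1) + (a + 1) + 1 by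
      ring, show 2 * a + 1 = a + a + 1 by ring, moment_add_add_one, moment_add_add_one,
      moment_add_add_one, mul_pow, mul_mul_mul_comm, ← sq]
    exact mul_le_mul_of_nonneg_left (dotProduct_sq_le _ _) (sq_nonneg _)

/-- In a log-convex sequence, a decrease at some place is preceded by decreases only. -/
theorem le_zero_of_logConvex {m : ℕ → ℝ} (hm : ∀ q, 0 ≤ m q)
    (hconv : ∀ q, m (q + 1) ^ 2 ≤ m q * m (q + 2)) :
    ∀ k, m (k + 1) ≤ m k → 0 < m k → m k ≤ m 0 := by
  intro k
  induction k with
  | zero => exact fun _ _ => le_rfl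
  | succ k ih =>
    intro h hpos
    have h1 : m (k + 1) * m (k + 1) ≤ m k * m (k + 1) := by
      nlinarith [hconv k, hm k]
    have h2 := le_of_mul_le_mul_right h1 hpos
    exact h2.trans (ih h2 (hpos.trans_le h2))

/-- Log-convexity makes the ratios of consecutive terms nondecreasing, so all of them stay at least
a. -/
theorem mul_pow_le_of_logConvex {m : ℕ → ℝ} {a : ℝ} (ha : 0 < a)
    (hconv : ∀ q, m (q + 1) ^ 2 ≤ m q * m (q + 2)) (h0 : 0 < m 0) (h1 : a * m 0 ≤ m 1) (q : ℕ) :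
    m 0 * a ^ q ≤ m q := by
  have key : ∀ q, 0 < m q ∧ a * m q ≤ m (q + 1) := by
    intro q
    induction q with
    | zero => exact ⟨h0, h1⟩
    | succ q ih =>
      have hpos : 0 < m (q + 1) := (mul_pos ha ih.1).trans_le ih.2
      refine ⟨hpos, le_of_mul_le_mul_left ?_ ih.1⟩
      calc m q * (a * m (q + 1)) = a * m q * m (q + 1) := by ring
        _ ≤ m (q + 1) * m (q + 1) := by gcongr; exact ih.2
        _ ≤ _ := by rw [← sq]; exact hconv q
  induction q with
  | zero => simp
  | succ q ih =>
    calc m 0 * a ^ (q + 1) = a * (m 0 * a ^ q) := by ring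
      _ ≤ a * m q := by gcongr
      _ ≤ _ := (key q).2

/-- A unit vector that grows under the power iteration yields a large Rayleigh quotient. -/
theorem le_mulVec_of_one_lt (Q : Matrix ι ι ℝ) {c : ℝ} (hc : 0 < c) {e : ι → ℝ} (he : e ⬝ᵥ e = 1)
    {k : ℕ} (h : 1 < (gram Q c ^ k *ᵥ e) ⬝ᵥ (gram Q c ^ k *ᵥ e)) :
    c * ((gram Q c ^ k *ᵥ e) ⬝ᵥ (gram Q c ^ k *ᵥ e)) ≤
      (Q *ᵥ (gram Q c ^ k *ᵥ e)) ⬝ᵥ (Q *ᵥ (gram Q c ^ k *ᵥ e)) := by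
  -- A quotient below c means that the moments decrease from 2k to 2k + 1. By log-convexity they
  -- then never exceed moment 0 = 1 before, contrary to the growth.
  by_contra! hlt
  rw [← moment_add] at h hlt
  have h1 : moment Q c e (k + k + 1) ≤ moment Q c e (k + k) := by
    rw [moment_add_add_one, inv_mul_le_iff₀ hc]
    exact hlt.le
  have := le_zero_of_logConvex (moment_nonneg Q hc e) (moment_sq_le Q c e) (k + k) h1 (by linarith)
  rw [moment_zero, he] at this
  linarith

/-- If no unit vector grows under the power iteration, then `Q` has small norm. -/
theorem mulVec_le_of_forall_le_one [Nonempty ι] (Q : Matrix ι ι ℝ) {c : ℝ} (hc : 0 < c)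
    (h : ∀ j, (gram Q c ^ (2 * Fintype.card ι) *ᵥ Pi.single j 1) ⬝ᵥ
      (gram Q c ^ (2 * Fintype.card ι) *ᵥ Pi.single j 1) ≤ 1) (x : ι → ℝ) :
    (Q *ᵥ x) ⬝ᵥ (Q *ᵥ x) ≤ 1.28 * c * (x ⬝ᵥ x) := by
  set n := Fintype.card ι with hn
  by_contra! hlt
  have hx0 : 0 < x ⬝ᵥ x := by
    refine (dotProduct_self_nonneg' x).lt_of_ne fun h0 => ?_
    rw [dotProduct_self_eq_zero.1 h0.symm] at hlt
    simp at hlt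
  have h1 : 1.28 * moment Q c x 0 ≤ moment Q c x 1 := by
    rw [moment_zero, moment_one, ← div_eq_inv_mul, le_div_iff₀ hc]
    linarith
  have h2 := mul_pow_le_of_logConvex (by norm_num) (moment_sq_le Q c x)
    (by rwa [moment_zero]) h1 (2 * n + 2 * n)
  rw [moment_zero, moment_add] at h2
  set T := gram Q c ^ (2 * n) with hT
  -- The hypothesis bounds the columns of T, hence its squared Frobenius norm by n.
  have h3 : (T *ᵥ x) ⬝ᵥ (T *ᵥ x) ≤ (x ⬝ᵥ x) * n := by
    have h4 : ∀ i, (T *ᵥ x) i * (T *ᵥ x) i ≤ (∑ j, T i j * T i j) * (x ⬝ᵥ x) := fun i => by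
      have := dotProduct_sq_le (T i) x
      rwa [sq] at this
    calc _ ≤ ∑ i, (∑ j, T i j * T i j) * (x ⬝ᵥ x) := Finset.sum_le_sum fun i _ => h4 i
      _ = (∑ j, ∑ i, T i j * T i j) * (x ⬝ᵥ x) := by rw [← Finset.sum_mul, Finset.sum_comm]
      _ ≤ (∑ _j : ι, 1) * (x ⬝ᵥ x) := by
          gcongr with j
          simpa [dotProduct] using h j
      _ = _ := by simp [hn, mul_comm]
  have h5 : (1.28 : ℝ) ^ (2 * n + 2 * n) ≤ n :=
    le_of_mul_le_mul_left (h2.trans h3) hx0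
  -- Bernoulli gives 1.28^(4n) ≥ 1 + 1.12 n > n, so 2n iterations suffice for the factor 1.28.
  have h6 := one_add_mul_le_pow (a := (0.28 : ℝ)) (by norm_num) (2 * n + 2 * n)
  have h7 : (0 : ℝ) < n := by exact_mod_cast Fintype.card_pos
  norm_num at h5 h6
  linarith

/-! ### Deflation -/

/-- The matrix `A` is the sum of `Q` and of `r` matrices of rank one, which are given by orthogonal
vectors in the kernel of `Q` and their images. -/
structure Deflation (A Q : Matrix ι ι ℝ) (c : ℝ) (r : ℕ) (V W : ℕ → ι → ℝ) : Prop where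
  orth : ∀ i < r, ∀ k < r, i ≠ k → V i ⬝ᵥ V k = 0
  pos : ∀ i < r, 0 < V i ⬝ᵥ V i
  ker : ∀ i < r, Q *ᵥ V i = 0
  image : ∀ i < r, W i = A *ᵥ V i
  large : ∀ i < r, c * (V i ⬝ᵥ V i) ≤ W i ⬝ᵥ W i
  decomp : A = Q + ∑ i ∈ Finset.range r, (V i ⬝ᵥ V i)⁻¹ • vecMulVec (W i) (V i)

omit [DecidableEq ι] in
theorem Deflation.zero (A : Matrix ι ι ℝ) (c : ℝ) (V W : ℕ → ι → ℝ) : Deflation A A c 0 V W where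
  orth := by simp
  pos := by simp
  ker := by simp
  image := by simp
  large := by simp
  decomp := by simp

/-- The new vector x lies in the range of the symmetric matrix gram Q c (hence the exponent k + 1),
so it is orthogonal to the kernel of Q, which contains the earlier vectors. Consequently Q x = A x,
and subtracting the rank one piece kills x while keeping the earlier vectors in the kernel. -/
theorem Deflation.succ {A Q : Matrix ι ι ℝ} {c : ℝ} (hc : 0 < c) {r : ℕ} {V W : ℕ → ι → ℝ}
    (h : Deflation A Q c r V W) {e : ι → ℝ} (he : e ⬝ᵥ e = 1) {k : ℕ} {x : ι → ℝ}
    (hx : x = gram Q c ^ (k + 1) *ᵥ e) (hx1 : 1 < x ⬝ᵥ x) {V' W' : ℕ → ι → ℝ}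
    (hV : ∀ i < r, V' i = V i) (hW : ∀ i < r, W' i = W i) (hVr : V' r = x) (hWr : W' r = Q *ᵥ x)
    {Q' : Matrix ι ι ℝ} (hQ' : Q' = Q - (x ⬝ᵥ x)⁻¹ • vecMulVec (Q *ᵥ x) x) :
    Deflation A Q' c (r + 1) V' W' := by
  have hxorth : ∀ i < r, x ⬝ᵥ V i = 0 := by
    intro i hi
    have : V i ⬝ᵥ (gram Q c *ᵥ (gram Q c ^ k *ᵥ e)) = 0 := by
      rw [dotProduct_gram, h.ker i hi]
      simp
    rwa [mulVec_mulVec, ← pow_succ', ← hx, dotProduct_comm] at this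
  have hdef : ∀ y, Q' *ᵥ y = Q *ᵥ y - ((x ⬝ᵥ x)⁻¹ * (x ⬝ᵥ y)) • (Q *ᵥ x) := by
    intro y
    rw [hQ', sub_mulVec, smul_mulVec, vecMulVec_mulVec, op_smul_eq_smul, smul_smul]
  have hQx : Q *ᵥ x = A *ᵥ x := by
    conv_rhs => rw [h.decomp]
    rw [add_mulVec, Matrix.sum_mulVec, Finset.sum_eq_zero, add_zero]
    intro i hi
    rw [smul_mulVec, vecMulVec_mulVec, dotProduct_comm (V i) x, hxorth i (Finset.mem_range.1 hi)]
    simp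
  refine ⟨fun i hi j hj hij => ?_, fun i hi => ?_, fun i hi => ?_, fun i hi => ?_, fun i hi => ?_,
    ?_⟩
  · rcases Nat.lt_succ_iff_lt_or_eq.1 hi with hi | rfl <;>
      rcases Nat.lt_succ_iff_lt_or_eq.1 hj with hj | rfl
    · rw [hV i hi, hV j hj, h.orth i hi j hj hij]
    · rw [hV i hi, hVr, dotProduct_comm, hxorth i hi]
    · rw [hV j hj, hVr, hxorth j hj]
    · exact absurd rfl hij
  · rcases Nat.lt_succ_iff_lt_or_eq.1 hi with hi | rfl
    · rw [hV i hi]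
      exact h.pos i hi
    · rw [hVr]
      linarith
  · rw [hdef]
    rcases Nat.lt_succ_iff_lt_or_eq.1 hi with hi | rfl
    · rw [hV i hi, h.ker i hi, hxorth i hi]
      simp
    · rw [hVr, inv_mul_cancel₀ (by linarith), one_smul, sub_self]
  · rcases Nat.lt_succ_iff_lt_or_eq.1 hi with hi | rfl
    · rw [hV i hi, hW i hi, h.image i hi]
    · rw [hVr, hWr, hQx]
  · rcases Nat.lt_succ_iff_lt_or_eq.1 hi with hi | rfl
    · rw [hV i hi, hW i hi]
      exact h.large i hi
    · rw [hVr, hWr, hx]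
      exact le_mulVec_of_one_lt Q hc he (hx ▸ hx1)
  · have : ∑ i ∈ Finset.range r, (V' i ⬝ᵥ V' i)⁻¹ • vecMulVec (W' i) (V' i) =
        ∑ i ∈ Finset.range r, (V i ⬝ᵥ V i)⁻¹ • vecMulVec (W i) (V i) :=
      Finset.sum_congr rfl fun i hi => by
        rw [hV i (Finset.mem_range.1 hi), hW i (Finset.mem_range.1 hi)]
    rw [Finset.sum_range_succ, this, hVr, hWr, hQ']
    conv_lhs => rw [h.decomp]
    abel

/-- The sum of the Rayleigh quotients of `A ^ 2` over orthogonal vectors is controlled by the large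
eigenvalues. -/
theorem sum_mulVec_le {A : Matrix ι ι ℝ} (hA : A.IsHermitian) (δ : ℝ) {r : ℕ} {V : ℕ → ι → ℝ}
    (hpos : ∀ i < r, 0 < V i ⬝ᵥ V i) (horth : ∀ i < r, ∀ k < r, i ≠ k → V i ⬝ᵥ V k = 0) :
    ∑ i ∈ Finset.range r, ((A *ᵥ V i) ⬝ᵥ (A *ᵥ V i)) / (V i ⬝ᵥ V i) ≤
      (open Classical in ∑ l with |hA.eigenvalues l| > δ, hA.eigenvalues l ^ 2) + r * δ ^ 2 := by
  classical
  set b := hA.eigenvectorBasis with hb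
  set v : Fin r → EuclideanSpace ℝ ι := fun i =>
    WithLp.toLp 2 ((√(V i ⬝ᵥ V i))⁻¹ • V i) with hv
  have hon : Orthonormal ℝ v := by
    rw [orthonormal_iff_ite]
    intro i k
    rw [hv, EuclideanSpace.inner_toLp_toLp]
    simp only [star_trivial, smul_dotProduct, dotProduct_smul, smul_eq_mul]
    split_ifs with h
    · subst h
      have := hpos i i.2
      rw [← mul_assoc, ← mul_inv, Real.mul_self_sqrt this.le, inv_mul_cancel₀ this.ne']
    · rw [horth k k.2 i i.2 fun h' => h (Fin.ext h'.symm)]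
      simp
  have hray : ∀ i : Fin r, ((A *ᵥ V i) ⬝ᵥ (A *ᵥ V i)) / (V i ⬝ᵥ V i) =
      ∑ l, hA.eigenvalues l ^ 2 * inner ℝ (v i) (b l) ^ 2 := by
    intro i
    have hg := hpos i i.2
    set u := V i
    have hnorm : (A *ᵥ u) ⬝ᵥ (A *ᵥ u) = ∑ l, (hA.eigenvalues l * (b l ⬝ᵥ u)) ^ 2 := by
      have h1 := b.sum_sq_norm_inner_right (WithLp.toLp 2 (A *ᵥ u))
      rw [← real_inner_self_eq_norm_sq, EuclideanSpace.inner_toLp_toLp, star_trivial] at h1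
      rw [← h1]
      refine Finset.sum_congr rfl fun l _ => ?_
      have h2 : inner ℝ (b l) (WithLp.toLp 2 (A *ᵥ u)) = (b l).ofLp ⬝ᵥ (A *ᵥ u) := by
        rw [dotProduct_comm]
        rfl
      rw [h2, Real.norm_eq_abs, sq_abs, dotProduct_mulVec, ← mulVec_transpose]
      have h3 : Aᵀ = A := by rw [← conjTranspose_eq_transpose_of_trivial]; exact hA
      rw [h3, hb, hA.mulVec_eigenvectorBasis, smul_dotProduct, smul_eq_mul]
    rw [hnorm, Finset.sum_div]
    refine Finset.sum_congr rfl fun l _ => ?_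
    have h4 : inner ℝ (v i) (b l) = (√(u ⬝ᵥ u))⁻¹ * (b l ⬝ᵥ u) := by
      rw [← smul_eq_mul, ← dotProduct_smul]
      rfl
    rw [h4, mul_pow, mul_pow, inv_pow, Real.sq_sqrt hg.le]
    field_simp
  rw [Finset.sum_range, Finset.sum_congr rfl fun i _ => hray i, Finset.sum_comm]
  -- Each eigenvector receives weight at most one, and all weights add up to r. Large eigenvalues
  -- are bounded through the first fact, small ones through the second.
  have hbessel : ∀ l, ∑ i, inner ℝ (v i) (b l) ^ 2 ≤ 1 := by
    intro l
    have := hon.sum_inner_products_le (x := b l) (s := Finset.univ)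
    simpa using this
  have hparseval : ∑ l, ∑ i, inner ℝ (v i) (b l) ^ 2 = r := by
    rw [Finset.sum_comm]
    have : ∀ i, ∑ l, inner ℝ (v i) (b l) ^ 2 = 1 := by
      intro i
      have := b.sum_sq_norm_inner_left (v i)
      simpa [hon.1 i] using this
    simp [this]
  rw [← hparseval, Finset.sum_mul, Finset.sum_filter, ← Finset.sum_add_distrib]
  refine Finset.sum_le_sum fun l _ => ?_
  rw [← Finset.mul_sum]
  have hnonneg : 0 ≤ ∑ i, inner ℝ (v i) (b l) ^ 2 := Finset.sum_nonneg fun _ _ => sq_nonneg _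
  split_ifs with hl
  · nlinarith [hbessel l, sq_nonneg (hA.eigenvalues l), mul_nonneg hnonneg (sq_nonneg δ)]
  · rw [zero_add, mul_comm]
    refine mul_le_mul_of_nonneg_left ?_ hnonneg
    rw [← sq_abs]
    exact pow_le_pow_left₀ (abs_nonneg _) (not_lt.1 hl) 2

end Ising

namespace Ising

open Real

/-! ### The objective function of the algorithm -/

section Objective

variable (n r K : ℕ) (e : ℝ) (V W : ℕ → ℕ → ℝ)

/-- The square of the norm of the first `n` coordinates. -/
def normSq (x : ℕ → ℝ) : ℝ := ∑ j ∈ Finset.range n, x j * x j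

/-- The sum of the Rayleigh quotients. -/
noncomputable def rayleigh : ℝ := ∑ i ∈ Finset.range r, normSq n (W i) / normSq n (V i)

/-- The vectors of the positive squares. -/
noncomputable def plus (i j : ℕ) : ℝ := V i j + W i j / (rayleigh n r V W / e)

/-- The vectors of the negative squares. -/
noncomputable def minus (i j : ℕ) : ℝ := V i j - W i j / (rayleigh n r V W / e)

/-- The weights of the squares. -/
noncomputable def weight (i : ℕ) : ℝ := rayleigh n r V W / e / (4 * normSq n (V i))

/-- The coordinate number `i` of the point number `a` of the grid for the vectors `X`. -/
noncomputable def netPoint (X : ℕ → ℕ → ℝ) (a i : ℕ) : ℝ :=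
  gridPoint (∑ j ∈ Finset.range n, |X i j|) K (a / K ^ i % K)

/-- The external field that belongs to a pair of grid points. -/
noncomputable def netField (a a' j : ℕ) : ℝ :=
  2 * ∑ i ∈ Finset.range r, weight n r e V W i *
    (plus n r e V W i j * netPoint n K (plus n r e V W) a i -
      minus n r e V W i j * netPoint n K (minus n r e V W) a' i)

/-- The approximate dual objective at a pair of grid points. -/
noncomputable def objective (a a' : ℕ) : ℝ :=
  ∑ j ∈ Finset.range n, logTwoCoshApprox (2 * (100 * n)) (netField n r K e V W a a' j) -
    ∑ i ∈ Finset.range r, weight n r e V W i *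
      (netPoint n K (plus n r e V W) a i ^ 2 - netPoint n K (minus n r e V W) a' i ^ 2)

end Objective

/-- Base K digits let one natural number below K ^ r encode a grid point with r coordinates. -/
theorem exists_digits {K r : ℕ} (g : Fin r → ℕ) (hg : ∀ i, g i < K) :
    ∃ a : Fin (K ^ r), (fun i : Fin r => (a : ℕ) / K ^ (i : ℕ) % K) = g := by
  refine ⟨finFunctionFinEquiv fun i => ⟨g i, hg i⟩, funext fun i => ?_⟩
  have := congrFun (finFunctionFinEquiv.symm_apply_apply fun i : Fin r => (⟨g i, hg i⟩ : Fin K)) i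
  simpa [finFunctionFinEquiv, Fin.ext_iff] using congrArg Fin.val this

theorem abs_log_sum_exp_sub_le {α : Type*} [Fintype α] [Nonempty α] {θ : ℝ} (a b : α → ℝ)
    (h : ∀ x, |a x - b x| ≤ θ) :
    |log (∑ x, exp (a x)) - log (∑ x, exp (b x))| ≤ θ := by
  have key : ∀ a b : α → ℝ, (∀ x, |a x - b x| ≤ θ) →
      log (∑ x, exp (a x)) - log (∑ x, exp (b x)) ≤ θ := by
    intro a b h
    have hpos : ∀ a : α → ℝ, 0 < ∑ x, exp (a x) := fun a =>
      Finset.sum_pos (fun _ _ => exp_pos _) Finset.univ_nonempty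
    rw [sub_le_iff_le_add, ← log_exp θ, ← log_mul (exp_pos _).ne' (hpos b).ne']
    refine log_le_log (hpos a) ?_
    rw [Finset.mul_sum]
    refine Finset.sum_le_sum fun x _ => ?_
    rw [← exp_add, exp_le_exp]
    linarith [(abs_le.1 (h x)).2]
  exact abs_sub_le_iff.2 ⟨key a b h, key b a fun x => by rw [abs_sub_comm]; exact h x⟩

/-- The growth of the exponential function at the rates that are needed. -/
theorem bounds_of_two_rpow_le {s ε : ℝ} {n : ℕ} (hs : 0 ≤ s) (hε : 0 < ε)
    (hn : (2 : ℝ) ^ (10000 * s) ≤ n) (hnε : 1 ≤ n * ε ^ 2) :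
    20 * (4 * s * (1 + 8000 * s ^ 2)) ≤ ε * n ∧ 60 * s ≤ n ∧ 8000 * s ^ 2 ≤ n ∧ 4 * s < n ∧
      1 ≤ ε * n := by
  -- Half of the exponent: exp u bounds √n from below, and also ε * n, since n ≤ (ε n)² by nε² ≥ 1.
  -- A cubic Taylor polynomial of exp u then dominates all polynomials in s that are needed.
  set u := 5000 * s * log 2 with hu
  have hu1 : 3000 * s ≤ u := by
    rw [hu]
    nlinarith [log_two_gt_d9]
  have hu0 : 0 ≤ u := by linarith
  have hn' : exp u ^ 2 ≤ n := by
    refine le_trans (le_of_eq ?_) hn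
    rw [rpow_def_of_pos two_pos, ← exp_nat_mul, hu]
    push_cast
    ring_nf
  have hexp : 1 + u + u ^ 2 / 2 + u ^ 3 / 6 ≤ exp u := by
    have := sum_le_exp_of_nonneg hu0 4
    simp [Finset.sum_range_succ, Nat.factorial] at this
    linarith
  have h2 : 9000000 * s ^ 2 ≤ u ^ 2 := by nlinarith
  have h3 : 27000000000 * s ^ 3 ≤ u ^ 3 := by
    have := pow_le_pow_left₀ (by linarith) hu1 3
    linarith [this, show (3000 * s) ^ 3 = 27000000000 * s ^ 3 by ring]
  have hs3 : 0 ≤ s ^ 3 := pow_nonneg hs 3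
  have hE : 1 + 3000 * s + 4500000 * s ^ 2 + 4500000000 * s ^ 3 ≤ exp u := by linarith
  have hE1 : 1 ≤ exp u := by nlinarith [sq_nonneg s]
  have hEn : exp u ≤ n := by nlinarith
  have hεn : exp u ≤ ε * n := by
    have hn0 : (0 : ℝ) ≤ n := n.cast_nonneg
    refine le_of_sq_le_sq ?_ (by positivity)
    nlinarith
  have hs2 := sq_nonneg s
  exact ⟨by nlinarith, by nlinarith, by nlinarith, by nlinarith, by linarith⟩

end Ising

/-! ### Error analysis of the minimax value -/

namespace Ising

open Real Matrix

variable {n : ℕ} (M : IsingModel n) {J' ε : ℝ}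

theorem thresholdRank_nonneg (δ : ℝ) : 0 ≤ M.thresholdRank J' δ :=
  Finset.sum_nonneg fun _ _ => sq_nonneg _

theorem mulVec_eq_smul_normalizedAdjacency (hJ' : J' ≠ 0) (v : Fin n → ℝ) :
    M.J *ᵥ v = J' • (M.normalizedAdjacency J' *ᵥ v) := by
  rw [← smul_mulVec]
  congr 1
  ext i j
  simp [IsingModel.normalizedAdjacency, mul_div_cancel₀ _ hJ']

theorem rayleigh_le (hJ' : 0 < J') (hε : 0 < ε) {r : ℕ} {V : ℕ → Fin n → ℝ}
    (hpos : ∀ i < r, 0 < V i ⬝ᵥ V i) (horth : ∀ i < r, ∀ k < r, i ≠ k → V i ⬝ᵥ V k = 0) :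
    (∑ i ∈ Finset.range r, ((M.J *ᵥ V i) ⬝ᵥ (M.J *ᵥ V i)) / (V i ⬝ᵥ V i)) / (ε * J') ^ 2 ≤
      M.thresholdRank J' (ε / 2) / ε ^ 2 + r / 4 := by
  have h := sum_mulVec_le (M.normalizedAdjacency_isHermitian J') (ε / 2) hpos horth
  have h1 : ∑ i ∈ Finset.range r, ((M.J *ᵥ V i) ⬝ᵥ (M.J *ᵥ V i)) / (V i ⬝ᵥ V i) =
      J' ^ 2 * ∑ i ∈ Finset.range r, ((M.normalizedAdjacency J' *ᵥ V i) ⬝ᵥ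
        (M.normalizedAdjacency J' *ᵥ V i)) / (V i ⬝ᵥ V i) := by
    rw [Finset.mul_sum]
    refine Finset.sum_congr rfl fun i _ => ?_
    rw [mulVec_eq_smul_normalizedAdjacency M hJ'.ne', smul_dotProduct, dotProduct_smul, smul_eq_mul,
      smul_eq_mul]
    ring
  rw [h1, div_le_iff₀ (by positivity)]
  calc _ ≤ J' ^ 2 * (M.thresholdRank J' (ε / 2) + r * (ε / 2) ^ 2) := by
        gcongr
        exact h
    _ = _ := by
        field_simp
        ring

/-- Cauchy–Schwarz in each row gives ∑ J_ij² ≥ J'². With the standard basis in `rayleigh_le` this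
means 1/ε² ≤ s + n/4. If nε² < 1, then n < 1/ε², so n is at most a multiple of s, and the
exponential lower bound on n yields 2^n ≤ n. -/
theorem one_le_card_mul_sq (hreg : M.IsRegular J') (hJ' : 1 ≤ J') (hε : 0 < ε) (hn : 0 < n)
    (h : (2 : ℝ) ^ (10000 * (M.thresholdRank J' (ε / 2) / ε ^ 2)) ≤ n) : 1 ≤ n * ε ^ 2 := by
  by_contra! hlt
  have hJ0 : (0 : ℝ) < J' := by linarith
  have hn0 : (0 : ℝ) < n := by exact_mod_cast hn
  set s := M.thresholdRank J' (ε / 2) / ε ^ 2 with hs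
  let V : ℕ → Fin n → ℝ := fun i => if hi : i < n then Pi.single ⟨i, hi⟩ 1 else 0
  have hV : ∀ i : Fin n, V i = Pi.single i 1 := fun i => by simp [V]
  have hVV : ∀ i : Fin n, V i ⬝ᵥ V i = 1 := fun i => by simp [hV]
  have h1 := rayleigh_le M hJ0 hε (r := n) (V := V) (fun i hi => by
      have := hVV ⟨i, hi⟩
      simp only at this
      rw [this]
      exact one_pos) (fun i hi k hk hik => by
      have e1 := hV ⟨i, hi⟩
      have e2 := hV ⟨k, hk⟩
      simp only at e1 e2
      rw [e1, e2]
      simp [hik])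
  have h2 : J' ^ 2 ≤ ∑ i ∈ Finset.range n, ((M.J *ᵥ V i) ⬝ᵥ (M.J *ᵥ V i)) / (V i ⬝ᵥ V i) := by
    rw [Finset.sum_range]
    have h3 : ∀ i : Fin n, ((M.J *ᵥ V i) ⬝ᵥ (M.J *ᵥ V i)) / (V i ⬝ᵥ V i) = ∑ j, |M.J i j| ^ 2 := by
      intro i
      rw [hVV, div_one, hV]
      simp only [dotProduct, mulVec_single_one, col_apply, sq_abs, ← sq]
      exact Finset.sum_congr rfl fun j _ => by rw [M.symm.apply]
    rw [Finset.sum_congr rfl fun i _ => h3 i]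
    have h4 : ∀ i : Fin n, J' ^ 2 / n ≤ ∑ j, |M.J i j| ^ 2 := by
      intro i
      have := sq_sum_le_card_mul_sum_sq (s := Finset.univ) (f := fun j => |M.J i j|)
      rw [hreg i] at this
      rw [div_le_iff₀ hn0]
      simpa [mul_comm] using this
    calc J' ^ 2 = ∑ _i : Fin n, J' ^ 2 / n := by
          simp
          field_simp
      _ ≤ _ := Finset.sum_le_sum fun i _ => h4 i
  have h5 : 1 / ε ^ 2 ≤ s + n / 4 := by
    refine le_trans ?_ h1
    rw [div_le_div_iff₀ (by positivity) (by positivity)]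
    nlinarith [sq_nonneg ε]
  have h6 : (n : ℝ) ≤ 1 / ε ^ 2 := by
    rw [le_div_iff₀ (by positivity)]
    exact hlt.le
  have h7 : (n : ℝ) ≤ 10000 * s := by nlinarith
  have h8 : (2 : ℝ) ^ (n : ℝ) ≤ n := (rpow_le_rpow_of_exponent_le (by norm_num) h7).trans h
  rw [rpow_natCast] at h8
  have h9 : (n : ℝ) < 2 ^ n := by exact_mod_cast n.lt_two_pow_self
  linarith

/-- The rank and the sum of the Rayleigh quotients of a deflation are controlled by the threshold
rank. -/
theorem Deflation.bounds (hJ' : 0 < J') (hε : 0 < ε) {Q : Matrix (Fin n) (Fin n) ℝ} {r : ℕ}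
    {V W : ℕ → Fin n → ℝ} (hd : Deflation M.J Q ((ε * J') ^ 2 / 2) r V W) :
    (r : ℝ) / 2 ≤ (∑ i ∈ Finset.range r, (W i ⬝ᵥ W i) / (V i ⬝ᵥ V i)) / (ε * J') ^ 2 ∧
      (∑ i ∈ Finset.range r, (W i ⬝ᵥ W i) / (V i ⬝ᵥ V i)) / (ε * J') ^ 2 ≤
        2 * (M.thresholdRank J' (ε / 2) / ε ^ 2) ∧
      (r : ℝ) ≤ 4 * (M.thresholdRank J' (ε / 2) / ε ^ 2) := by
  have h1 := rayleigh_le M hJ' hε hd.pos hd.orth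
  rw [Finset.sum_congr rfl fun i hi => by rw [← hd.image i (Finset.mem_range.1 hi)]] at h1
  -- Every quotient is at least (ε J')² / 2, whereas the threshold ε/2 contributes only r/4 to the
  -- upper bound; the gap between the two controls r.
  have h2 : (r : ℝ) / 2 ≤
      (∑ i ∈ Finset.range r, (W i ⬝ᵥ W i) / (V i ⬝ᵥ V i)) / (ε * J') ^ 2 := by
    rw [le_div_iff₀ (by positivity)]
    calc (r : ℝ) / 2 * (ε * J') ^ 2 = ∑ _i ∈ Finset.range r, (ε * J') ^ 2 / 2 := by
          simp
          ring
      _ ≤ _ := Finset.sum_le_sum fun i hi => by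
          have hi := Finset.mem_range.1 hi
          rw [le_div_iff₀ (hd.pos i hi)]
          exact hd.large i hi
  exact ⟨h2, by linarith, by linarith⟩

theorem l1Norm_eq (hreg : M.IsRegular J') : M.l1Norm = n * J' := by
  rw [IsingModel.l1Norm, Finset.sum_congr rfl fun i _ => hreg i]
  simp

theorem normSq_eq_dotProduct (n : ℕ) (x : ℕ → ℝ) :
    normSq n x = (fun j : Fin n => x j) ⬝ᵥ (fun j : Fin n => x j) :=
  Finset.sum_range _

section Squares

variable {n r : ℕ} {e : ℝ} {V W : ℕ → ℕ → ℝ}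

/-- The bound ρ ≥ 1/2 is only available if there is some vector, hence its quantification over Fin
r; for r = 0 the scale is zero and all sums over i are empty. -/
theorem weight_pos (he0 : 0 < e) (hg : ∀ i : Fin r, 0 < normSq n (V i))
    (hρ1 : ∀ _i : Fin r, 1 / 2 ≤ rayleigh n r V W / e ^ 2) (i : Fin r) :
    0 < weight n r e V W i := by
  have h := hρ1 i
  rw [le_div_iff₀ (by positivity)] at h
  have : 0 < rayleigh n r V W := lt_of_lt_of_le (by positivity) h
  exact div_pos (div_pos this he0) (mul_pos four_pos (hg i))

/-- Polarisation: (a + b/κ)² - (a - b/κ)² = 4ab/κ with a = V_i·x, b = W_i·x and κ = rayleigh / e. A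
common κ keeps the coefficients rational; the balanced scale |W_i|/|V_i| would require square roots.
-/
theorem form_add {A Q : Matrix (Fin n) (Fin n) ℝ}
    (hA : A = Q + ∑ i ∈ Finset.range r, ((fun j : Fin n => V i j) ⬝ᵥ (fun j : Fin n => V i j))⁻¹ •
      vecMulVec (fun j : Fin n => W i j) (fun j : Fin n => V i j))
    (he0 : 0 < e) (hg : ∀ i : Fin r, 0 < normSq n (V i))
    (hρ1 : ∀ _i : Fin r, 1 / 2 ≤ rayleigh n r V W / e ^ 2) (x : Fin n → ℝ) :
    ∑ i, ∑ j, A i j * x i * x j - form (fun (i : Fin r) (j : Fin n) => plus n r e V W i j)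
      (fun i j => minus n r e V W i j) (fun i => weight n r e V W i) x = x ⬝ᵥ (Q *ᵥ x) := by
  set tp := rayleigh n r V W with htp
  set ρ := tp / e ^ 2 with hρ
  set cc := tp / e with hcc
  have hccρ : cc = ρ * e := by
    rw [hcc, hρ]
    field_simp
  have hcc0 : ∀ _i : Fin r, 0 < cc := fun i => by
    rw [hccρ]
    have := hρ1 i
    positivity
  let P : Fin r → Fin n → ℝ := fun i j => plus n r e V W i j
  let R : Fin r → Fin n → ℝ := fun i j => minus n r e V W i j
  let w : Fin r → ℝ := fun i => weight n r e V W i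
  change ∑ i, ∑ j, A i j * x i * x j - form P R w x = x ⬝ᵥ (Q *ᵥ x)
  have h1 : ∑ i, ∑ j, A i j * x i * x j = x ⬝ᵥ (A *ᵥ x) := by
    simp only [dotProduct, mulVec, Finset.mul_sum]
    exact Finset.sum_congr rfl fun i _ => Finset.sum_congr rfl fun j _ => by ring
  have h2 : A *ᵥ x = Q *ᵥ x + ∑ i : Fin r, ((normSq n (V i))⁻¹ *
      ∑ j : Fin n, V i j * x j) • fun j : Fin n => W i j := by
    conv_lhs => rw [hA]
    rw [add_mulVec, Matrix.sum_mulVec, Finset.sum_range]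
    congr 1
    refine Finset.sum_congr rfl fun i _ => ?_
    rw [smul_mulVec, vecMulVec_mulVec, op_smul_eq_smul, smul_smul, normSq_eq_dotProduct]
    rfl
  rw [h1, h2, dotProduct_add, dotProduct_sum, form, add_sub_assoc, add_eq_left, sub_eq_zero]
  refine Finset.sum_congr rfl fun i _ => ?_
  have hp : ∑ j, P i j * x j = ∑ j : Fin n, V i j * x j + (∑ j : Fin n, x j * W i j) / cc := by
    rw [Finset.sum_div, ← Finset.sum_add_distrib]
    exact Finset.sum_congr rfl fun j _ => by
      simp only [P, plus, ← htp, ← hcc]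
      ring
  have hm : ∑ j, R i j * x j = ∑ j : Fin n, V i j * x j - (∑ j : Fin n, x j * W i j) / cc := by
    rw [Finset.sum_div, ← Finset.sum_sub_distrib]
    exact Finset.sum_congr rfl fun j _ => by
      simp only [R, minus, ← htp, ← hcc]
      ring
  have hcci := hcc0 i
  have hgi := hg i
  rw [hp, hm, dotProduct_smul]
  simp only [w, weight, ← htp, ← hcc, dotProduct, smul_eq_mul]
  field_simp
  ring

/-- With κ = ρe and Rayleigh quotient q_i, Cauchy–Schwarz bounds each term by nκ/2 + n q_i/(2κ). The
sum is n e (rρ/2 + 1/2), and r ≤ 2ρ together with ρ ≥ 1/2 gives the factor 3ρ². -/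
theorem weight_mul_sq_le (he0 : 0 < e) (hg : ∀ i : Fin r, 0 < normSq n (V i))
    (hρ1 : ∀ _i : Fin r, 1 / 2 ≤ rayleigh n r V W / e ^ 2)
    (hr : (r : ℝ) / 2 ≤ rayleigh n r V W / e ^ 2) (X : Fin r → Fin n → ℝ)
    (hX : ∀ i j, X i j ^ 2 ≤ 2 * (V i j * V i j) +
      2 / (rayleigh n r V W / e) ^ 2 * (W i j * W i j)) :
    ∑ i : Fin r, weight n r e V W i * (∑ j, |X i j|) ^ 2 ≤
      3 * n * (rayleigh n r V W / e ^ 2) ^ 2 * e := by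
  set tp := rayleigh n r V W with htp
  set ρ := tp / e ^ 2 with hρ
  set cc := tp / e with hcc
  have hccρ : cc = ρ * e := by
    rw [hcc, hρ]
    field_simp
  have hcc0 : ∀ _i : Fin r, 0 < cc := fun i => by
    rw [hccρ]
    have := hρ1 i
    positivity
  let w : Fin r → ℝ := fun i => weight n r e V W i
  have hw : ∀ i, 0 < w i := weight_pos he0 hg hρ1
  have hω : ∑ i : Fin r, normSq n (W i) / normSq n (V i) = ρ * e ^ 2 := by
    rw [hρ, div_mul_cancel₀ _ (by positivity), htp, rayleigh, Finset.sum_range]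
  have hρ0 : 0 ≤ ρ := le_trans (by positivity) hr
  change ∑ i, w i * _ ≤ _
  have h1 : ∀ i, w i * (∑ j, |X i j|) ^ 2 ≤
      n * cc / 2 + n / (2 * cc) * (normSq n (W i) / normSq n (V i)) := by
    intro i
    have h2 := sq_sum_le_card_mul_sum_sq (s := Finset.univ) (f := fun j => |X i j|)
    have h3 : ∑ j, |X i j| ^ 2 ≤ 2 * normSq n (V i) + 2 / cc ^ 2 * normSq n (W i) := by
      simp_rw [sq_abs]
      refine (Finset.sum_le_sum fun j _ => hX i j).trans (le_of_eq ?_)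
      rw [Finset.sum_add_distrib, ← Finset.mul_sum, ← Finset.mul_sum, normSq_eq_dotProduct,
        normSq_eq_dotProduct]
      rfl
    have hcci := hcc0 i
    have hgi := hg i
    calc _ ≤ w i * (n * (2 * normSq n (V i) + 2 / cc ^ 2 * normSq n (W i))) := by
          refine mul_le_mul_of_nonneg_left (h2.trans ?_) (hw i).le
          simp only [Finset.card_univ, Fintype.card_fin]
          gcongr
      _ = _ := by
          simp only [w, weight, ← htp, ← hcc]
          field_simp
          ring
  rcases isEmpty_or_nonempty (Fin r) with h0 | ⟨⟨i₀⟩⟩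
  · rw [Finset.sum_of_isEmpty]
    positivity
  refine (Finset.sum_le_sum fun i _ => h1 i).trans ?_
  rw [Finset.sum_add_distrib, ← Finset.mul_sum, hω]
  simp only [Finset.sum_const, Finset.card_univ, Fintype.card_fin, nsmul_eq_mul]
  have h4 := hρ1 i₀
  have h6 : n / (2 * (ρ * e)) * (ρ * e ^ 2) = n * e / 2 := by field_simp
  rw [hccρ, h6]
  have h7 : 0 ≤ n * e := by positivity
  have h8 : r * ρ / 2 + 1 / 2 ≤ 3 * ρ ^ 2 := by nlinarith
  calc _ = (n * e) * (r * ρ / 2 + 1 / 2) := by ring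
    _ ≤ (n * e) * (3 * ρ ^ 2) := by gcongr
    _ = _ := by ring

theorem plus_sq_le (i j : ℕ) : plus n r e V W i j ^ 2 ≤
    2 * (V i j * V i j) + 2 / (rayleigh n r V W / e) ^ 2 * (W i j * W i j) := by
  rw [plus]
  set cc := rayleigh n r V W / e
  have : 0 ≤ (V i j - W i j / cc) ^ 2 := sq_nonneg _
  calc _ ≤ (V i j + W i j / cc) ^ 2 + (V i j - W i j / cc) ^ 2 := by linarith
    _ = _ := by ring

theorem minus_sq_le (i j : ℕ) : minus n r e V W i j ^ 2 ≤
    2 * (V i j * V i j) + 2 / (rayleigh n r V W / e) ^ 2 * (W i j * W i j) := by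
  rw [minus]
  set cc := rayleigh n r V W / e
  have : 0 ≤ (V i j + W i j / cc) ^ 2 := sq_nonneg _
  calc _ ≤ (V i j + W i j / cc) ^ 2 + (V i j - W i j / cc) ^ 2 := by linarith
    _ = _ := by ring

/-- Only the n single spin terms are approximated, each with error 3 / (100 n). -/
theorem abs_objective_sub_dual_le (hn : 0 < n) (K a a' : ℕ) :
    |objective n r K e V W a a' -
      dual (fun (i : Fin r) (j : Fin n) => plus n r e V W i j) (fun i j => minus n r e V W i j)
        (fun i => weight n r e V W i)
      (fun i => gridPoint (∑ j : Fin n, |plus n r e V W i j|) K (a / K ^ (i : ℕ) % K))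
      (fun i => gridPoint (∑ j : Fin n, |minus n r e V W i j|) K (a' / K ^ (i : ℕ) % K))| ≤
      0.03 := by
  let P : Fin r → Fin n → ℝ := fun i j => plus n r e V W i j
  let R : Fin r → Fin n → ℝ := fun i j => minus n r e V W i j
  let w : Fin r → ℝ := fun i => weight n r e V W i
  change |objective n r K e V W a a' - dual P R w
    (fun i => gridPoint (∑ j, |P i j|) K (a / K ^ (i : ℕ) % K))
    (fun i => gridPoint (∑ j, |R i j|) K (a' / K ^ (i : ℕ) % K))| ≤ 0.03
  have hfield : ∀ j : Fin n, netField n r K e V W a a' j = field P R w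
      (fun i => gridPoint (∑ j, |P i j|) K (a / K ^ (i : ℕ) % K))
      (fun i => gridPoint (∑ j, |R i j|) K (a' / K ^ (i : ℕ) % K)) j := by
    intro j
    simp only [netField, field, netPoint, Finset.sum_range]
    rfl
  have hquad : ∑ i ∈ Finset.range r, weight n r e V W i *
      (netPoint n K (plus n r e V W) a i ^ 2 - netPoint n K (minus n r e V W) a' i ^ 2) =
      ∑ i, w i * (gridPoint (∑ j, |P i j|) K (a / K ^ (i : ℕ) % K) ^ 2 -
        gridPoint (∑ j, |R i j|) K (a' / K ^ (i : ℕ) % K) ^ 2) := by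
    simp only [netPoint, Finset.sum_range]
    rfl
  rw [objective, dual, hquad, sub_sub_sub_cancel_right, Finset.sum_range,
    ← Finset.sum_sub_distrib]
  refine (Finset.abs_sum_le_sum_abs _ _).trans ?_
  calc _ ≤ ∑ _j : Fin n, (3 / (100 * n : ℕ) : ℝ) := Finset.sum_le_sum fun j _ => by
        rw [hfield]
        exact abs_logTwoCoshApprox_sub_le _ (by omega)
    _ = _ := by
        have hn0 : (0 : ℝ) < n := by exact_mod_cast hn
        simp
        field_simp
        norm_num

/-- The diagonal entries of the rank r part are sums of V_ij W_ij / |V_i|². The inequality of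
arithmetic and geometric means with weight e bounds their absolute sum by re/2 + ρe/2, and r ≤ 2ρ.
-/
theorem sum_abs_diag_le (he0 : 0 < e) (hg : ∀ i : Fin r, 0 < normSq n (V i))
    (hρ1 : ∀ _i : Fin r, 1 / 2 ≤ rayleigh n r V W / e ^ 2)
    (hr : (r : ℝ) / 2 ≤ rayleigh n r V W / e ^ 2) :
    ∑ j : Fin n, |∑ i : Fin r, weight n r e V W i *
      (plus n r e V W i j ^ 2 - minus n r e V W i j ^ 2)| ≤
      3 / 2 * (rayleigh n r V W / e ^ 2) * e := by
  set tp := rayleigh n r V W with htp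
  set ρ := tp / e ^ 2 with hρ
  set cc := tp / e with hcc
  have hccρ : cc = ρ * e := by
    rw [hcc, hρ]
    field_simp
  have hcc0 : ∀ _i : Fin r, 0 < cc := fun i => by
    rw [hccρ]
    have := hρ1 i
    positivity
  let P : Fin r → Fin n → ℝ := fun i j => plus n r e V W i j
  let R : Fin r → Fin n → ℝ := fun i j => minus n r e V W i j
  let w : Fin r → ℝ := fun i => weight n r e V W i
  have hω : ∑ i : Fin r, normSq n (W i) / normSq n (V i) = ρ * e ^ 2 := by
    rw [hρ, div_mul_cancel₀ _ (by positivity), htp, rayleigh, Finset.sum_range]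
  change ∑ j, |∑ i, w i * (P i j ^ 2 - R i j ^ 2)| ≤ 3 / 2 * ρ * e
  have h1 : ∀ (i : Fin r) (j : Fin n), |w i * (P i j ^ 2 - R i j ^ 2)| ≤
      e / 2 * (V i j * V i j / normSq n (V i)) + (W i j * W i j / normSq n (V i)) / (2 * e) := by
    intro i j
    have hcci := hcc0 i
    have hgi := hg i
    have h2 : w i * (P i j ^ 2 - R i j ^ 2) = V i j * W i j / normSq n (V i) := by
      simp only [w, P, R, plus, minus, weight, ← htp, ← hcc]
      field_simp
      ring
    have h3 : e / 2 * (V i j * V i j / normSq n (V i)) +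
        (W i j * W i j / normSq n (V i)) / (2 * e) =
        ((e * |V i j|) ^ 2 + |W i j| ^ 2) / (2 * e) / normSq n (V i) := by
      rw [mul_pow, sq_abs, sq_abs]
      field_simp
    rw [h2, h3, abs_div, abs_of_pos hgi, abs_mul]
    gcongr
    rw [le_div_iff₀ (by positivity)]
    nlinarith [sq_nonneg (e * |V i j| - |W i j|)]
  calc _ ≤ ∑ j : Fin n, ∑ i : Fin r, (e / 2 * (V i j * V i j / normSq n (V i)) +
        (W i j * W i j / normSq n (V i)) / (2 * e)) := Finset.sum_le_sum fun j _ =>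
          (Finset.abs_sum_le_sum_abs _ _).trans (Finset.sum_le_sum fun i _ => h1 i j)
    _ = ∑ i : Fin r, (e / 2 + normSq n (W i) / normSq n (V i) / (2 * e)) := by
        rw [Finset.sum_comm]
        refine Finset.sum_congr rfl fun i _ => ?_
        rw [Finset.sum_add_distrib, ← Finset.mul_sum, ← Finset.sum_div, ← Finset.sum_div,
          ← Finset.sum_div]
        have h4 : ∀ x : ℕ → ℝ, ∑ j : Fin n, x j * x j = normSq n x := fun x =>
          (Finset.sum_range fun j => x j * x j).symm
        rw [h4, h4, div_self (hg i).ne', mul_one]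
    _ = r * (e / 2) + ρ * e / 2 := by
        rw [Finset.sum_add_distrib, ← Finset.sum_div, ← Finset.sum_div, hω]
        simp only [Finset.sum_const, Finset.card_univ, Fintype.card_fin, nsmul_eq_mul]
        field_simp
    _ ≤ _ := by nlinarith

end Squares

/-- The main estimate: the minimax value of the objective approximates `log Z`. -/
theorem abs_sub_log_partitionFunction_le (hreg : M.IsRegular J') (hJ' : 1 ≤ J') (hε : 0 < ε)
    (hn : 0 < n) (h : (2 : ℝ) ^ (10000 * (M.thresholdRank J' (ε / 2) / ε ^ 2)) ≤ n)
    {Q : Matrix (Fin n) (Fin n) ℝ} {r K : ℕ} {V W : ℕ → ℕ → ℝ}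
    (hd : Deflation M.J Q ((ε * J') ^ 2 / 2) r (fun i j => V i j) (fun i j => W i j))
    (hsmall : ∀ j, (gram Q ((ε * J') ^ 2 / 2) ^ (2 * n) *ᵥ Pi.single j 1) ⬝ᵥ
      (gram Q ((ε * J') ^ 2 / 2) ^ (2 * n) *ᵥ Pi.single j 1) ≤ 1)
    (hK : 1 ≤ K) (hK1 : 2000 * (rayleigh n r V W / (ε * J') ^ 2) ^ 2 ≤ K)
    (hK2 : (K : ℝ) ≤ 2 + 2000 * (rayleigh n r V W / (ε * J') ^ 2) ^ 2) {out : ℝ}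
    (hout : ∀ a < K ^ r, ∃ a' < K ^ r, objective n r K (ε * J') V W a a' ≤ out)
    (hout' : ∃ a < K ^ r, ∀ a' < K ^ r, out ≤ objective n r K (ε * J') V W a a') :
    |out - log M.partitionFunction| ≤ ε * M.l1Norm := by
  have hJ0 : (0 : ℝ) < J' := by linarith
  set e := ε * J' with he
  have he0 : 0 < e := by positivity
  have hn0 : (0 : ℝ) < n := by exact_mod_cast hn
  have : Nonempty (Fin n) := ⟨⟨0, hn⟩⟩
  set s := M.thresholdRank J' (ε / 2) / ε ^ 2 with hs
  have hs0 : 0 ≤ s := div_nonneg (thresholdRank_nonneg M _) (sq_nonneg _)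
  obtain ⟨b1, b2, b3, b4, b5⟩ :=
    bounds_of_two_rpow_le hs0 hε h (one_le_card_mul_sq M hreg hJ' hε hn h)
  have hεe : ε ≤ e := by nlinarith
  obtain ⟨r1, r2, r3⟩ := hd.bounds M hJ0 hε
  have hray : ∑ i ∈ Finset.range r, ((fun j : Fin n => W i j) ⬝ᵥ (fun j : Fin n => W i j)) /
      ((fun j : Fin n => V i j) ⬝ᵥ (fun j : Fin n => V i j)) = rayleigh n r V W := by
    simp_rw [rayleigh, normSq_eq_dotProduct]
  rw [hray] at r1 r2
  set tp := rayleigh n r V W with htp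
  set ρ := tp / e ^ 2 with hρ
  have hρ0 : 0 ≤ ρ := le_trans (by positivity) r1
  let P : Fin r → Fin n → ℝ := fun i j => plus n r e V W i j
  let R : Fin r → Fin n → ℝ := fun i j => minus n r e V W i j
  let w : Fin r → ℝ := fun i => weight n r e V W i
  have hg : ∀ i : Fin r, 0 < normSq n (V i) := fun i => by
    rw [normSq_eq_dotProduct]
    exact hd.pos i i.2
  have hρ1 : ∀ _i : Fin r, 1 / 2 ≤ ρ := fun i => by
    have : (1 : ℝ) ≤ r := by exact_mod_cast i.pos
    linarith
  have hw : ∀ i, 0 < w i := weight_pos he0 hg hρ1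
  -- The squared norm of Q is at most 1.28 * e² / 2 = (0.8 e)², and |x|² = n on the cube.
  have hS : ∀ x : Fin n → ℤˣ, |∑ i, ∑ j, M.J i j * spin (x i) * spin (x j) -
      form P R w fun j => spin (x j)| ≤ 0.8 * (e * n) := by
    intro x
    rw [form_add hd.decomp he0 hg hρ1 fun j => spin (x j)]
    set y : Fin n → ℝ := fun j => spin (x j) with hy
    have hyy : y ⬝ᵥ y = n := by simp [dotProduct, hy, spin_mul_self]
    have h1 := mulVec_le_of_forall_le_one Q (c := e ^ 2 / 2) (by positivity)
      (by simpa using hsmall) y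
    have h2 := dotProduct_sq_le y (Q *ᵥ y)
    rw [hyy] at h1 h2
    refine abs_le_of_sq_le_sq ?_ (by positivity)
    calc _ ≤ (n : ℝ) * ((Q *ᵥ y) ⬝ᵥ (Q *ᵥ y)) := h2
      _ ≤ n * (1.28 * (e ^ 2 / 2) * n) := by gcongr
      _ = _ := by ring
  have hZ := abs_log_sum_exp_sub_le _ _ hS
  have hmain := abs_sub_log_sum_exp_form_le (P := P) (R := R) (h := w) hK hw
    (fun (a : Fin (K ^ r)) (i : Fin r) => (a : ℕ) / K ^ (i : ℕ) % K)
    (fun g hg => exists_digits g hg) (b := 3 * n * ρ ^ 2 * e) (δ := 0.03) (D := 3 / 2 * ρ * e)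
    (out := out) (fun a a' => objective n r K e V W a a') 
    (weight_mul_sq_le he0 hg hρ1 r1 P fun i j => plus_sq_le i j)
    (weight_mul_sq_le he0 hg hρ1 r1 R fun i j => minus_sq_le i j)
    (fun a a' => abs_objective_sub_dual_le hn K a a') (sum_abs_diag_le he0 hg hρ1 r1)
    (fun a => by
      obtain ⟨a', ha', hle⟩ := hout a a.2
      exact ⟨⟨a', ha'⟩, hle⟩)
    (by
      obtain ⟨a, ha, hle⟩ := hout'
      exact ⟨⟨a, ha⟩, fun a' => hle a' a'.2⟩)
  have hK' : (1 : ℝ) ≤ K := by exact_mod_cast hK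
  have hlog : log (Fintype.card (Fin (K ^ r))) ≤ 0.05 * (e * n) := by
    rw [Fintype.card_fin, Nat.cast_pow, log_pow]
    have h1 : log K ≤ 1 + 8000 * s ^ 2 := by
      refine (log_le_sub_one_of_pos (by linarith)).trans ?_
      nlinarith
    calc r * log K ≤ 4 * s * (1 + 8000 * s ^ 2) := by
          gcongr
      _ ≤ 0.05 * (ε * n) := by linarith
      _ ≤ _ := by gcongr
  have hεen : ε * n ≤ e * n := by gcongr
  -- The grid size K ≥ 2000 ρ² yields 12 / 2000 = 0.006.
  have hgrid : 4 * (3 * n * ρ ^ 2 * e) / K ≤ 0.006 * (e * n) := by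
    rw [div_le_iff₀ (by linarith)]
    have : 0 < e * n := by positivity
    nlinarith
  have hD : 3 / 2 * ρ * e ≤ 0.05 * (e * n) := by nlinarith
  have hpart : M.partitionFunction =
      ∑ x : Fin n → ℤˣ, exp (∑ i, ∑ j, M.J i j * spin (x i) * spin (x j)) := rfl
  rw [hpart, l1Norm_eq M hreg]
  have e1 : ε * (n * J') = e * n := by rw [he]; ring
  rw [e1]
  have h1 := abs_le.1 hmain
  have h2 := abs_le.1 hZ
  -- Error budget in units of e * n: 0.8 for Q, 0.05 for the number of grid points, 0.006 for
  -- rounding, 0.05 for the diagonal, and 0.03 for `logTwoCoshApprox`, where e * n ≥ ε * n ≥ 1.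
  rw [abs_le]
  constructor <;> linarith

end Ising

/-! ### Expressions for the objective function -/

namespace RealRAM

open Function Ising

/-- The array number `k`. -/
def State.array (σ : State) (k i j : ℕ) : ℝ := σ.real (cell k i j)

@[simp]
theorem State.setNat_nat_of_ne (σ : State) {v i : ℕ} (h : i ≠ v) (k : ℕ) :
    (σ.setNat v k).nat i = σ.nat i := update_of_ne h _ _

@[simp]
theorem State.setNat_nat_self (σ : State) (v k : ℕ) : (σ.setNat v k).nat v = k := update_self _ _ _

@[simp]
theorem State.setNat_real (σ : State) (v k : ℕ) : (σ.setNat v k).real = σ.real := rfl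

@[simp]
theorem State.setNat_array (σ : State) (v k : ℕ) : (σ.setNat v k).array = σ.array := rfl

theorem NatExpr.Ev.var_of_eq {L N i m : ℕ} {σ : ℕ → ℕ} (hi : i < N) (h : σ i = m) :
    NatExpr.Ev L N σ (.var i) m := h ▸ .var hi

namespace RealExpr

variable {A : ℕ → ℕ → ℝ} {L : ℕ} {σ : State}

theorem Ev.of_eq {x : RealExpr} {a b : ℝ} (h : Ev A L σ x a) (hab : a = b) : Ev A L σ x b :=
  hab ▸ h

theorem Ev.natConst (k : ℕ) : Ev A L σ (.nat (.const k)) k := .nat (.const k)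

/-- The entry of the array number `k` at the positions given by the variables `v` and `w`. -/
def entry (k v w : ℕ) : RealExpr := .get (.cell k (.var v) (.var w))

theorem Ev.entry {k v w : ℕ} (hk : 0 < k) (hk8 : k < 8) (hv : v < 50) (hw : w < 50) (hL : 8 ≤ L)
    (h : σ.nat v + σ.nat w ≤ L) :
    Ev A L σ (.entry k v w) (σ.array k (σ.nat v) (σ.nat w)) :=
  -- The address is congruent to k modulo 8, hence different from the accumulator cell 8.
  .get (.cell (.var hv) (.var hw) h hL) fun h => by
    unfold cell at h
    omega

/-- The square of the norm of a row of an array. -/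
def normSq (k w : ℕ) : RealExpr :=
  .sum 12 (.var 0) (.mul (.entry k w 12) (.entry k w 12))

theorem Ev.normSq {k w : ℕ} (hk : 0 < k) (hk8 : k < 8) (hw : w < 50) (hw' : w ≠ 12) (hL : 8 ≤ L)
    (h : σ.nat w + σ.nat 0 ≤ L) :
    Ev A L σ (.normSq k w) (Ising.normSq (σ.nat 0) (σ.array k (σ.nat w))) := by
  refine Ev.sum (.var (by omega)) (by omega) fun j hj => ?_
  have := Ev.entry (A := A) (L := L) (σ := σ.setNat 12 j) (w := 12) hk hk8 hw (by omega) hL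
    (by simp [hw']; omega)
  simp only [State.setNat_array, State.setNat_nat_self, State.setNat_nat_of_ne _ hw'] at this
  exact this.mul this

/-- The sum of the Rayleigh quotients. -/
def rayleigh : RealExpr := .sum 13 (.var 1) (.div (.normSq 3 13) (.normSq 2 13))

theorem Ev.rayleigh (hL : 8 ≤ L) (h : σ.nat 1 + σ.nat 0 ≤ L) :
    Ev A L σ .rayleigh (Ising.rayleigh (σ.nat 0) (σ.nat 1) (σ.array 2) (σ.array 3)) := by
  refine Ev.sum (.var (by omega)) (by omega) fun i hi => ?_
  have key : ∀ k, 0 < k → k < 8 → Ev A L (σ.setNat 13 i) (.normSq k 13)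
      (Ising.normSq (σ.nat 0) (σ.array k i)) := by
    intro k hk hk8
    simpa using Ev.normSq (A := A) (L := L) (σ := σ.setNat 13 i) (w := 13) hk hk8 (by omega)
      (by omega) hL (by simp; omega)
  exact (key 3 (by omega) (by omega)).div (key 2 (by omega) (by omega))

/-- The vectors of the positive squares. -/
def plus (v w : ℕ) : RealExpr :=
  .add (.entry 2 v w) (.div (.entry 3 v w) (.div .rayleigh (.get (.const 16))))

/-- The vectors of the negative squares. -/
def minus (v w : ℕ) : RealExpr :=
  .sub (.entry 2 v w) (.div (.entry 3 v w) (.div .rayleigh (.get (.const 16))))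

/-- The weights of the squares. -/
def weight (v : ℕ) : RealExpr :=
  .div (.div .rayleigh (.get (.const 16))) (.mul (.nat (.const 4)) (.normSq 2 v))

/-- The vectors of the positive squares in a state. -/
noncomputable def _root_.RealRAM.State.plus (σ : State) : ℕ → ℕ → ℝ :=
  Ising.plus (σ.nat 0) (σ.nat 1) (σ.real 16) (σ.array 2) (σ.array 3)

/-- The vectors of the negative squares in a state. -/
noncomputable def _root_.RealRAM.State.minus (σ : State) : ℕ → ℕ → ℝ :=
  Ising.minus (σ.nat 0) (σ.nat 1) (σ.real 16) (σ.array 2) (σ.array 3)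

/-- The weights of the squares in a state. -/
noncomputable def _root_.RealRAM.State.weight (σ : State) : ℕ → ℝ :=
  Ising.weight (σ.nat 0) (σ.nat 1) (σ.real 16) (σ.array 2) (σ.array 3)

theorem _root_.RealRAM.State.setNat_plus (σ : State) {v : ℕ} (hv : 1 < v) (k : ℕ) :
    (σ.setNat v k).plus = σ.plus := by
  rw [State.plus, σ.setNat_nat_of_ne (by omega), σ.setNat_nat_of_ne (by omega)]
  rfl

theorem _root_.RealRAM.State.setNat_minus (σ : State) {v : ℕ} (hv : 1 < v) (k : ℕ) :
    (σ.setNat v k).minus = σ.minus := by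
  rw [State.minus, σ.setNat_nat_of_ne (by omega), σ.setNat_nat_of_ne (by omega)]
  rfl

theorem _root_.RealRAM.State.setNat_weight (σ : State) {v : ℕ} (hv : 1 < v) (k : ℕ) :
    (σ.setNat v k).weight = σ.weight := by
  rw [State.weight, σ.setNat_nat_of_ne (by omega), σ.setNat_nat_of_ne (by omega)]
  rfl

theorem Ev.scale (hL : 8 ≤ L) (h : σ.nat 1 + σ.nat 0 ≤ L) :
    Ev A L σ (.div .rayleigh (.get (.const 16)))
      (Ising.rayleigh (σ.nat 0) (σ.nat 1) (σ.array 2) (σ.array 3) / σ.real 16) :=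
  (Ev.rayleigh hL h).div (.get (.const 16) (by omega))

theorem Ev.plus {v w : ℕ} (hv : v < 50) (hw : w < 50) (hL : 8 ≤ L) (h : σ.nat 1 + σ.nat 0 ≤ L)
    (h' : σ.nat v + σ.nat w ≤ L) :
    Ev A L σ (.plus v w) (σ.plus (σ.nat v) (σ.nat w)) :=
  (Ev.entry (by omega) (by omega) hv hw hL h').add
    ((Ev.entry (by omega) (by omega) hv hw hL h').div (.scale hL h))

theorem Ev.minus {v w : ℕ} (hv : v < 50) (hw : w < 50) (hL : 8 ≤ L) (h : σ.nat 1 + σ.nat 0 ≤ L)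
    (h' : σ.nat v + σ.nat w ≤ L) :
    Ev A L σ (.minus v w) (σ.minus (σ.nat v) (σ.nat w)) :=
  (Ev.entry (by omega) (by omega) hv hw hL h').sub
    ((Ev.entry (by omega) (by omega) hv hw hL h').div (.scale hL h))

theorem Ev.weight {v : ℕ} (hv : v < 50) (hv' : v ≠ 12) (hL : 8 ≤ L) (h : σ.nat 1 + σ.nat 0 ≤ L)
    (h' : σ.nat v + σ.nat 0 ≤ L) : Ev A L σ (.weight v) (σ.weight (σ.nat v)) :=
  (Ev.scale hL h).div ((Ev.natConst 4).mul (.normSq (by omega) (by omega) hv hv' hL h'))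

/-- The coordinate number `w` of the point number `u` of the grid for the vectors `x`; the
expression `x` uses variable `14` for the coordinates of the vectors. -/
def netPoint (x : RealExpr) (u w : ℕ) : RealExpr :=
  .div (.mul (.sum 14 (.var 0) (.abs x))
    (.sub (.add (.mul (.nat (.const 2))
      (.nat (.mod 50 (.div 50 (.var u) (.pow 50 (.var 2) (.var w))) (.var 2))))
      (.nat (.const 1))) (.nat (.var 2)))) (.nat (.var 2))

theorem Ev.netPoint {x : RealExpr} {X : ℕ → ℕ → ℝ} {u w : ℕ} (hu : u < 50) (hw : w < 50)
    (hn : σ.nat 0 ≤ L) (hK : 0 < σ.nat 2) (hKL : σ.nat 2 ≤ L) (hwL : σ.nat w ≤ L)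
    (hKw : σ.nat 2 ^ σ.nat w ≤ L) (huL : σ.nat u ≤ L)
    (hx : ∀ j < σ.nat 0, Ev A L (σ.setNat 14 j) x (X (σ.nat w) j)) :
    Ev A L σ (.netPoint x u w)
      (Ising.netPoint (σ.nat 0) (σ.nat 2) X (σ.nat u) (σ.nat w)) := by
  have hpow := (NatExpr.Ev.var (L := L) (σ := σ.nat) (show 2 < 50 by omega)).pow (.var hw) hKL hwL
  have hmod := ((NatExpr.Ev.var hu).div hpow huL hKw (by positivity)).mod
    (.var (show 2 < 50 by omega)) ((Nat.div_le_self _ _).trans huL) hKL hK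
  have h := ((Ev.sum (.var (by omega)) hn fun j hj => (hx j hj).abs).mul
    ((((Ev.natConst 2).mul (.nat hmod)).add (.natConst 1)).sub
      (.nat (.var (i := 2) (by omega))))).div (.nat (.var (i := 2) (by omega)))
  exact h.of_eq (by simp [Ising.netPoint, gridPoint])

/-- The external field at the coordinate in variable `18`. -/
def netField : RealExpr :=
  .mul (.nat (.const 2)) (.sum 15 (.var 1) (.mul (.weight 15)
    (.sub (.mul (.plus 15 18) (.netPoint (.plus 15 14) 6 15))
      (.mul (.minus 15 18) (.netPoint (.minus 15 14) 7 15)))))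

/-- The bounds that are used for the evaluation of the objective function. -/
structure _root_.RealRAM.State.Bounded (L : ℕ) (σ : State) : Prop where
  eight_le : 8 ≤ L
  add_le : σ.nat 1 + 400 * σ.nat 0 ≤ L
  pos : 0 < σ.nat 2
  le : σ.nat 2 ≤ L
  pow_le : σ.nat 2 ^ σ.nat 1 ≤ L

theorem _root_.RealRAM.State.Bounded.setNat (h : σ.Bounded L) {v : ℕ} (hv : 2 < v) (k : ℕ) :
    (σ.setNat v k).Bounded L := by
  obtain ⟨h1, h2, h3, h4, h5⟩ := h
  constructor <;> first
    | assumption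
    | (simpa [State.setNat_nat_of_ne _ (show 0 ≠ v by omega),
        State.setNat_nat_of_ne _ (show 1 ≠ v by omega),
        State.setNat_nat_of_ne _ (show 2 ≠ v by omega)])

theorem Ev.netPoint_plus (h : σ.Bounded L) {u w : ℕ} (hu : u < 50) (hw : w < 50) (hw' : w ≠ 14)
    (hwr : σ.nat w < σ.nat 1) (huL : σ.nat u ≤ L) : Ev A L σ (.netPoint (.plus w 14) u w)
      (Ising.netPoint (σ.nat 0) (σ.nat 2) σ.plus (σ.nat u) (σ.nat w)) := by
  obtain ⟨h1, h2, h3, h4, h5⟩ := h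
  refine .netPoint hu hw (by omega) h3 h4 (by omega)
    ((Nat.pow_le_pow_right h3 hwr.le).trans h5) huL fun j hj => ?_
  have := Ev.plus (A := A) (σ := σ.setNat 14 j) hw (show 14 < 50 by omega) h1 (by simp; omega)
    (by simp [hw']; omega)
  simpa [State.setNat_plus, hw'] using this

theorem Ev.netPoint_minus (h : σ.Bounded L) {u w : ℕ} (hu : u < 50) (hw : w < 50) (hw' : w ≠ 14)
    (hwr : σ.nat w < σ.nat 1) (huL : σ.nat u ≤ L) : Ev A L σ (.netPoint (.minus w 14) u w)
      (Ising.netPoint (σ.nat 0) (σ.nat 2) σ.minus (σ.nat u) (σ.nat w)) := by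
  obtain ⟨h1, h2, h3, h4, h5⟩ := h
  refine .netPoint hu hw (by omega) h3 h4 (by omega)
    ((Nat.pow_le_pow_right h3 hwr.le).trans h5) huL fun j hj => ?_
  have := Ev.minus (A := A) (σ := σ.setNat 14 j) hw (show 14 < 50 by omega) h1 (by simp; omega)
    (by simp [hw']; omega)
  simpa [State.setNat_minus, hw'] using this

theorem Ev.netField (h : σ.Bounded L) (h6 : σ.nat 6 ≤ L) (h7 : σ.nat 7 ≤ L)
    (h18 : σ.nat 18 < σ.nat 0) : Ev A L σ .netField
      (Ising.netField (σ.nat 0) (σ.nat 1) (σ.nat 2) (σ.real 16) (σ.array 2) (σ.array 3)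
        (σ.nat 6) (σ.nat 7) (σ.nat 18)) := by
  have hL := h.add_le
  refine ((Ev.natConst 2).mul (Ev.sum (f := fun i => σ.weight i *
    (σ.plus i (σ.nat 18) * Ising.netPoint (σ.nat 0) (σ.nat 2) σ.plus (σ.nat 6) i -
      σ.minus i (σ.nat 18) * Ising.netPoint (σ.nat 0) (σ.nat 2) σ.minus (σ.nat 7) i))
    (.var (by omega)) (by omega) fun i hi => ?_)).of_eq (by rw [Nat.cast_ofNat]; rfl)
  have hB := h.setNat (show 2 < 15 by omega) i
  have e1 := Ev.weight (A := A) (σ := σ.setNat 15 i) (v := 15) (by omega) (by omega) h.eight_le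
    (by simp; omega) (by simp; omega)
  have e2 := Ev.plus (A := A) (σ := σ.setNat 15 i) (v := 15) (w := 18) (by omega) (by omega)
    h.eight_le (by simp; omega) (by simp; omega)
  have e3 := Ev.minus (A := A) (σ := σ.setNat 15 i) (v := 15) (w := 18) (by omega) (by omega)
    h.eight_le (by simp; omega) (by simp; omega)
  have e4 := Ev.netPoint_plus (A := A) (u := 6) (w := 15) hB (by omega) (by omega) (by omega)
    (by simpa) (by simpa)
  have e5 := Ev.netPoint_minus (A := A) (u := 7) (w := 15) hB (by omega) (by omega) (by omega)
    (by simpa) (by simpa)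
  simp only [State.setNat_plus _ (show 1 < 15 by omega),
    State.setNat_minus _ (show 1 < 15 by omega),
    State.setNat_weight _ (show 1 < 15 by omega), State.setNat_nat_self,
    State.setNat_nat_of_ne _ (show 18 ≠ 15 by omega),
    State.setNat_nat_of_ne _ (show 0 ≠ 15 by omega),
    State.setNat_nat_of_ne _ (show 2 ≠ 15 by omega),
    State.setNat_nat_of_ne _ (show 6 ≠ 15 by omega),
    State.setNat_nat_of_ne _ (show 7 ≠ 15 by omega)] at e1 e2 e3 e4 e5
  exact e1.mul ((e2.mul e4).sub (e3.mul e5))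

/-- The approximation of `log (2 * cosh y)` with `b` terms. -/
def logTwoCosh (b : NatExpr) (y : RealExpr) : RealExpr :=
  let q : RealExpr := .prod 17 b (.div (.nat (.const 1)) (.add (.nat (.const 1))
    (.div (.mul (.nat (.const 2)) (.abs y)) (.nat b))))
  .add (.abs y) (.sum 16 b (.div q (.add (.nat b) (.mul (.nat (.var 16)) q))))

/-- Both b and y are evaluated again inside the two loops, so their values must not depend on the
loop variables 16 and 17. -/
theorem Ev.logTwoCosh {b : NatExpr} {y : RealExpr} {m : ℕ} {v : ℝ} (hm : m ≤ L)
    (hb : ∀ τ : State, (∀ i, i ≠ 16 → i ≠ 17 → τ.nat i = σ.nat i) → b.Ev L 50 τ.nat m)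
    (hy : ∀ τ : State, (∀ i, i ≠ 16 → i ≠ 17 → τ.nat i = σ.nat i) → τ.real = σ.real →
      Ev A L τ y v) : Ev A L σ (.logTwoCosh b y) (logTwoCoshApprox m v) := by
  refine (hy σ (fun _ _ _ => rfl) rfl).abs.add (Ev.sum (hb σ fun _ _ _ => rfl) hm fun k _ => ?_)
  have h16 : ∀ i, i ≠ 16 → i ≠ 17 → (σ.setNat 16 k).nat i = σ.nat i := fun i h _ => by simp [h]
  have hq : Ev A L (σ.setNat 16 k) (.prod 17 b (.div (.nat (.const 1)) (.add (.nat (.const 1))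
      (.div (.mul (.nat (.const 2)) (.abs y)) (.nat b)))))
      (∏ _l ∈ Finset.range m, 1 / (1 + 2 * |v| / m)) := by
    refine Ev.prod (hb _ h16) hm fun l _ => ?_
    have h17 : ∀ i, i ≠ 16 → i ≠ 17 → ((σ.setNat 16 k).setNat 17 l).nat i = σ.nat i :=
      fun i h h' => by simp [h, h']
    exact ((Ev.natConst 1).div ((Ev.natConst 1).add (((Ev.natConst 2).mul (hy _ h17 rfl).abs).div
      (.nat (hb _ h17))))).of_eq (by simp)
  exact hq.div ((Ev.nat (hb _ h16)).add
    ((Ev.nat (.var_of_eq (m := k) (by omega) (by simp))).mul hq))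

/-- The approximate dual objective at the pair of grid points with the numbers in the variables `6`
and `7`. -/
def objective : RealExpr :=
  .sub (.sum 18 (.var 0)
      (.logTwoCosh (.mul 50 (.const 2) (.mul 50 (.const 100) (.var 0))) .netField))
    (.sum 19 (.var 1) (.mul (.weight 19)
      (.sub (.mul (.netPoint (.plus 19 14) 6 19) (.netPoint (.plus 19 14) 6 19))
        (.mul (.netPoint (.minus 19 14) 7 19) (.netPoint (.minus 19 14) 7 19)))))

theorem Ev.objective (h : σ.Bounded L) (h6 : σ.nat 6 ≤ L) (h7 : σ.nat 7 ≤ L) :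
    Ev A L σ .objective
      (Ising.objective (σ.nat 0) (σ.nat 1) (σ.nat 2) (σ.real 16) (σ.array 2) (σ.array 3)
        (σ.nat 6) (σ.nat 7)) := by
  have hL := h.add_le
  refine (Ev.sum (.var (by omega)) (by omega) fun j hj => ?_).sub
    ((Ev.sum (f := fun i => σ.weight i *
      (Ising.netPoint (σ.nat 0) (σ.nat 2) σ.plus (σ.nat 6) i ^ 2 -
        Ising.netPoint (σ.nat 0) (σ.nat 2) σ.minus (σ.nat 7) i ^ 2))
      (.var (by omega)) (by omega) fun i hi => ?_))
  · refine .logTwoCosh (by omega) (fun τ hτ => ?_) fun τ hτ hτ' => ?_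
    · refine (NatExpr.Ev.const 2).mul ((NatExpr.Ev.const 100).mul
        (.var_of_eq (by omega) ?_) (by omega)) (by omega)
      rw [hτ 0 (by omega) (by omega)]
      simp
    · have g0 : τ.nat 0 = σ.nat 0 := (hτ 0 (by omega) (by omega)).trans (by simp)
      have g1 : τ.nat 1 = σ.nat 1 := (hτ 1 (by omega) (by omega)).trans (by simp)
      have g2 : τ.nat 2 = σ.nat 2 := (hτ 2 (by omega) (by omega)).trans (by simp)
      have g6 : τ.nat 6 = σ.nat 6 := (hτ 6 (by omega) (by omega)).trans (by simp)
      have g7 : τ.nat 7 = σ.nat 7 := (hτ 7 (by omega) (by omega)).trans (by simp)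
      have g18 : τ.nat 18 = j := (hτ 18 (by omega) (by omega)).trans (by simp)
      have hB : τ.Bounded L := by
        obtain ⟨h1, h2, h3, h4, h5⟩ := h
        constructor <;> (try simp only [g0, g1, g2]) <;> assumption
      have hreal : τ.real = σ.real := hτ'
      have harr : τ.array = σ.array := by
        funext k i j
        exact congrFun hreal _
      have := Ev.netField (A := A) hB (by omega) (by omega) (by omega)
      rwa [g0, g1, g2, g6, g7, g18, hreal, harr] at this
  · have hB := h.setNat (show 2 < 19 by omega) i
    have e1 := Ev.weight (A := A) (σ := σ.setNat 19 i) (v := 19) (by omega) (by omega) h.eight_le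
      (by simp; omega) (by simp; omega)
    have e4 := Ev.netPoint_plus (A := A) (u := 6) (w := 19) hB (by omega) (by omega) (by omega)
      (by simpa) (by simpa)
    have e5 := Ev.netPoint_minus (A := A) (u := 7) (w := 19) hB (by omega) (by omega) (by omega)
      (by simpa) (by simpa)
    simp only [State.setNat_plus _ (show 1 < 19 by omega),
      State.setNat_minus _ (show 1 < 19 by omega), State.setNat_weight _ (show 1 < 19 by omega),
      State.setNat_nat_self, State.setNat_nat_of_ne _ (show 0 ≠ 19 by omega),
      State.setNat_nat_of_ne _ (show 2 ≠ 19 by omega),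
      State.setNat_nat_of_ne _ (show 6 ≠ 19 by omega),
      State.setNat_nat_of_ne _ (show 7 ≠ 19 by omega)] at e1 e4 e5
    exact (e1.mul ((e4.mul e4).sub (e5.mul e5))).of_eq (by rw [sq, sq])

/-- The value of the game on the grid. -/
def value : RealExpr :=
  .max 6 (.pow 50 (.var 2) (.var 1)) (.min 7 (.pow 50 (.var 2) (.var 1)) .objective)

/-- The max-min is characterised by the two inequalities that `abs_sub_log_partitionFunction_le`
consumes. -/
theorem Ev.value (h : σ.Bounded L) : ∃ v, Ev A L σ .value v ∧
    (∀ a < σ.nat 2 ^ σ.nat 1, ∃ a' < σ.nat 2 ^ σ.nat 1,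
      Ising.objective (σ.nat 0) (σ.nat 1) (σ.nat 2) (σ.real 16) (σ.array 2) (σ.array 3) a a' ≤ v) ∧
    ∃ a < σ.nat 2 ^ σ.nat 1, ∀ a' < σ.nat 2 ^ σ.nat 1,
      v ≤ Ising.objective (σ.nat 0) (σ.nat 1) (σ.nat 2) (σ.real 16) (σ.array 2) (σ.array 3)
        a a' := by
  set obj := Ising.objective (σ.nat 0) (σ.nat 1) (σ.nat 2) (σ.real 16) (σ.array 2) (σ.array 3)
    with hobj
  have hL := h.add_le
  have hb : ∀ a, (NatExpr.pow 50 (.var 2) (.var 1)).Ev L 50 (σ.setNat 6 a).nat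
      (σ.nat 2 ^ σ.nat 1) := fun a =>
    (NatExpr.Ev.var_of_eq (by omega) (by simp)).pow (.var_of_eq (by omega) (by simp)) h.le
      (by omega)
  have hmin : ∀ a < σ.nat 2 ^ σ.nat 1, ∃ m, Ev A L (σ.setNat 6 a)
      (.min 7 (.pow 50 (.var 2) (.var 1)) .objective) m ∧
      (∀ a' < σ.nat 2 ^ σ.nat 1, m ≤ obj a a') ∧ ∃ a' < σ.nat 2 ^ σ.nat 1, obj a a' = m := by
    intro a ha
    refine Ev.min (hb a) h.pow_le (Nat.pow_pos h.pos) fun a' ha' => ?_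
    have := Ev.objective (A := A) ((h.setNat (show 2 < 6 by omega) a).setNat
      (show 2 < 7 by omega) a') (by simpa using (ha.trans_le h.pow_le).le)
      (by simpa using (ha'.trans_le h.pow_le).le)
    simpa using this
  choose! f hf hf1 hf2 using hmin
  obtain ⟨v, hv, hv1, a, ha, hv2⟩ := Ev.max (A := A) (f := f)
    ((NatExpr.Ev.var (by omega)).pow (.var (by omega)) h.le (by omega))
    h.pow_le (Nat.pow_pos h.pos) hf
  refine ⟨v, hv, fun b hb => ?_, a, ha, hv2 ▸ hf1 a ha⟩
  obtain ⟨a', ha', h'⟩ := hf2 b hb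
  exact ⟨a', ha', h'.trans_le (hv1 b hb)⟩

end RealExpr

end RealRAM

/-! ### Statements that fill arrays -/

namespace RealRAM

open Function Ising Matrix

theorem State.setReal_array (σ : State) {k k' : ℕ} (hk : k < 8) (hk' : k' < 8) (i j i' j' : ℕ)
    (v : ℝ) : (σ.setReal (cell k i j) v).array k' i' j' =
      if k' = k ∧ i' = i ∧ j' = j then v else σ.array k' i' j' := by
  simp only [State.array, State.setReal, update_apply, cell_inj hk' hk]

theorem State.setReal_real (σ : State) {k : ℕ} (hk : 0 < k) (hk8 : k < 8) (i j : ℕ) (v : ℝ) :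
    (σ.setReal (cell k i j) v).real 16 = σ.real 16 :=
  update_of_ne (by unfold cell; omega) _ _

namespace Stmt

variable {A : ℕ → ℕ → ℝ} {L : ℕ} {σ : State}

/-- The states agree up to variable `10` and the row `r` of the array number `k`. -/
structure RowEq (k r : ℕ) (σ τ : State) : Prop where
  nat : ∀ i, i ≠ 10 → τ.nat i = σ.nat i
  array : ∀ k' < 8, ∀ i j, k' ≠ k ∨ i ≠ r → τ.array k' i j = σ.array k' i j
  real : τ.real 16 = σ.real 16

theorem RowEq.refl (k r : ℕ) (σ : State) : RowEq k r σ σ :=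
  ⟨fun _ _ => rfl, fun _ _ _ _ _ => rfl, rfl⟩

/-- Write the values of `x` into the row of the array number `k` given by variable `1`. -/
def row (k : ℕ) (x : RealExpr) : Stmt :=
  .loop 10 (.var 0) (.set (.cell k (.var 1) (.var 10)) x)

theorem Tr.row {k : ℕ} {x : RealExpr} {f : ℕ → ℝ} (hk : 0 < k) (hk8 : k < 8) (hL : 8 ≤ L)
    (h : σ.nat 1 + σ.nat 0 ≤ L)
    (hx : ∀ j < σ.nat 0, ∀ τ, RowEq k (σ.nat 1) σ τ → τ.nat 10 = j → x.Ev A L τ (f j)) :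
    Tr A L (.row k x) σ fun τ => RowEq k (σ.nat 1) σ τ ∧
      ∀ j < σ.nat 0, τ.array k (σ.nat 1) j = f j := by
  refine .loop (.var (by omega)) (by omega) (fun l τ => RowEq k (σ.nat 1) σ τ ∧
    ∀ j < l, τ.array k (σ.nat 1) j = f j) ⟨.refl _ _ _, by simp⟩ fun l hl τ ⟨h1, h2⟩ => ?_
  have h3 : RowEq k (σ.nat 1) σ (τ.setNat 10 l) :=
    ⟨fun i hi => (τ.setNat_nat_of_ne hi l).trans (h1.nat i hi), h1.array, h1.real⟩
  have h4 : (τ.setNat 10 l).nat 1 = σ.nat 1 := h3.nat 1 (by omega)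
  refine .set (.cell (.var_of_eq (by omega) h4) (.var_of_eq (by omega) (τ.setNat_nat_self 10 l))
    (by omega) hL) (hx l hl _ h3 (τ.setNat_nat_self 10 l)) ⟨⟨h3.nat, fun k' hk' i j hij => ?_,
      (State.setReal_real _ hk hk8 _ _ _).trans h3.real⟩, fun j hj => ?_⟩
  · rw [State.setReal_array _ hk8 hk', if_neg (by omega)]
    exact h3.array k' hk' i j hij
  · rw [State.setReal_array _ hk8 hk8]
    split_ifs with hjl
    · rw [hjl.2.2]
    · exact h2 j (by omega)

/-- The states agree up to the variables `10` and `11` and the array number `1`. -/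
structure MatrixEq (σ τ : State) : Prop where
  nat : ∀ i, i ≠ 10 → i ≠ 11 → τ.nat i = σ.nat i
  array : ∀ k, 1 < k → k < 8 → τ.array k = σ.array k
  real : τ.real 16 = σ.real 16

theorem MatrixEq.refl (σ : State) : MatrixEq σ σ := ⟨fun _ _ _ => rfl, fun _ _ _ => rfl, rfl⟩

theorem MatrixEq.setNat {τ : State} (h : MatrixEq σ τ) {v : ℕ} (hv : v = 10 ∨ v = 11) (k : ℕ) :
    MatrixEq σ (τ.setNat v k) :=
  ⟨fun i h1 h2 => (τ.setNat_nat_of_ne (by omega) k).trans (h.nat i h1 h2), h.array, h.real⟩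

/-- Write the values of `x` into the array number `1`. -/
def matrix (x : RealExpr) : Stmt :=
  .loop 10 (.var 0) (.loop 11 (.var 0) (.set (.cell 1 (.var 10) (.var 11)) x))

/-- Each entry is computed while its own old value is still present, which permits the in-place rank
one update of Q. -/
theorem Tr.matrix {x : RealExpr} {f : ℕ → ℕ → ℝ} (hL : 8 ≤ L) (h : 2 * σ.nat 0 ≤ L)
    (hx : ∀ i < σ.nat 0, ∀ j < σ.nat 0, ∀ τ, MatrixEq σ τ → τ.nat 10 = i → τ.nat 11 = j →
      τ.array 1 i j = σ.array 1 i j → x.Ev A L τ (f i j)) :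
    Tr A L (.matrix x) σ fun τ => MatrixEq σ τ ∧
      ∀ i < σ.nat 0, ∀ j < σ.nat 0, τ.array 1 i j = f i j := by
  refine (Tr.loop (.var (by omega)) (by omega) (fun k τ => MatrixEq σ τ ∧ ∀ i < σ.nat 0,
    ∀ j < σ.nat 0, τ.array 1 i j = if i < k then f i j else σ.array 1 i j)
    ⟨.refl σ, by simp⟩ fun k hk τ ⟨h1, h2⟩ => ?_).mono fun τ ⟨h1, h2⟩ =>
      ⟨h1, fun i hi j hj => by rw [h2 i hi j hj, if_pos hi]⟩
  have h3 := h1.setNat (Or.inl rfl) k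
  refine (Tr.loop (m := σ.nat 0) (.var_of_eq (by omega) (h3.nat 0 (by omega) (by omega)))
    (by omega) (fun l υ => (MatrixEq σ υ ∧ υ.nat 10 = k) ∧ ∀ i < σ.nat 0, ∀ j < σ.nat 0,
      υ.array 1 i j = if i < k ∨ i = k ∧ j < l then f i j else σ.array 1 i j)
    ⟨⟨h3, τ.setNat_nat_self 10 k⟩, ?_⟩ fun l hl υ ⟨⟨g1, g2⟩, g3⟩ => ?_).mono
      fun υ ⟨⟨g1, _⟩, g3⟩ => ⟨g1, fun i hi j hj => ?_⟩
  · simpa using h2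
  · have g4 := g1.setNat (Or.inr rfl) l
    have g5 : (υ.setNat 11 l).nat 10 = k := (υ.setNat_nat_of_ne (by omega) l).trans g2
    have g6 : (υ.setNat 11 l).nat 11 = l := υ.setNat_nat_self 11 l
    refine .set (.cell (.var_of_eq (by omega) g5) (.var_of_eq (by omega) g6) (by omega) hL)
      (hx k hk l hl _ g4 g5 g6 ?_) ⟨⟨⟨g4.nat, fun k' hk hk' => ?_, ?_⟩, g5⟩, fun i hi j hj => ?_⟩
    · exact (g3 k hk l hl).trans (by simp)
    · rw [← g4.array k' hk hk']
      funext i j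
      rw [State.setReal_array _ (by omega) hk', if_neg (by omega)]
    · exact (State.setReal_real _ (by omega) (by omega) _ _ _).trans g4.real
    · rw [State.setReal_array _ (by omega) (by omega)]
      split_ifs with e1 e2 e2
      · rw [e1.2.1, e1.2.2]
      · omega
      · exact (g3 i hi j hj).trans (if_pos (by omega))
      · exact (g3 i hi j hj).trans (if_neg (by omega))
  · rw [g3 i hi j hj]
    congr 1
    apply propext
    omega

/-! ### Deflation -/

/-- Multiply the current row of the array `2` by the matrix in the array `1`. -/
def apply : Stmt := .row 3 (.sum 11 (.var 0) (.mul (.entry 1 10 11) (.entry 2 1 11)))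

/-- Multiply the current row of the array `3` by the transpose of the matrix in the array `1`. -/
def applyTranspose : Stmt :=
  .row 2 (.div (.sum 11 (.var 0) (.mul (.entry 1 11 10) (.entry 3 1 11)))
    (.div (.mul (.get (.const 16)) (.get (.const 16))) (.nat (.const 2))))

/-- The memory during the deflation: `r` vectors have been found. -/
structure Holds {n : ℕ} (r : ℕ) (e : ℝ) (Q : Matrix (Fin n) (Fin n) ℝ) (σ : State) : Prop where
  nat_zero : σ.nat 0 = n
  nat_one : σ.nat 1 = r
  real : σ.real 16 = e
  matrix : ∀ i j : Fin n, σ.array 1 i j = Q i j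

variable {n r : ℕ} {e : ℝ} {Q : Matrix (Fin n) (Fin n) ℝ}

theorem Holds.rowEq (h : Holds r e Q σ) {k : ℕ} (hk : 1 < k) {τ : State}
    (hτ : RowEq k (σ.nat 1) σ τ) : Holds r e Q τ :=
  ⟨(hτ.nat 0 (by omega)).trans h.nat_zero, (hτ.nat 1 (by omega)).trans h.nat_one,
    hτ.real.trans h.real, fun i j => (hτ.array 1 (by omega) i j (by omega)).trans (h.matrix i j)⟩

/-- Only the current rows of the arrays `2` and `3` and the variables `9`, `10` have changed. -/
structure Frame (r : ℕ) (σ τ : State) : Prop where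
  nat : ∀ i, i ≠ 9 → i ≠ 10 → τ.nat i = σ.nat i
  array : ∀ k, k = 2 ∨ k = 3 → ∀ i, i ≠ r → τ.array k i = σ.array k i

theorem Frame.refl (r : ℕ) (σ : State) : Frame r σ σ := ⟨fun _ _ _ => rfl, fun _ _ _ _ => rfl⟩

theorem Frame.rowEq {τ υ : State} (h : Frame r σ τ) {k : ℕ} (hτ : RowEq k r τ υ) : Frame r σ υ :=
  ⟨fun i h1 h2 => (hτ.nat i h2).trans (h.nat i h1 h2), fun k' hk' i hi => by
    rw [← h.array k' hk' i hi]
    funext j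
    exact hτ.array k' (by omega) i j (Or.inr hi)⟩

theorem Tr.apply (h : Holds r e Q σ) {x : Fin n → ℝ} (hx : ∀ j : Fin n, σ.array 2 r j = x j)
    (hL : 8 ≤ L) (hr : r + 2 * n ≤ L) :
    Tr A L .apply σ fun τ => RowEq 3 r σ τ ∧ Holds r e Q τ ∧
      (∀ j : Fin n, τ.array 2 r j = x j) ∧ ∀ j : Fin n, τ.array 3 r j = (Q *ᵥ x) j := by
  obtain ⟨h0, h1, -, -⟩ := id h
  have hrow := Tr.row (A := A) (L := L) (σ := σ) (k := 3)
    (x := .sum 11 (.var 0) (.mul (.entry 1 10 11) (.entry 2 1 11)))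
    (f := fun i => ∑ j ∈ Finset.range n, σ.array 1 i j * σ.array 2 r j)
    (by omega) (by omega) hL (by omega) fun i hi τ hτ h10 => ?_
  · rw [h0, h1] at hrow
    refine hrow.mono fun τ ⟨g1, g2⟩ => ⟨g1, h.rowEq (by omega) (h1 ▸ g1), fun j => ?_, fun i => ?_⟩
    · exact (g1.array 2 (by omega) r j (by omega)).trans (hx j)
    · rw [g2 i i.2, Finset.sum_range]
      exact Finset.sum_congr rfl fun j _ => by rw [h.matrix, hx]
  · have e0 := hτ.nat 0 (by omega)
    have e1 := hτ.nat 1 (by omega)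
    refine .sum (.var_of_eq (by omega) (e0.trans h0)) (by omega) fun j hj => ?_
    have a1 := RealExpr.Ev.entry (A := A) (L := L) (σ := τ.setNat 11 j) (k := 1) (v := 10)
      (w := 11) (by omega) (by omega) (by omega) (by omega) hL (by simp; omega)
    have a2 := RealExpr.Ev.entry (A := A) (L := L) (σ := τ.setNat 11 j) (k := 2) (v := 1)
      (w := 11) (by omega) (by omega) (by omega) (by omega) hL (by simp; omega)
    refine (a1.mul a2).of_eq ?_
    simp [h10, e1, h1, hτ.array 1, hτ.array 2]

theorem Tr.applyTranspose (h : Holds r e Q σ) {y : Fin n → ℝ}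
    (hy : ∀ j : Fin n, σ.array 3 r j = y j) (hL : 8 ≤ L) (hr : r + 2 * n ≤ L) :
    Tr A L .applyTranspose σ fun τ => RowEq 2 r σ τ ∧ Holds r e Q τ ∧
      ∀ j : Fin n, τ.array 2 r j = ((e ^ 2 / 2)⁻¹ • (Qᵀ *ᵥ y)) j := by
  obtain ⟨h0, h1, -, -⟩ := id h
  have hrow := Tr.row (A := A) (L := L) (σ := σ) (k := 2)
    (x := .div (.sum 11 (.var 0) (.mul (.entry 1 11 10) (.entry 3 1 11)))
      (.div (.mul (.get (.const 16)) (.get (.const 16))) (.nat (.const 2))))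
    (f := fun i => (∑ j ∈ Finset.range n, σ.array 1 j i * σ.array 3 r j) / (e * e / 2))
    (by omega) (by omega) hL (by omega) fun i hi τ hτ h10 => ?_
  · rw [h0, h1] at hrow
    refine hrow.mono fun τ ⟨g1, g2⟩ => ⟨g1, h.rowEq (by omega) (h1 ▸ g1), fun i => ?_⟩
    rw [g2 i i.2, Finset.sum_range, Pi.smul_apply, smul_eq_mul, ← sq, div_eq_inv_mul]
    congr 1
    refine Finset.sum_congr rfl fun j _ => ?_
    rw [h.matrix, hy]
    rfl
  · have e0 := hτ.nat 0 (by omega)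
    have e1 := hτ.nat 1 (by omega)
    refine RealExpr.Ev.div (.sum (.var_of_eq (by omega) (e0.trans h0)) (by omega) fun j hj => ?_) ?_
    · have a1 := RealExpr.Ev.entry (A := A) (L := L) (σ := τ.setNat 11 j) (k := 1) (v := 11)
        (w := 10) (by omega) (by omega) (by omega) (by omega) hL (by simp; omega)
      have a2 := RealExpr.Ev.entry (A := A) (L := L) (σ := τ.setNat 11 j) (k := 3) (v := 1)
        (w := 11) (by omega) (by omega) (by omega) (by omega) hL (by simp; omega)
      refine (a1.mul a2).of_eq ?_
      simp [h10, e1, h1, hτ.array 1, hτ.array 3]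
    · have a1 := RealExpr.Ev.get (A := A) (L := L) (σ := τ) (.const 16) (by omega)
      refine ((a1.mul a1).div (.natConst 2)).of_eq ?_
      rw [hτ.real, h.real, Nat.cast_ofNat]

/-- Compute the image of the unit vector number `j`, for `j` in variable `5`, under a high power of
the Gram matrix, and the image of this vector under the matrix in the array `1`. -/
def power : Stmt :=
  -- In truncated arithmetic 1 - |i - j| is the indicator of i = j, so this row is a unit vector.
  .seq (.row 2 (.nat (.sub (.const 1) (.add (.sub (.var 10) (.var 5)) (.sub (.var 5) (.var 10))))))
    (.seq (.loop 9 (.add (.var 0) (.var 0)) (.seq .apply .applyTranspose)) .apply)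

theorem Holds.setNat (h : Holds r e Q σ) {v : ℕ} (hv : 1 < v) (k : ℕ) :
    Holds r e Q (σ.setNat v k) :=
  ⟨(σ.setNat_nat_of_ne (by omega) k).trans h.nat_zero,
    (σ.setNat_nat_of_ne (by omega) k).trans h.nat_one, h.real, h.matrix⟩

theorem Tr.power (h : Holds r e Q σ) {j : Fin n} (h5 : σ.nat 5 = j) (hL : 8 ≤ L)
    (hr : r + 2 * n ≤ L) :
    Tr A L .power σ fun τ => Frame r σ τ ∧ Holds r e Q τ ∧
      (∀ i : Fin n, τ.array 2 r i = (gram Q (e ^ 2 / 2) ^ (2 * n) *ᵥ Pi.single j 1) i) ∧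
      ∀ i : Fin n, τ.array 3 r i =
        (Q *ᵥ (gram Q (e ^ 2 / 2) ^ (2 * n) *ᵥ Pi.single j 1)) i := by
  obtain ⟨h0, h1, -, -⟩ := id h
  let I : ℕ → State → Prop := fun k τ => Frame r σ τ ∧ Holds r e Q τ ∧
    ∀ i : Fin n, τ.array 2 r i = (gram Q (e ^ 2 / 2) ^ k *ᵥ Pi.single j 1) i
  refine Tr.seq (Q := I 0) ?_ fun τ hτ => Tr.seq (Q := I (2 * n)) ?_ fun τ hτ => ?_
  · have hrow := Tr.row (A := A) (L := L) (σ := σ) (k := 2)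
      (x := .nat (.sub (.const 1) (.add (.sub (.var 10) (.var 5)) (.sub (.var 5) (.var 10)))))
      (f := fun i => ((1 - ((i - j) + (j - i)) : ℕ) : ℝ)) (by omega) (by omega) hL (by omega)
      fun i hi τ hτ h10 => ?_
    · rw [h0, h1] at hrow
      refine hrow.mono fun τ ⟨g1, g2⟩ => ⟨(Frame.refl r σ).rowEq g1,
        h.rowEq (by omega) (h1 ▸ g1), fun i => ?_⟩
      rw [g2 i i.2, pow_zero, one_mulVec, Pi.single_apply]
      split_ifs with hij
      · rw [hij]
        simp
      · have : (i : ℕ) ≠ j := fun h => hij (Fin.ext h)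
        rw [Nat.cast_eq_zero]
        omega
    · have e5 : τ.nat 5 = j := (hτ.nat 5 (by omega)).trans h5
      exact .nat ((NatExpr.Ev.const 1).sub
        (((NatExpr.Ev.var_of_eq (by omega) h10).sub (.var_of_eq (by omega) e5)).add
          ((NatExpr.Ev.var_of_eq (by omega) e5).sub (.var_of_eq (by omega) h10))))
  · refine .loop (m := 2 * n) (by
      rw [two_mul]
      exact (NatExpr.Ev.var_of_eq (by omega) hτ.2.1.nat_zero).add
        (.var_of_eq (by omega) hτ.2.1.nat_zero)) (by omega) I hτ fun k _ τ hτ => ?_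
    obtain ⟨g1, g2, g3⟩ := hτ
    refine (Tr.apply (g2.setNat (by omega) k) g3 hL hr).seq fun υ ⟨a1, a2, _, a3⟩ =>
      (Tr.applyTranspose a2 a3 hL hr).mono fun ω ⟨b1, b2, b3⟩ => ⟨?_, b2, fun i => ?_⟩
    · exact ((Frame.mk (fun i hi hi' => (τ.setNat_nat_of_ne hi k).trans (g1.nat i hi hi'))
        g1.array).rowEq a1).rowEq b1
    · rw [b3, pow_succ' (gram Q (e ^ 2 / 2)), ← mulVec_mulVec]
      generalize gram Q (e ^ 2 / 2) ^ k *ᵥ Pi.single j 1 = v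
      rw [Ising.gram, smul_mulVec, ← mulVec_mulVec]
  · obtain ⟨g1, g2, g3⟩ := hτ
    exact (Tr.apply g2 g3 hL hr).mono fun υ ⟨a1, a2, a3, a4⟩ => ⟨g1.rowEq a1, a2, a3, a4⟩

/-- One step of the deflation, for the unit vector with the number in variable `5`. -/
def deflate : Stmt :=
  -- Setting variable 20 is a no-op in place of a skip statement. The candidate sits in row r,
  -- behind the rows in use, so rejecting it requires no cleaning up.
  .seq .power (.ite (.normSq 2 1) (.nat (.const 1)) (.setNat 20 (.const 0))
    (.seq (.matrix (.sub (.entry 1 10 11)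
        (.div (.mul (.entry 3 1 10) (.entry 2 1 11)) (.normSq 2 1))))
      (.setNat 1 (.add (.var 1) (.const 1)))))

/-- The memory during the deflation of `M`. -/
structure Deflated (M : Matrix (Fin n) (Fin n) ℝ) (e : ℝ) (r : ℕ) (Q : Matrix (Fin n) (Fin n) ℝ)
    (σ : State) : Prop where
  holds : Holds r e Q σ
  deflation : Deflation M Q (e ^ 2 / 2) r (fun i j => σ.array 2 i j) fun i j => σ.array 3 i j

/-- The high power of the Gram matrix does not enlarge the unit vector number `j`. -/
def Small (e : ℝ) (Q : Matrix (Fin n) (Fin n) ℝ) (j : Fin n) : Prop :=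
  (gram Q (e ^ 2 / 2) ^ (2 * n) *ᵥ Pi.single j 1) ⬝ᵥ
    (gram Q (e ^ 2 / 2) ^ (2 * n) *ᵥ Pi.single j 1) ≤ 1

variable {M : Matrix (Fin n) (Fin n) ℝ}

theorem Deflated.setNat (h : Deflated M e r Q σ) {v : ℕ} (hv : 1 < v) (k : ℕ) :
    Deflated M e r Q (σ.setNat v k) := ⟨h.holds.setNat hv k, h.deflation⟩

theorem _root_.Ising.Deflation.congr {ι : Type*} [Fintype ι] {A Q : Matrix ι ι ℝ} {c : ℝ} {r : ℕ}
    {V W V' W' : ℕ → ι → ℝ} (h : Deflation A Q c r V W) (hV : ∀ i < r, V' i = V i)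
    (hW : ∀ i < r, W' i = W i) : Deflation A Q c r V' W' where
  orth i hi k hk hik := by rw [hV i hi, hV k hk, h.orth i hi k hk hik]
  pos i hi := by rw [hV i hi]; exact h.pos i hi
  ker i hi := by rw [hV i hi, h.ker i hi]
  image i hi := by rw [hV i hi, hW i hi, h.image i hi]
  large i hi := by rw [hV i hi, hW i hi]; exact h.large i hi
  decomp := h.decomp.trans (congrArg (Q + ·) (Finset.sum_congr rfl fun i hi => by
    rw [hV i (Finset.mem_range.1 hi), hW i (Finset.mem_range.1 hi)]))

theorem Tr.deflate (he : 0 < e) (h : Deflated M e r Q σ) {j : Fin n} (h5 : σ.nat 5 = j)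
    (hL : 8 ≤ L) (hr : r + 2 * n ≤ L) :
    Tr A L .deflate σ fun τ => (Small e Q j ∧ Deflated M e r Q τ) ∨
      (¬ Small e Q j ∧ ∃ Q', Deflated M e (r + 1) Q' τ) := by
  have hn : 0 < n := j.pos
  refine (Tr.power h.holds h5 hL hr).seq fun τ ⟨g1, g2, g3, g4⟩ => ?_
  obtain ⟨h0, h1, he', hQ⟩ := id g2
  set x := gram Q (e ^ 2 / 2) ^ (2 * n) *ᵥ Pi.single j 1 with hx
  have hnorm : ∀ υ : State, υ.nat 0 = n → υ.nat 1 = r → υ.array 2 = τ.array 2 →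
      (RealExpr.normSq 2 1).Ev A L υ (x ⬝ᵥ x) := by
    intro υ e0 e1 e2
    refine (RealExpr.Ev.normSq (by omega) (by omega) (by omega) (by omega) hL (by omega)).of_eq ?_
    rw [normSq_eq_dotProduct, e0, e1, e2]
    congr 1 <;> exact funext g3
  refine .ite (hnorm τ h0 h1 rfl) (.natConst 1) (fun hle => ?_) fun hlt => ?_
  · rw [Nat.cast_one] at hle
    refine .setNat (.const 0) (Or.inl ⟨hle, Deflated.setNat ⟨g2, h.deflation.congr
      (fun i hi => ?_) fun i hi => ?_⟩ (by omega) 0⟩)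
    · funext k
      rw [g1.array 2 (by omega) i hi.ne]
    · funext k
      rw [g1.array 3 (by omega) i hi.ne]
  rw [Nat.cast_one] at hlt
  have hmat := Tr.matrix (A := A) (L := L) (σ := τ)
    (x := .sub (.entry 1 10 11) (.div (.mul (.entry 3 1 10) (.entry 2 1 11)) (.normSq 2 1)))
    (f := fun i k => τ.array 1 i k - τ.array 3 r i * τ.array 2 r k / (x ⬝ᵥ x)) hL (by omega)
    fun i hi k hk υ hυ h10 h11 hown => ?_
  · refine hmat.seq fun υ ⟨a1, a2⟩ => ?_
    have u0 := (a1.nat 0 (by omega) (by omega)).trans h0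
    have u1 := (a1.nat 1 (by omega) (by omega)).trans h1
    refine .setNat ((NatExpr.Ev.var_of_eq (by omega) u1).add (.const 1)) (Or.inr ⟨hlt, _, ⟨⟨?_, ?_,
      a1.real.trans he', fun i k => rfl⟩, ?_⟩⟩)
    · rw [State.setNat_nat_of_ne _ (by omega), u0]
    · rw [State.setNat_nat_self]
    · refine h.deflation.succ (e := Pi.single j 1) (k := 2 * n - 1) (x := x) (by positivity)
        (by simp) ?_ (not_le.1 hlt) (fun i hi => ?_) (fun i hi => ?_) ?_ ?_ ?_
      · rw [Nat.sub_add_cancel (by omega)]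
      · funext k
        rw [State.setNat_array, a1.array 2 (by omega) (by omega), g1.array 2 (by omega) i hi.ne]
      · funext k
        rw [State.setNat_array, a1.array 3 (by omega) (by omega), g1.array 3 (by omega) i hi.ne]
      · funext k
        rw [State.setNat_array, a1.array 2 (by omega) (by omega), g3]
      · funext k
        rw [State.setNat_array, a1.array 3 (by omega) (by omega), g4]
      · ext i k
        rw [State.setNat_array, a2 i (by omega) k (by omega), hQ, g3, g4]
        simp only [Matrix.sub_apply, Matrix.smul_apply, vecMulVec_apply, smul_eq_mul]
        ring
  · have u0 := (hυ.nat 0 (by omega) (by omega)).trans h0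
    have u1 := (hυ.nat 1 (by omega) (by omega)).trans h1
    have b1 := RealExpr.Ev.entry (A := A) (L := L) (σ := υ) (k := 1) (v := 10)
      (w := 11) (by omega) (by omega) (by omega) (by omega) hL (by omega)
    have b2 := RealExpr.Ev.entry (A := A) (L := L) (σ := υ) (k := 3) (v := 1)
      (w := 10) (by omega) (by omega) (by omega) (by omega) hL (by omega)
    have b3 := RealExpr.Ev.entry (A := A) (L := L) (σ := υ) (k := 2) (v := 1)
      (w := 11) (by omega) (by omega) (by omega) (by omega) hL (by omega)
    rw [h10, h11, hown] at b1
    rw [u1, h10, hυ.array 3 (by omega) (by omega)] at b2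
    rw [u1, h11, hυ.array 2 (by omega) (by omega)] at b3
    exact b1.sub ((b2.mul b3).div (hnorm υ u0 u1 (hυ.array 2 (by omega) (by omega))))

/-- The deflation. -/
def deflation : Stmt := .loop 4 (.var 0) (.loop 5 (.var 0) .deflate)

/-- The final rank is not known in advance. A pass over all unit vectors either increases r, or
leaves Q unchanged and certifies every unit vector as small, a condition later passes preserve. As r
stays below n, the second case has occurred within n passes. -/
theorem Tr.deflation (he : 0 < e)
    (hM : ∀ r Q V W, Deflation M Q (e ^ 2 / 2) r V W → r < n) (h : Deflated M e r Q σ)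
    (hL : 8 ≤ L) (hn : 3 * n ≤ L) :
    Tr A L .deflation σ fun τ => ∃ r Q, Deflated M e r Q τ ∧ ∀ j, Small e Q j := by
  refine (Tr.loop (.var_of_eq (by omega) h.holds.nat_zero) (by omega)
    (fun k τ => ∃ r Q, Deflated M e r Q τ ∧ (k ≤ r ∨ ∀ j, Small e Q j)) ⟨r, Q, h, by simp⟩
    fun k _ τ ⟨r, Q, g1, g2⟩ => ?_).mono fun τ ⟨r, Q, g1, g2⟩ =>
      ⟨r, Q, g1, g2.resolve_left (hM _ _ _ _ g1.deflation).not_ge⟩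
  refine (Tr.loop (m := n) (.var_of_eq (by omega) (g1.setNat (by omega) k).holds.nat_zero)
    (by omega) (fun l τ => ∃ r' Q', Deflated M e r' Q' τ ∧
      ((r' = r ∧ Q' = Q ∧ ∀ j : Fin n, (j : ℕ) < l → Small e Q j) ∨
        (r < r' ∧ ¬ ∀ j, Small e Q j)))
    ⟨r, Q, g1.setNat (by omega) k, Or.inl ⟨rfl, rfl, fun j hj => absurd hj (by omega)⟩⟩
    fun l hl υ ⟨r', Q', a1, a2⟩ => ?_).mono fun τ ⟨r', Q', a1, a2⟩ => ?_
  · have hr' := hM _ _ _ _ a1.deflation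
    refine (Tr.deflate (j := ⟨l, hl⟩) he (a1.setNat (by omega) l) (υ.setNat_nat_self 5 l) hL
      (by omega)).mono fun ω hω => ?_
    rcases hω with ⟨b1, b2⟩ | ⟨b1, Q'', b2⟩
    · refine ⟨r', Q', b2, a2.imp_left fun ⟨c1, c2, c3⟩ => ⟨c1, c2, fun j hj => ?_⟩⟩
      rcases Nat.lt_succ_iff_lt_or_eq.1 hj with hj | hj
      · exact c3 j hj
      · rw [← c2, show j = ⟨l, hl⟩ from Fin.ext hj]
        exact b1
    · refine ⟨r' + 1, Q'', b2, Or.inr ?_⟩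
      rcases a2 with ⟨c1, c2, -⟩ | ⟨c1, c2⟩
      · exact ⟨by omega, fun hs => b1 (c2 ▸ hs _)⟩
      · exact ⟨by omega, c2⟩
  · refine ⟨r', Q', a1, ?_⟩
    rcases a2 with ⟨rfl, rfl, c⟩ | ⟨c1, c2⟩
    · exact Or.inr fun j => c j j.2
    · exact Or.inl ((g2.resolve_right c2).trans_lt c1)

end Stmt

end RealRAM

/-! ### The complete algorithm -/

namespace RealRAM

open Function Ising Matrix

namespace Stmt

variable {A : ℕ → ℕ → ℝ} {L : ℕ} {σ : State}

/-- The number of grid points for one coordinate. -/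
def gridSize : Stmt :=
  let q : RealExpr := .div .rayleigh (.mul (.get (.const 16)) (.get (.const 16)))
  .seq (.setNat 2 (.const 1)) (.loop 10 (.var 0) (.ite (.mul (.nat (.const 2000)) (.mul q q))
    (.nat (.var 10)) (.setNat 20 (.const 0)) (.setNat 2 (.add (.var 2) (.const 1)))))

/-- Reals cannot be rounded by the machine, so the ceiling is obtained by counting the k < n with k
< κ; as κ ≤ n, this counts all of them. -/
theorem Tr.gridSize {κ : ℝ} (hκ : κ = 2000 * (rayleigh (σ.nat 0) (σ.nat 1) (σ.array 2)
    (σ.array 3) / σ.real 16 ^ 2) ^ 2) (hκn : κ ≤ σ.nat 0) (hL : 8 ≤ L)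
    (h : σ.nat 1 + σ.nat 0 ≤ L) : Tr A L .gridSize σ fun τ => τ.nat 0 = σ.nat 0 ∧
      τ.nat 1 = σ.nat 1 ∧ τ.real = σ.real ∧ τ.nat 2 = 1 + ⌈κ⌉₊ := by
  let I : ℕ → State → Prop := fun k τ => τ.nat 0 = σ.nat 0 ∧ τ.nat 1 = σ.nat 1 ∧
    τ.real = σ.real ∧ τ.nat 2 = 1 + min k ⌈κ⌉₊
  refine Tr.seq (Q := I 0) (.setNat (.const 1) ⟨?_, ?_, rfl, ?_⟩) fun τ hτ => ?_
  · exact σ.setNat_nat_of_ne (by omega) 1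
  · exact σ.setNat_nat_of_ne (by omega) 1
  · simp
  refine (Tr.loop (.var_of_eq (by omega) hτ.1) (by omega) I hτ
    fun k hk υ ⟨h0, h1, h2, h3⟩ => ?_).mono fun υ ⟨h0, h1, h2, h3⟩ => ⟨h0, h1, h2, ?_⟩
  · have u0 := (υ.setNat_nat_of_ne (show 0 ≠ 10 by omega) k).trans h0
    have u1 := (υ.setNat_nat_of_ne (show 1 ≠ 10 by omega) k).trans h1
    have u2 := (υ.setNat_nat_of_ne (show 2 ≠ 10 by omega) k).trans h3
    have ur : (υ.setNat 10 k).real = σ.real := h2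
    have ua : (υ.setNat 10 k).array = σ.array := by
      funext k' i j
      exact congrFun ur _
    have hget := RealExpr.Ev.get (A := A) (L := L) (σ := υ.setNat 10 k) (.const 16) (by omega)
    have hray := RealExpr.Ev.rayleigh (A := A) (L := L) (σ := υ.setNat 10 k) hL (by omega)
    have hq := hray.div (hget.mul hget)
    refine .ite (((RealExpr.Ev.natConst 2000).mul (hq.mul hq)).of_eq (b := κ) ?_)
      (.nat (.var_of_eq (by omega) (υ.setNat_nat_self 10 k))) (fun hle => ?_) fun hlt => ?_
    · rw [u0, u1, ur, ua, hκ, Nat.cast_ofNat, sq (σ.real 16), sq (_ / _)]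
    · refine .setNat (.const 0) ⟨?_, ?_, h2, ?_⟩
      · rwa [State.setNat_nat_of_ne _ (by omega)]
      · rwa [State.setNat_nat_of_ne _ (by omega)]
      · have := Nat.ceil_le.2 hle
        rw [State.setNat_nat_of_ne _ (by omega), u2]
        omega
    · refine .setNat ((NatExpr.Ev.var_of_eq (by omega) u2).add (.const 1)) ⟨?_, ?_, h2, ?_⟩
      · rwa [State.setNat_nat_of_ne _ (by omega)]
      · rwa [State.setNat_nat_of_ne _ (by omega)]
      · have := Nat.lt_ceil.2 (not_le.1 hlt)
        rw [State.setNat_nat_self]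
        omega
  · rw [h3, min_eq_right (Nat.ceil_le.2 hκn)]

/-- The algorithm. -/
def algorithm : Stmt :=
  .seq (.set (.const 16) (.mul (.get (.const 0))
      (.sum 10 (.var 0) (.abs (.probe (.const 0) (.var 10))))))
    (.seq (.matrix (.probe (.var 10) (.var 11)))
      (.seq .deflation (.seq .gridSize (.set (.const 0) .value))))

/-- The parameter J' is not part of the input, but by regularity it is the absolute sum of row 0.
The grid parameters K and r are only determined at run time, so `L` is required to dominate K ^ r
for all values that the error analysis allows. -/
theorem Tr.algorithm {n : ℕ} (M : IsingModel n) {J' ε : ℝ} (hreg : M.IsRegular J') (hJ' : 1 ≤ J')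
    (hε : 0 < ε) (hn : 0 < n)
    (h : (2 : ℝ) ^ (10000 * (M.thresholdRank J' (ε / 2) / ε ^ 2)) ≤ n) (hL : 401 * n + 8 ≤ L)
    (hL' : ∀ K r : ℕ, (K : ℝ) ≤ 2 + 8000 * (M.thresholdRank J' (ε / 2) / ε ^ 2) ^ 2 →
      (r : ℝ) ≤ 4 * (M.thresholdRank J' (ε / 2) / ε ^ 2) → K ^ r ≤ L) :
    Tr M.entry L .algorithm (initial n ε)
      fun τ => |τ.real 0 - Real.log M.partitionFunction| ≤ ε * M.l1Norm := by
  have hJ0 : 0 < J' := by linarith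
  have he : 0 < ε * J' := mul_pos hε hJ0
  set s := M.thresholdRank J' (ε / 2) / ε ^ 2 with hs
  have hs0 : 0 ≤ s := div_nonneg (thresholdRank_nonneg M _) (sq_nonneg ε)
  obtain ⟨-, -, hsn, hsn', -⟩ := bounds_of_two_rpow_le hs0 hε h
    (one_le_card_mul_sq M hreg hJ' hε hn h)
  have hM : ∀ r Q V W, Deflation M.J Q ((ε * J') ^ 2 / 2) r V W → r < n := fun r Q V W hd => by
    have := (Deflation.bounds M hJ0 hε hd).2.2
    exact_mod_cast this.trans_lt hsn'
  have hinit : (initial n ε).nat 0 = n := by simp [initial]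
  refine Tr.seq (Q := fun τ => τ.nat 0 = n ∧ τ.nat 1 = 0 ∧ τ.real 16 = ε * J')
    (.set (.const 16) (v := ε * J') ?_ ⟨hinit, by simp [State.setReal, initial],
      by simp [State.setReal]⟩) fun τ ⟨h0, h1, hr⟩ => ?_
  · have hsum := RealExpr.Ev.sum (A := M.entry) (L := L) (σ := initial n ε) (v := 10) (m := n)
      (f := fun j => |M.entry 0 j|) (x := .abs (.probe (.const 0) (.var 10)))
      (.var_of_eq (by omega) hinit) (by omega) fun j _ => RealExpr.Ev.abs (.probe (.const 0)
        (.var_of_eq (by omega) (State.setNat_nat_self _ _ _)))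
    refine ((RealExpr.Ev.get (.const 0) (by omega)).mul hsum).of_eq ?_
    rw [Finset.sum_range, ← hreg ⟨0, hn⟩]
    simp [initial, IsingModel.entry, hn]
  have hmat := Tr.matrix (A := M.entry) (L := L) (σ := τ) (x := .probe (.var 10) (.var 11))
    (f := M.entry) (by omega) (by omega) fun i _ j _ υ _ h10 h11 _ =>
      .probe (.var_of_eq (by omega) h10) (.var_of_eq (by omega) h11)
  refine hmat.seq fun υ ⟨g1, g2⟩ => ?_
  have hdef : Deflated M.J (ε * J') 0 M.J υ :=
    ⟨⟨(g1.nat 0 (by omega) (by omega)).trans h0, (g1.nat 1 (by omega) (by omega)).trans h1,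
      g1.real.trans hr, fun i j => by
        rw [g2 i (by omega) j (by omega)]
        simp [IsingModel.entry]⟩, .zero _ _ _ _⟩
  refine (Tr.deflation he hM hdef (by omega) (by omega)).seq
    fun ω ⟨r, Q, ⟨⟨e0, e1, e2, e3⟩, hd⟩, hsmall⟩ => ?_
  have hrn := hM _ _ _ _ hd
  obtain ⟨b1, b2, b3⟩ := Deflation.bounds M hJ0 hε hd
  have hray : rayleigh n r (ω.array 2) (ω.array 3) / (ε * J') ^ 2 ≤ 2 * s := by
    refine le_trans (le_of_eq ?_) b2
    simp only [rayleigh, normSq_eq_dotProduct]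
  have hray0 : 0 ≤ rayleigh n r (ω.array 2) (ω.array 3) / (ε * J') ^ 2 := by
    have : (0 : ℝ) ≤ r := r.cast_nonneg
    refine le_trans ?_ (b1.trans_eq ?_)
    · positivity
    · simp only [rayleigh, normSq_eq_dotProduct]
  set κ := 2000 * (rayleigh n r (ω.array 2) (ω.array 3) / (ε * J') ^ 2) ^ 2 with hκ
  have hκs : κ ≤ 8000 * s ^ 2 := by nlinarith
  have hκ0 : 0 ≤ κ := by positivity
  refine (Tr.gridSize (κ := κ) (by rw [e0, e1, e2]) (by rw [e0]; linarith) (by omega)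
    (by omega)).seq fun υ ⟨u0, u1, u2, u3⟩ => ?_
  rw [e0] at u0
  rw [e1] at u1
  have hK2 : ((1 + ⌈κ⌉₊ : ℕ) : ℝ) ≤ 2 + κ := by
    push_cast
    linarith [Nat.ceil_lt_add_one hκ0]
  have hK1 : κ ≤ (1 + ⌈κ⌉₊ : ℕ) := by
    push_cast
    linarith [Nat.le_ceil κ]
  have hKn : ⌈κ⌉₊ ≤ n := Nat.ceil_le.2 (by linarith)
  have hB : υ.Bounded L := ⟨by omega, by omega, by omega, by omega, by
    rw [u1, u3]
    exact hL' _ _ (by linarith) b3⟩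
  obtain ⟨v, hv, hv1, hv2⟩ := RealExpr.Ev.value (A := M.entry) hB
  have ua : υ.array = ω.array := by
    funext k i j
    exact congrFun u2 _
  rw [u0, u1, u3, u2, ua, e2] at hv1 hv2
  refine .set (.const 0) hv ?_
  rw [show (υ.setReal 0 v).real 0 = v by simp [State.setReal]]
  exact abs_sub_log_partitionFunction_le M hreg hJ' hε hn h hd hsmall (by omega) hK1 hK2 hv1 hv2

end Stmt

end RealRAM

/-! ### Running time -/

namespace RealRAM

open Real

/-- From 2 + 8000 s² ≤ (2 + s)^15 and r ≤ 4s; the exponent is 60 = 15 · 4. -/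
theorem pow_le_two_add_rpow {s : ℝ} (hs : 0 ≤ s) {K r : ℕ} (hK : (K : ℝ) ≤ 2 + 8000 * s ^ 2)
    (hr : (r : ℝ) ≤ 4 * s) : (K : ℝ) ^ r ≤ (2 + s) ^ (60 * s) := by
  have h15 : 2 + 8000 * s ^ 2 ≤ (2 + s) ^ 15 := by
    have h13 : (8192 : ℝ) ≤ (2 + s) ^ 13 := by
      calc (8192 : ℝ) = 2 ^ 13 := by norm_num
        _ ≤ _ := pow_le_pow_left₀ two_pos.le (by linarith) 13
    calc 2 + 8000 * s ^ 2 ≤ 8192 * (2 + s) ^ 2 := by nlinarith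
      _ ≤ (2 + s) ^ 13 * (2 + s) ^ 2 := by gcongr
      _ = _ := by ring
  calc (K : ℝ) ^ r ≤ ((2 + s) ^ 15) ^ r := by gcongr; exact hK.trans h15
    _ = (2 + s) ^ (15 * r : ℝ) := by
      rw [← pow_mul, ← rpow_natCast]
      push_cast
      rfl
    _ ≤ _ := rpow_le_rpow_of_exponent_le (by linarith) (by linarith)

theorem add_pow_le_two_pow_mul {x y : ℝ} (hx : 0 ≤ x) (hy : 0 ≤ y) (l : ℕ) :
    (x + y) ^ l ≤ 2 ^ l * (x ^ l + y ^ l) := by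
  rcases le_total x y with h | h
  · calc (x + y) ^ l ≤ (2 * y) ^ l := by gcongr; linarith
      _ = 2 ^ l * (0 + y ^ l) := by ring
      _ ≤ _ := by gcongr; positivity
  · calc (x + y) ^ l ≤ (2 * x) ^ l := by gcongr; linarith
      _ = 2 ^ l * (x ^ l + 0) := by ring
      _ ≤ _ := by gcongr; positivity

/-- The exponential term of the claim carries no constant factor. The factor c in front of Y ^ l is
absorbed by c Y^l ≤ c² + Y^(2l), which doubles the exponent from 60 to 120 and sends c² to the
polynomial part. -/
theorem steps_le {a l n T : ℕ} {s m : ℝ} (hs : 0 ≤ s) (hn : 1 ≤ n) (hm : (n : ℝ) ≤ m)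
    (hT : T ≤ a * (401 * n + 8 + ⌊(2 + s) ^ (60 * s)⌋₊ + 1) ^ l) :
    (T : ℝ) ≤ (2 : ℝ) ^ (120 * l / log 2 * s * log (2 + s) ^ 1) +
      ((a * 2 ^ l) ^ 2 + a * 2 ^ l * 410 ^ l) * m ^ l := by
  set Y := (2 + s) ^ (60 * s) with hY
  have hY0 : 0 ≤ Y := by positivity
  have hn' : (1 : ℝ) ≤ n := by exact_mod_cast hn
  have hpow : (2 : ℝ) ^ (120 * l / log 2 * s * log (2 + s) ^ 1) = (Y ^ l) ^ 2 := by
    have hlog : log 2 ≠ 0 := (log_pos one_lt_two).ne'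
    rw [hY, rpow_def_of_pos two_pos, rpow_def_of_pos (by linarith), ← exp_nat_mul, ← exp_nat_mul]
    congr 1
    push_cast
    field_simp
    ring
  have h1 : (T : ℝ) ≤ a * (410 * n + Y) ^ l := by
    have h : (T : ℝ) ≤ a * (401 * n + 8 + ⌊Y⌋₊ + 1) ^ l := by exact_mod_cast hT
    refine h.trans (mul_le_mul_of_nonneg_left (pow_le_pow_left₀ (by positivity) ?_ l)
      a.cast_nonneg)
    linarith [Nat.floor_le hY0]
  have h2 := add_pow_le_two_pow_mul (x := 410 * n) (by positivity) hY0 l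
  have hml : (n : ℝ) ^ l ≤ m ^ l := by gcongr
  have hm1 : (1 : ℝ) ≤ m ^ l := one_le_pow₀ (hn'.trans hm)
  set c : ℝ := a * 2 ^ l with hc
  have hc0 : 0 ≤ c := by positivity
  rw [hpow]
  calc (T : ℝ) ≤ a * (2 ^ l * ((410 * n) ^ l + Y ^ l)) := h1.trans (by gcongr)
    _ = c * 410 ^ l * n ^ l + c * Y ^ l := by rw [mul_pow]; ring
    _ ≤ c * 410 ^ l * m ^ l + (c ^ 2 * m ^ l + (Y ^ l) ^ 2) := by
      gcongr
      nlinarith [sq_nonneg (c - Y ^ l), sq_nonneg c, sq_nonneg (Y ^ l)]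
    _ = _ := by ring

end RealRAM

theorem mainTheorem4 :
    ∃ (C : ℝ) (p : RealRAM.Program) (A B : ℝ) (k l : ℕ), 0 < C ∧
      ∀ (ε : ℝ), 0 < ε → ∀ (n : ℕ) (M : IsingModel n) (J' : ℝ), M.IsRegular J' → 1 ≤ J' →
        ∀ t : ℝ, t = M.thresholdRank J' (ε / 2) →
          (2 : ℝ) ^ (C * t / ε ^ 2) ≤ (n : ℝ) →
            ∃ (T : ℕ) (out : ℝ), RealRAM.Computes p M ε T out ∧
              |out - Real.log M.partitionFunction| ≤ ε * M.l1Norm ∧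
              (T : ℝ) ≤ (2 : ℝ) ^ (A * (t / ε ^ 2) * Real.log (2 + t / ε ^ 2) ^ k)
                + B * ((n : ℝ) + t + 1 / ε + 1) ^ l := by
  obtain ⟨a, l, hcomp⟩ := RealRAM.Stmt.algorithm.exists_computes
  refine ⟨10000, RealRAM.Stmt.algorithm.compile 0, 120 * l / Real.log 2,
    (a * 2 ^ l) ^ 2 + a * 2 ^ l * 410 ^ l, 1, l, by norm_num, ?_⟩
  rintro ε hε n M J' hreg hJ' t rfl h
  rw [mul_div_assoc] at h
  have ht := Ising.thresholdRank_nonneg (J' := J') M (ε / 2)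
  have hs : 0 ≤ M.thresholdRank J' (ε / 2) / ε ^ 2 := div_nonneg ht (sq_nonneg ε)
  -- The case n = 0 is excluded by the hypothesis, as the power of 2 is positive.
  have hn : 0 < n := by
    have : (0 : ℝ) < n := (Real.rpow_pos_of_pos two_pos _).trans_le h
    exact_mod_cast this
  obtain ⟨hok, hout⟩ := RealRAM.Stmt.Tr.algorithm M hreg hJ' hε hn h
    (L := 401 * n + 8 + ⌊(2 + M.thresholdRank J' (ε / 2) / ε ^ 2) ^
      (60 * (M.thresholdRank J' (ε / 2) / ε ^ 2))⌋₊) (by omega) fun K r hK hr => by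
    have := Nat.le_floor (α := ℝ) (n := K ^ r) (by
      push_cast
      exact RealRAM.pow_le_two_add_rpow hs hK hr)
    omega
  obtain ⟨T, hT, hTle⟩ := hcomp n M ε _ hok
  refine ⟨T, _, hT, hout, RealRAM.steps_le hs hn ?_ hTle⟩
  have : 0 < 1 / ε := by positivity
  linarith
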